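/- Let $\Sigma\subset\mathbb{C}$ be a compact set with connected complement, let $\mu$ be a Borel probability measure with $\mu(\mathbb{C}\setminus\Sigma)=0$, and let $f$ be holomorphic on an open set $V\supset\Sigma$. Put $$P(\mu;z)=\int -\log|z-\zeta|\,d\mu(\zeta)\in(-\infty,+\infty],\qquad r_0=\inf_{z\in\Sigma}e^{-P(\mu;z)},\qquad E_\mu(r)=\{z\in\mathbb{C}: e^{-P(\mu;z)}<r\}.$$ Fix an integer $m\ge 0$; poles are counted with multiplicity. Let $R_{\mu,m}\in(0,+\infty]$ be the supremum of the real numbers $r>r_0$ such that $f$ admits a meromorphic continuation with at most $m$ poles to $E_\mu(r)$, i.e. such that there is a meromorphic function $F$ on $E_\mu(r)$ with at most $m$ poles which coincides with $f$ in a neighbourhood of every point of $\Sigma\cap E_\mu(r)$. Put $D_{\mu,m}=E_\mu(R_{\mu,m})$ (so $D_{\mu,m}=\mathbb{C}$ if $R_{\mu,m}=+\infty$). Assume that the continuation of $f$ is single-valued in the following sense: for every real $r>r_0$, if there is a meromorphic function with at most $m$ poles on $E_\mu(r)$ which coincides with $f$ in a neighbourhood of every point of $\operatorname{supp}\mu\cap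 E_\mu(r)$, then there is one which coincides with $f$ in a neighbourhood of every point of $\Sigma\cap E_\mu(r)$. (For instance, this holds if $\operatorname{supp}\mu=\Sigma$, if every connected component of $\Sigma\cap E_\mu(r)$ meets $\operatorname{supp}\mu$ for all $r>r_0$, or if $f$ is the restriction of a meromorphic function on $\mathbb{C}$.) Let $w_n(z)=\prod_{i=1}^n(z-\alpha_{n,i})$, with all $\alpha_{n,i}\in\Sigma$, form a newtonian table, i.e. $w_n$ divides $w_{n+1}$ for all $n$, and suppose that $\mu$ is its asymptotic zero distribution: the normalized zero counting measures of $w_n$ converge to $\mu$ in the weak-* topology. For every $n\ge m$ there are polynomials $P_n,Q_n$ with $$\deg P_n\le n-m,\quad \deg Q_n\le m,\quad Q_n\not\equiv0,\quad (Q_nf-P_n)/w_{n+1}\ \text{holomorphic on } V,$$ and $Q_n$ may be taken normalized, i.e. $Q_n(z)=\prod_{|\zeta|\le1}(z-\zeta)\prod_{|\zeta|>1}(1-z/\zeta)$, the products being over the zeros $\zeta$ of $Q_n$ with multiplicity. Call any such pair admissible and let $\Pi_{n,m}=P_n/Q_n$ be the multipoint Padé approximant, with values in the Riemann sphere (after cancellation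 of common factors). Then: 1. For every $z\in\mathbb{C}\setminus(\overline{D_{\mu,m}}\cup\Sigma)$ the sequence $\{\Pi_{n,m}(z)\}_{n\ge m}$ diverges, i.e. has no limit in $\mathbb{C}$. 2. For any choice of admissible pairs $(P_n,Q_n)$ with $Q_n$ normalized (common zeros of $P_n$ and $Q_n$ are not cancelled), there are numbers $A_n\in\mathbb{C}$ with $$\Pi_{n+1,m}-\Pi_{n,m}=\frac{A_n\,w_{n+1}}{Q_nQ_{n+1}}\quad(n\ge m),\qquad\text{and}\qquad \frac1{R_{\mu,m}}=\limsup_{n\to\infty}|A_n|^{1/n},$$ where $1/(+\infty)=0$. -/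

import Mathlib

open Filter Topology MeasureTheory Polynomial
open scoped ENNReal NNReal

noncomputable section

/-- The logarithmic potential `P(μ; z) = ∫ -log |z - ζ| dμ(ζ)`, with values in `[-∞, +∞]`, written
as the integral of the positive part of the integrand minus that of its negative part. Here
`-log 0 = +∞`. For finite measures with compact support the second integral is finite. -/
def logPotential (μ : Measure ℂ) (z : ℂ) : EReal :=
  ((∫⁻ ζ, (-ENNReal.log ‖z - ζ‖ₑ).toENNReal ∂μ : ℝ≥0∞) : EReal)
    - ((∫⁻ ζ, (ENNReal.log ‖z - ζ‖ₑ).toENNReal ∂μ : ℝ≥0∞) : EReal)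

/-- The function `z ↦ exp (-P(μ; z))`. -/
def expNegPotential (μ : Measure ℂ) (z : ℂ) : ℝ≥0∞ :=
  EReal.exp (-logPotential μ z)

/-- The set `E_μ(r) = {z ∈ ℂ : exp (-P(μ; z)) < r}`. For `r = ∞` this is the whole plane when `μ`
is a finite measure with compact support. -/
def potentialSublevel (μ : Measure ℂ) (r : ℝ≥0∞) : Set ℂ :=
  {z | expNegPotential μ z < r}

/-- The number `r₀`, the infimum of `exp (-P(μ; ·))` on `S`. -/
def potentialInf (S : Set ℂ) (μ : Measure ℂ) : ℝ≥0∞ :=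
  ⨅ z ∈ S, expNegPotential μ z

/-- `F` is meromorphic on `U` and has at most `m` poles there, counting multiplicities. -/
def IsMeromorphicWithAtMost (F : ℂ → ℂ) (U : Set ℂ) (m : ℕ) : Prop :=
  MeromorphicOn F U ∧
    ∀ T : Finset ℂ, (T : Set ℂ) ⊆ U →
      ∑ z ∈ T, max 0 (-(meromorphicOrderAt F z).untop₀) ≤ (m : ℤ)

/-- The function `f`, given near the set `A`, admits a meromorphic continuation with at most `m`
poles on `U`: some meromorphic function on `U` with at most `m` poles coincides with `f` on a
neighbourhood of each point of `A ∩ U`. -/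
def HasMeromorphicContinuation (f : ℂ → ℂ) (A U : Set ℂ) (m : ℕ) : Prop :=
  ∃ F : ℂ → ℂ, IsMeromorphicWithAtMost F U m ∧ ∀ z ∈ A ∩ U, F =ᶠ[𝓝 z] f

/-- The number `R_{μ,m} ∈ [0, ∞]`: the supremum of the real numbers `r > r₀` such that `f`, given
near `S`, admits a meromorphic continuation with at most `m` poles on `E_μ(r)`. -/
def meromorphyRadius (S : Set ℂ) (μ : Measure ℂ) (f : ℂ → ℂ) (m : ℕ) : ℝ≥0∞ :=
  ⨆ (r : ℝ≥0) (_ : potentialInf S μ < r ∧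
    HasMeromorphicContinuation f S (potentialSublevel μ r) m), (r : ℝ≥0∞)

/-- The set `D_{μ,m} = E_μ(R_{μ,m})` of `m`-meromorphy of `f` relative to `μ`. -/
def meromorphySet (S : Set ℂ) (μ : Measure ℂ) (f : ℂ → ℂ) (m : ℕ) : Set ℂ :=
  potentialSublevel μ (meromorphyRadius S μ f m)

/-- The polynomial `w_n = ∏_{i=1}^n (z - α_{n,i})`. -/
def nodePoly (α : (n : ℕ) → Fin n → ℂ) (n : ℕ) : ℂ[X] :=
  ∏ i : Fin n, (X - C (α n i))

/-- The table is newtonian: `w_n` divides `w_{n+1}`. -/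
def IsNewtonianTable (α : (n : ℕ) → Fin n → ℂ) : Prop :=
  ∀ n : ℕ, nodePoly α n ∣ nodePoly α (n + 1)

/-- The normalized zero counting measure `Θ_p` (zeros counted with multiplicity). -/
def zeroCountingMeasure (p : ℂ[X]) : Measure ℂ :=
  ((p.natDegree : ℝ≥0∞))⁻¹ • (p.roots.map fun ξ => Measure.dirac ξ).sum

/-- `Θ_{w_n} → μ` in the weak-* sense, tested against the continuous functions on the Riemann
sphere. -/
def HasAsymptoticZeroDistribution (α : (n : ℕ) → Fin n → ℂ) (μ : Measure ℂ) : Prop :=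
  ∀ g : C(OnePoint ℂ, ℝ),
    Tendsto (fun n : ℕ => ∫ z : ℂ, g (z : OnePoint ℂ) ∂(zeroCountingMeasure (nodePoly α n)))
      atTop (𝓝 (∫ z : ℂ, g (z : OnePoint ℂ) ∂μ))

/-- `(P, Q)` is a pair of polynomials defining the multipoint Padé approximant of type `(n, m)` of
`f ∈ H(V)`: `deg P ≤ n - m`, `deg Q ≤ m`, `Q ≢ 0` and `(Q f - P) / w_{n+1} ∈ H(V)`. It is used for
`n ≥ m` only. -/
def IsPadePair (f : ℂ → ℂ) (V : Set ℂ) (α : (n : ℕ) → Fin n → ℂ) (n m : ℕ) (P Q : ℂ[X]) : Prop :=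
  P.natDegree ≤ n - m ∧ Q.natDegree ≤ m ∧ Q ≠ 0 ∧
    ∃ h : ℂ → ℂ, DifferentiableOn ℂ h V ∧
      ∀ z ∈ V, Q.eval z * f z - P.eval z = h z * (nodePoly α (n + 1)).eval z

/-- The normalization `Q(z) = ∏_{|ζ| ≤ 1} (z - ζ) ∏_{|ζ| > 1} (1 - z / ζ)` over the zeros `ζ` of
`Q`, repeated according to multiplicity. -/
def IsNormalizedDenominator (Q : ℂ[X]) : Prop :=
  Q = (Q.roots.map fun ζ => if ‖ζ‖ ≤ 1 then X - C ζ else 1 - C ζ⁻¹ * X).prod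

/-- The rational function `P / Q`. -/
def ratQuot (P Q : ℂ[X]) : RatFunc ℂ :=
  algebraMap ℂ[X] (RatFunc ℂ) P / algebraMap ℂ[X] (RatFunc ℂ) Q

/-- The value of a rational function at `z ∈ ℂ` as a point of the Riemann sphere (`∞` at a pole);
`num` and `denom` are coprime. -/
def sphereValue (r : RatFunc ℂ) (z : ℂ) : OnePoint ℂ :=
  open Classical in
  if r.denom.eval z = 0 then OnePoint.infty else ((r.num.eval z / r.denom.eval z : ℂ) : OnePoint ℂ)

end

/-!
Write `u = exp (-P(μ; ·))`, so that `E_μ(r) = {u < r}`, and let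
`A_n = [z^{n+1-m}] P_{n+1} · [z^m] Q_n`. Since `w_{n+1}` divides `w_{n+2}`, the polynomial
`P_{n+1} Q_n - P_n Q_{n+1}` is divisible by `w_{n+1}`, and comparison of degrees shows that the
quotient is the constant `A_n` (`IsPadePair.mul_sub_mul_eq`). Normalization bounds the denominators
locally uniformly. The potential enters through the node polynomials: `|w_n|^{1/n}` is locally
eventually below `r` on `E_μ(r)` (the principle of descent, `exists_forall_norm_nodePoly_le`), and
locally eventually above every `ρ < r` off `E_μ(r)` and `S` (`exists_forall_le_norm_nodePoly`).

If `f` continues to `E_μ(r)` with at most `m` poles, then `limsup |A_n|^{1/n} ≤ 1 / r`. A monic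
polynomial `s` of degree `m` clears the poles, and `s P_n` interpolates `Q_n · (s f)` at the zeros of
`w_{n+1}`, so its leading coefficient is a contour integral of `Q_n s f / w_{n+1}`, which is of order
`ρ^{-n}` for every `ρ < r` (`exists_norm_coeff_le`). The contour has to surround all of `S`, also
the part outside `E_μ(r)`, so the continuation and `f` must agree where both are defined near `S`.
A lemniscate component `{|w_n| < ρ^n}` around a point of a smaller sublevel set contains a node,
does not leave `E_μ(r)`, and becomes small near a point outside `E_μ(r)`, because otherwise `|w_n|`
would be small on a full circle there (`forall_isPreconnected_subset_ball`); on such a component the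
identity theorem gives the agreement (`exists_glued_continuation`).

Conversely let `|A_n| ≤ ρ^{-n}` eventually. The normalized denominators have a convergent
subsequence with limit `q ≠ 0`, since their Mahler measure is `1`. The telescoping series of
`A_n w_{n+1} / (Q_n Q_{n+1})` converges uniformly on circles that keep a distance `n^{-2}` to the
zeros of `Q_n`; by Borel–Cantelli these circles exist around every point of `E_μ(ρ)`, and by the
maximum principle the numerators converge inside. The quotient of the limits is a continuation with
at most `m` poles, and it coincides with `f` near the support of `μ`, where a positive proportion
of the nodes accumulates (`hasMeromorphicContinuation_support_of_norm_le`). The assumption of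
single-valuedness transfers this to `S` for `ρ > r₀`. Smaller `ρ` are harmless because some
sublevel set meets `S` and lies in `V` (`exists_potentialSublevel_subset`), which rests on
the minimum principle. Together these give the radius formula
(`inv_meromorphyRadius_eq_limsup`).

For the divergence, off `S` the function `log u` is harmonic without local minima, as the
complement of `S` is connected and the Cauchy transform of `μ` does not vanish identically
(`not_isLocalMin_integral_log`); hence `u > R_{μ,m}` off `S` and the closure of `D_{μ,m}`. There
`|w_n|` exceeds `ρ^n` with some `ρ > R_{μ,m}`, so by the radius formula `A_n w_{n+1}` is
unbounded, while convergence of the values to a finite limit would make it bounded.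
-/

/-! ### Truncated potentials and the sublevel sets of the potential -/

/-- The truncated potential `∫ log max(t, |z - ζ|) dμ(ζ)`. -/
noncomputable def truncPotential (μ : Measure ℂ) (t : ℝ) (z : ℂ) : ℝ :=
  ∫ ζ, Real.log (max t ‖z - ζ‖) ∂μ

theorem continuous_log_max {t : ℝ} (ht : 0 < t) (z : ℂ) :
    Continuous fun ζ : ℂ => Real.log (max t ‖z - ζ‖) := by
  refine Continuous.log (by fun_prop) fun ζ => ?_
  exact (lt_of_lt_of_le ht (le_max_left _ _)).ne'

theorem integrable_of_continuous_of_compl_null {S : Set ℂ} (hS : IsCompact S) {μ : Measure ℂ}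
    [IsProbabilityMeasure μ] (hμ : μ Sᶜ = 0) {E : Type*} [NormedAddCommGroup E] {g : ℂ → E}
    (hg : ContinuousOn g S) : Integrable g μ := by
  have h1 : μ.restrict S = μ := Measure.restrict_eq_self_of_ae_mem (by
    rw [ae_iff]; exact hμ)
  have := hg.integrableOn_compact (μ := μ) hS
  rwa [IntegrableOn, h1] at this

theorem ae_mem_of_compl_null {S : Set ℂ} {μ : Measure ℂ} (hμ : μ Sᶜ = 0) : ∀ᵐ ζ ∂μ, ζ ∈ S := by
  rw [ae_iff]; exact hμ

theorem potentialSublevel_mono {μ : Measure ℂ} {a b : ℝ≥0∞} (h : a ≤ b) :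
    potentialSublevel μ a ⊆ potentialSublevel μ b := fun _ hz => lt_of_lt_of_le hz h

section Potential

variable {S : Set ℂ} {μ : Measure ℂ} [IsProbabilityMeasure μ]

theorem integrable_log_max (hS : IsCompact S) (hμ : μ Sᶜ = 0) {t : ℝ} (ht : 0 < t) (z : ℂ) :
    Integrable (fun ζ : ℂ => Real.log (max t ‖z - ζ‖)) μ :=
  integrable_of_continuous_of_compl_null hS hμ (continuous_log_max ht z).continuousOn

theorem truncPotential_mono (hS : IsCompact S) (hμ : μ Sᶜ = 0) {s t : ℝ} (hs : 0 < s)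
    (hst : s ≤ t) (z : ℂ) : truncPotential μ s z ≤ truncPotential μ t z := by
  refine integral_mono (integrable_log_max hS hμ hs z)
    (integrable_log_max hS hμ (hs.trans_le hst) z) fun ζ => ?_
  exact Real.log_le_log (lt_of_lt_of_le hs (le_max_left _ _)) (max_le_max_right _ hst)

theorem log_max_le_log_max_add {t : ℝ} (ht : 0 < t) (z z' ζ : ℂ) :
    Real.log (max t ‖z - ζ‖) ≤ Real.log (max t ‖z' - ζ‖) + ‖z - z'‖ / t := by
  have h0 : 0 < max t ‖z' - ζ‖ := lt_of_lt_of_le ht (le_max_left _ _)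
  have h1 : 0 < max t ‖z - ζ‖ := lt_of_lt_of_le ht (le_max_left _ _)
  have h2 : max t ‖z - ζ‖ ≤ max t ‖z' - ζ‖ + ‖z - z'‖ := by
    refine max_le ?_ ?_
    · have := le_max_left t ‖z' - ζ‖
      have := norm_nonneg (z - z'); linarith
    · have : ‖z - ζ‖ ≤ ‖z' - ζ‖ + ‖z - z'‖ := by
        rw [add_comm]; calc ‖z - ζ‖ = ‖(z - z') + (z' - ζ)‖ := by ring_nf
          _ ≤ _ := norm_add_le _ _
      have := le_max_right t ‖z' - ζ‖; linarith
  have h3 : Real.log (max t ‖z - ζ‖) - Real.log (max t ‖z' - ζ‖)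
      ≤ max t ‖z - ζ‖ / max t ‖z' - ζ‖ - 1 := by
    rw [← Real.log_div h1.ne' h0.ne']
    exact Real.log_le_sub_one_of_pos (by positivity)
  have h4 : max t ‖z - ζ‖ / max t ‖z' - ζ‖ - 1 ≤ ‖z - z'‖ / t := by
    have : max t ‖z - ζ‖ / max t ‖z' - ζ‖ - 1 = (max t ‖z - ζ‖ - max t ‖z' - ζ‖)
      / max t ‖z' - ζ‖ := by field_simp
    rw [this]
    calc _ ≤ ‖z - z'‖ / max t ‖z' - ζ‖ := by gcongr; linarith
      _ ≤ _ := by gcongr; exact le_max_left _ _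
  linarith

theorem truncPotential_le_add (hS : IsCompact S) (hμ : μ Sᶜ = 0) {t : ℝ} (ht : 0 < t) (z z' : ℂ) :
    truncPotential μ t z ≤ truncPotential μ t z' + ‖z - z'‖ / t := by
  have : ∫ ζ, (Real.log (max t ‖z' - ζ‖) + ‖z - z'‖ / t) ∂μ
      = truncPotential μ t z' + ‖z - z'‖ / t := by
    rw [integral_add (integrable_log_max hS hμ ht z') (integrable_const _)]
    simp [truncPotential]
  rw [← this]
  exact integral_mono (integrable_log_max hS hμ ht z)
    ((integrable_log_max hS hμ ht z').add (integrable_const _))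
    fun ζ => log_max_le_log_max_add ht z z' ζ

/-- A sublevel set of `exp (-P)` is described by the truncated potentials, because these decrease to
`-P` as the truncation level decreases to `0`. -/
theorem mem_potentialSublevel_iff (hS : IsCompact S) (hμ : μ Sᶜ = 0) {r : ℝ} (hr : 0 < r) (z : ℂ) :
    z ∈ potentialSublevel μ (ENNReal.ofReal r) ↔
      ∃ t > 0, truncPotential μ t z < Real.log r := by
  -- the levels `e⁻ᵏ`; for them the positive part of the truncated logarithm does not depend on
  -- `k`, and monotone convergence applies to the negative part
  set e : ℕ → ℝ := fun k => Real.exp (-(k : ℝ)) with he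
  have he0 : ∀ k, 0 < e k := fun k => Real.exp_pos _
  set b : ℝ≥0∞ := ∫⁻ ζ, (ENNReal.log ‖z - ζ‖ₑ).toENNReal ∂μ with hb
  set a : ℝ≥0∞ := ∫⁻ ζ, (-ENNReal.log ‖z - ζ‖ₑ).toENNReal ∂μ with ha
  set ak : ℕ → ℝ≥0∞ := fun k => ∫⁻ ζ, ENNReal.ofReal (-Real.log (max (e k) ‖z - ζ‖)) ∂μ with hak
  have hlog : ∀ ζ : ℂ, ζ ≠ z → ENNReal.log ‖z - ζ‖ₑ = ((Real.log ‖z - ζ‖ : ℝ) : EReal) := by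
    intro ζ hζ
    rw [← ofReal_norm, ENNReal.log_ofReal_of_pos]
    simpa [sub_eq_zero] using hζ.symm
  have hb' : ∀ k, b = ∫⁻ ζ, ENNReal.ofReal (Real.log (max (e k) ‖z - ζ‖)) ∂μ := by
    intro k
    refine lintegral_congr fun ζ => ?_
    have h1 : e k ≤ 1 := Real.exp_le_one_iff.2 (by simp)
    by_cases hζ : ζ = z
    · subst hζ
      simp only [sub_self, enorm_zero, ENNReal.log_zero, norm_zero]
      rw [max_eq_left (he0 k).le, ENNReal.ofReal_of_nonpos (Real.log_nonpos (he0 k).le h1)]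
      simp
    · rw [hlog ζ hζ, EReal.toENNReal_of_ne_top (by simp), EReal.toReal_coe]
      rcases le_total (e k) ‖z - ζ‖ with h | h
      · rw [max_eq_right h]
      · rw [max_eq_left h, ENNReal.ofReal_of_nonpos (Real.log_nonpos (he0 k).le h1),
          ENNReal.ofReal_of_nonpos (Real.log_nonpos (norm_nonneg _) (h.trans h1))]
  have hbfin : b ≠ ⊤ := by
    rw [hb' 0]
    exact (integrable_log_max hS hμ (he0 0) z).lintegral_lt_top.ne
  have hakfin : ∀ k, ak k ≠ ⊤ := fun k =>
    (integrable_log_max hS hμ (he0 k) z).neg.lintegral_lt_top.ne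
  have hU : ∀ k, truncPotential μ (e k) z = b.toReal - (ak k).toReal := by
    intro k
    rw [truncPotential, integral_eq_lintegral_pos_part_sub_lintegral_neg_part
      (integrable_log_max hS hμ (he0 k) z), ← hb' k]
  have hemono : ∀ {i j : ℕ}, i ≤ j → e j ≤ e i := by
    intro i j hij
    refine Real.exp_le_exp.2 (neg_le_neg (by exact_mod_cast hij))
  have hmono : Monotone fun (k : ℕ) (ζ : ℂ) => ENNReal.ofReal (-Real.log (max (e k) ‖z - ζ‖)) := by
    intro i j hij ζ
    refine ENNReal.ofReal_le_ofReal (neg_le_neg ?_)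
    exact Real.log_le_log (lt_of_lt_of_le (he0 j) (le_max_left _ _))
      (max_le_max_right _ (hemono hij))
  have hsup : a = ⨆ k, ak k := by
    rw [hak, ← lintegral_iSup (fun k => ?_) hmono]
    · refine lintegral_congr fun ζ => ?_
      by_cases hζ : ζ = z
      · subst hζ
        simp only [sub_self, enorm_zero, ENNReal.log_zero, norm_zero]
        have : ∀ k : ℕ, ENNReal.ofReal (-Real.log (max (e k) 0)) = (k : ℝ≥0∞) := by
          intro k
          rw [max_eq_left (he0 k).le, Real.log_exp]; simp
        simp [this, ENNReal.iSup_natCast]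
      · have hpos : 0 < ‖z - ζ‖ := by simpa [sub_eq_zero] using Ne.symm hζ
        rw [hlog ζ hζ, ← EReal.coe_neg, EReal.toENNReal_of_ne_top (by simp), EReal.toReal_coe]
        refine le_antisymm ?_ (iSup_le fun k => ?_)
        · obtain ⟨k, hk⟩ := exists_nat_gt (-Real.log ‖z - ζ‖)
          refine le_iSup_of_le k ?_
          rw [max_eq_right]
          rw [← Real.exp_log hpos]
          exact Real.exp_le_exp.2 (by linarith)
        · exact ENNReal.ofReal_le_ofReal (neg_le_neg
            (Real.log_le_log hpos (le_max_right _ _)))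
    · exact ((continuous_log_max (he0 k) z).measurable.neg).ennreal_ofReal
  have key : z ∈ potentialSublevel μ (ENNReal.ofReal r) ↔
      ∃ k, truncPotential μ (e k) z < Real.log r := by
    have h1 : z ∈ potentialSublevel μ (ENNReal.ofReal r) ↔
        -((a : EReal) - (b : EReal)) < ((Real.log r : ℝ) : EReal) := by
      rw [← EReal.exp_lt_exp_iff, EReal.exp_coe, Real.exp_log hr]; rfl
    rw [h1]
    have hbc : (b : EReal) = ((b.toReal : ℝ) : EReal) := (EReal.coe_ennreal_toReal hbfin).symm
    constructor
    · intro h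
      by_contra! hcon
      have h2 : a ≤ ENNReal.ofReal (b.toReal - Real.log r) := by
        rw [hsup]
        refine iSup_le fun k => ?_
        rw [← ENNReal.ofReal_toReal (hakfin k)]
        refine ENNReal.ofReal_le_ofReal ?_
        have := hcon k; rw [hU k] at this; linarith
      have h3 : 0 ≤ b.toReal - Real.log r := by
        have := hcon 0; rw [hU 0] at this
        have := (ENNReal.toReal_nonneg (a := ak 0)); linarith
      have h4 : a ≠ ⊤ := ne_top_of_le_ne_top ENNReal.ofReal_ne_top h2
      have h5 : a.toReal ≤ b.toReal - Real.log r := ENNReal.toReal_le_of_le_ofReal h3 h2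
      rw [hbc, ← EReal.coe_ennreal_toReal h4, ← EReal.coe_sub, ← EReal.coe_neg,
        EReal.coe_lt_coe_iff] at h
      linarith
    · rintro ⟨k, hk⟩
      rw [hU k] at hk
      by_cases h4 : a = ⊤
      · rw [h4, hbc]
        simp
      · rw [hbc, ← EReal.coe_ennreal_toReal h4, ← EReal.coe_sub, ← EReal.coe_neg,
          EReal.coe_lt_coe_iff]
        have : (ak k).toReal ≤ a.toReal := ENNReal.toReal_mono h4 (hsup ▸ le_iSup ak k)
        linarith
  rw [key]
  constructor
  · rintro ⟨k, hk⟩; exact ⟨e k, he0 k, hk⟩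
  · rintro ⟨t, ht, h⟩
    obtain ⟨k, hk⟩ := exists_nat_gt (-Real.log t)
    refine ⟨k, lt_of_le_of_lt (truncPotential_mono hS hμ (he0 k) ?_ z) h⟩
    rw [← Real.exp_log ht]
    exact Real.exp_le_exp.2 (by linarith)

theorem isOpen_potentialSublevel (hS : IsCompact S) (hμ : μ Sᶜ = 0) {r : ℝ} (hr : 0 < r) :
    IsOpen (potentialSublevel μ (ENNReal.ofReal r)) := by
  rw [Metric.isOpen_iff]
  intro z hz
  obtain ⟨t, ht, h⟩ := (mem_potentialSublevel_iff hS hμ hr z).1 hz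
  refine ⟨t * (Real.log r - truncPotential μ t z), mul_pos ht (by linarith), fun z' hz' => ?_⟩
  refine (mem_potentialSublevel_iff hS hμ hr z').2 ⟨t, ht, ?_⟩
  have h1 := truncPotential_le_add hS hμ ht z' z
  rw [Metric.mem_ball, dist_eq_norm] at hz'
  have : ‖z' - z‖ / t < Real.log r - truncPotential μ t z := by
    rw [div_lt_iff₀ ht]; linarith
  linarith

end Potential

/-! ### Asymptotics of the node polynomials -/

theorem nodePoly_monic (α : (n : ℕ) → Fin n → ℂ) (n : ℕ) : (nodePoly α n).Monic :=
  monic_prod_of_monic _ _ fun _ _ => monic_X_sub_C _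

theorem nodePoly_natDegree (α : (n : ℕ) → Fin n → ℂ) (n : ℕ) : (nodePoly α n).natDegree = n := by
  rw [nodePoly, natDegree_prod_of_monic _ _ fun i _ => monic_X_sub_C _]
  simp

theorem nodePoly_eval (α : (n : ℕ) → Fin n → ℂ) (n : ℕ) (z : ℂ) :
    (nodePoly α n).eval z = ∏ i, (z - α n i) := by
  simp [nodePoly, eval_prod]

theorem norm_nodePoly_eval (α : (n : ℕ) → Fin n → ℂ) (n : ℕ) (z : ℂ) :
    ‖(nodePoly α n).eval z‖ = ∏ i, ‖z - α n i‖ := by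
  rw [nodePoly_eval, norm_prod]

theorem integral_zeroCountingMeasure (α : (n : ℕ) → Fin n → ℂ) (n : ℕ) (φ : ℂ → ℝ) :
    ∫ z, φ z ∂(zeroCountingMeasure (nodePoly α n)) = (n : ℝ)⁻¹ * ∑ i, φ (α n i) := by
  have hr : (nodePoly α n).roots = Finset.univ.val.map (α n) := by
    rw [nodePoly, roots_prod _ _ (Finset.prod_ne_zero_iff.2 fun i _ => X_sub_C_ne_zero _)]
    simp only [roots_X_sub_C]
    rw [Multiset.bind_singleton]
  have hs : ((nodePoly α n).roots.map fun ξ => Measure.dirac ξ).sum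
      = ∑ i, Measure.dirac (α n i) := by
    rw [hr, Multiset.map_map]; rfl
  rw [zeroCountingMeasure, integral_smul_measure, hs, nodePoly_natDegree,
    integral_finsetSum_measure fun i _ => integrable_dirac (by simp)]
  simp [integral_dirac]

/-- Weak-* convergence on the sphere, tested against all continuous functions on the plane: the
nodes stay in a compact set, so the behaviour of the test function at infinity is immaterial. -/
theorem HasAsymptoticZeroDistribution.tendsto_average {S : Set ℂ} (hS : IsCompact S) {μ : Measure ℂ}
    (hμ : μ Sᶜ = 0) {α : (n : ℕ) → Fin n → ℂ} (hα : ∀ n i, α n i ∈ S)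
    (hdist : HasAsymptoticZeroDistribution α μ) {φ : ℂ → ℝ} (hφ : Continuous φ) :
    Tendsto (fun n : ℕ => (n : ℝ)⁻¹ * ∑ i, φ (α n i)) atTop (𝓝 (∫ z, φ z ∂μ)) := by
  obtain ⟨χ, hχ1, -, hχc, -⟩ := exists_continuous_one_zero_of_isCompact hS isClosed_empty
    (Set.disjoint_empty S)
  have hc : HasCompactSupport fun z => χ z * φ z := hχc.mul_right
  let g : C(OnePoint ℂ, ℝ) := ⟨fun x => x.elim 0 fun z => χ z * φ z, by
    rw [OnePoint.continuous_iff]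
    refine ⟨?_, χ.continuous.mul hφ⟩
    have := hasCompactSupport_iff_eventuallyEq.1 hc
    simp only [OnePoint.elim_some, OnePoint.elim_infty]
    exact tendsto_const_nhds.congr' (this.mono fun x hx => hx.symm)⟩
  have h := hdist g
  have hg : ∀ z ∈ S, g (z : OnePoint ℂ) = φ z := by
    intro z hz
    change χ z * φ z = φ z
    rw [hχ1 hz]; simp
  have h2 : ∫ z : ℂ, g (z : OnePoint ℂ) ∂μ = ∫ z, φ z ∂μ :=
    integral_congr_ae ((ae_mem_of_compl_null hμ).mono fun z hz => hg z hz)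
  rw [h2] at h
  refine h.congr fun n => ?_
  rw [integral_zeroCountingMeasure α n fun z => g (z : OnePoint ℂ)]
  congr 1
  exact Finset.sum_congr rfl fun i _ => hg _ (hα n i)

/-- A Jensen-type inequality: each factor `z - a i` with zero inside the circle is replaced by the
linear polynomial of the same modulus on the circle with zero outside, whose modulus at the centre
is the radius. -/
theorem prod_max_le_of_forall_norm_le {ι : Type*} (s : Finset ι) (a : ι → ℂ) (p : ℂ) {t : ℝ}
    (ht : 0 < t) {B : ℝ} (h : ∀ z, ‖z - p‖ = t → ∏ i ∈ s, ‖z - a i‖ ≤ B) :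
    ∏ i ∈ s, max t ‖p - a i‖ ≤ B := by
  let b : ι → ℂ → ℂ := fun i z => if t ≤ ‖p - a i‖ then z - a i
    else ((t : ℂ) ^ 2 - (starRingEnd ℂ) (a i - p) * (z - p)) / t
  have hbd : ∀ i, Differentiable ℂ (b i) := by
    intro i
    by_cases hi : t ≤ ‖p - a i‖
    · simp only [b, hi, if_true]; fun_prop
    · simp only [b, hi, if_false]; fun_prop
  have hb1 : ∀ i z, ‖z - p‖ = t → ‖b i z‖ = ‖z - a i‖ := by
    intro i z hz
    by_cases hi : t ≤ ‖p - a i‖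
    · simp [b, hi]
    · simp only [b, hi, if_false]
      have h1 : (t : ℂ) ^ 2 = (starRingEnd ℂ) (z - p) * (z - p) := by
        rw [← hz, mul_comm, Complex.mul_conj, Complex.normSq_eq_norm_sq]; push_cast; rfl
      rw [h1, ← sub_mul, ← map_sub, norm_div, norm_mul, Complex.norm_conj, hz]
      rw [show z - p - (a i - p) = z - a i by ring]
      simp [abs_of_pos ht, ht.ne']
  have hb2 : ∀ i, ‖b i p‖ = max t ‖p - a i‖ := by
    intro i
    by_cases hi : t ≤ ‖p - a i‖
    · simp [b, hi]
    · simp only [b, hi, if_false]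
      rw [max_eq_left (not_le.1 hi).le]
      simp [abs_of_pos ht, pow_two, ht.ne']
  have hd : Differentiable ℂ fun z => ∏ i ∈ s, b i z := by
    fun_prop
  have := Complex.norm_le_of_forall_mem_frontier_norm_le (Metric.isBounded_ball (x := p) (r := t))
    (hd.diffContOnCl) (C := B) (fun z hz => ?_) (z := p) (subset_closure (Metric.mem_ball_self ht))
  · rw [norm_prod] at this
    simpa [hb2] using this
  · rw [frontier_ball p ht.ne', mem_sphere_iff_norm] at hz
    rw [norm_prod, Finset.prod_congr rfl fun i _ => hb1 i z hz]
    exact h z hz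

theorem tendsto_average_log_max {S : Set ℂ} (hS : IsCompact S) {μ : Measure ℂ}
    (hμ : μ Sᶜ = 0) {α : (n : ℕ) → Fin n → ℂ} (hα : ∀ n i, α n i ∈ S)
    (hdist : HasAsymptoticZeroDistribution α μ) {t : ℝ} (ht : 0 < t) (z : ℂ) :
    Tendsto (fun n : ℕ => (n : ℝ)⁻¹ * ∑ i, Real.log (max t ‖z - α n i‖)) atTop
      (𝓝 (truncPotential μ t z)) :=
  hdist.tendsto_average hS hμ hα (continuous_log_max ht z)

theorem infDist_le_norm_sub {S : Set ℂ} {z ζ : ℂ} (hζ : ζ ∈ S) : Metric.infDist z S ≤ ‖z - ζ‖ := by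
  rw [← dist_eq_norm]; exact Metric.infDist_le_dist_of_mem hζ

/-- Off the compact carrier of `μ` the truncation at a small level changes nothing. -/
theorem truncPotential_eq {S : Set ℂ} {μ : Measure ℂ} (hμ : μ Sᶜ = 0) {z : ℂ} {t : ℝ}
    (h : t ≤ Metric.infDist z S) :
    truncPotential μ t z = ∫ ζ, Real.log ‖z - ζ‖ ∂μ := by
  refine integral_congr_ae ((ae_mem_of_compl_null hμ).mono fun ζ hζ => ?_)
  simp only
  rw [max_eq_right (h.trans (infDist_le_norm_sub hζ))]

section NodePolynomials

variable {S : Set ℂ} {μ : Measure ℂ} [IsProbabilityMeasure μ] {α : (n : ℕ) → Fin n → ℂ}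

/-- The principle of descent: near a point where `exp (-P) < r` the node polynomials satisfy
`|w_n|^{1/n} ≤ ρ` with some `ρ < r`. -/
theorem exists_forall_norm_nodePoly_le (hS : IsCompact S) (hμ : μ Sᶜ = 0) (hα : ∀ n i, α n i ∈ S)
    (hdist : HasAsymptoticZeroDistribution α μ) {r : ℝ} (hr : 0 < r) {z : ℂ}
    (hz : z ∈ potentialSublevel μ (ENNReal.ofReal r)) :
    ∃ ρ > 0, ρ < r ∧ ∃ δ > 0, ∀ᶠ n in atTop, ∀ z' ∈ Metric.ball z δ,
      ‖(nodePoly α n).eval z'‖ ≤ ρ ^ n := by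
  obtain ⟨t, ht, h⟩ := (mem_potentialSublevel_iff hS hμ hr z).1 hz
  obtain ⟨L1, hL1, hL1'⟩ := exists_between h
  obtain ⟨L2, hL2, hL2'⟩ := exists_between hL1'
  refine ⟨Real.exp L2, Real.exp_pos _, ?_, t * (L2 - L1), mul_pos ht (by linarith), ?_⟩
  · rw [← Real.exp_log hr]; exact Real.exp_lt_exp.2 hL2'
  filter_upwards [(tendsto_average_log_max hS hμ hα hdist ht z).eventually_lt_const hL1,
    eventually_gt_atTop 0] with n hn hn0 z' hz'
  have hn0' : (0 : ℝ) < n := by exact_mod_cast hn0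
  rw [inv_mul_lt_iff₀ hn0'] at hn
  rw [Metric.mem_ball, dist_eq_norm] at hz'
  have h1 : ‖z' - z‖ / t ≤ L2 - L1 := by
    rw [div_le_iff₀ ht]; linarith
  rw [norm_nodePoly_eval, ← Real.exp_nat_mul]
  calc ∏ i, ‖z' - α n i‖ ≤ ∏ i, Real.exp (Real.log (max t ‖z - α n i‖) + (L2 - L1)) := by
        refine Finset.prod_le_prod (fun i _ => norm_nonneg _) fun i _ => ?_
        have h2 := log_max_le_log_max_add ht z' z (α n i)
        have h3 : 0 < max t ‖z' - α n i‖ := lt_of_lt_of_le ht (le_max_left _ _)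
        calc ‖z' - α n i‖ ≤ max t ‖z' - α n i‖ := le_max_right _ _
          _ = Real.exp (Real.log (max t ‖z' - α n i‖)) := (Real.exp_log h3).symm
          _ ≤ _ := Real.exp_le_exp.2 (by linarith)
    _ = Real.exp (∑ i, (Real.log (max t ‖z - α n i‖) + (L2 - L1))) := (Real.exp_sum _ _).symm
    _ ≤ _ := by
        refine Real.exp_le_exp.2 ?_
        rw [Finset.sum_add_distrib]
        simp only [Finset.sum_const, Finset.card_univ, Fintype.card_fin, nsmul_eq_mul]
        nlinarith

/-- Around a point where `exp (-P) ≥ r` the node polynomials are not uniformly small. -/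
theorem exists_lt_norm_nodePoly (hS : IsCompact S) (hμ : μ Sᶜ = 0) (hα : ∀ n i, α n i ∈ S)
    (hdist : HasAsymptoticZeroDistribution α μ) {r ρ : ℝ} (hρ : 0 < ρ) (hρr : ρ < r) {p : ℂ}
    (hp : p ∉ potentialSublevel μ (ENNReal.ofReal r)) {δ C : ℝ} (hδ : 0 < δ) (hC : 0 < C) :
    ∀ᶠ n in atTop, ∃ z, ‖z - p‖ = δ ∧ C * ρ ^ n < ‖(nodePoly α n).eval z‖ := by
  have hr : 0 < r := hρ.trans hρr
  -- the truncated potential dominates `-P`, and it is the limit of the averages that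
  -- `prod_max_le_of_forall_norm_le` bounds by the maximum on the circle
  have hU : Real.log r ≤ truncPotential μ δ p := by
    by_contra! h
    exact hp ((mem_potentialSublevel_iff hS hμ hr p).2 ⟨δ, hδ, h⟩)
  have h1 : Tendsto (fun n : ℕ => (n : ℝ)⁻¹ * ∑ i, Real.log (max δ ‖p - α n i‖)
      - (n : ℝ)⁻¹ * Real.log C) atTop (𝓝 (truncPotential μ δ p - 0 * Real.log C)) :=
    (tendsto_average_log_max hS hμ hα hdist hδ p).sub
      (tendsto_inv_atTop_nhds_zero_nat.mul_const _)
  have h2 : Real.log ρ < truncPotential μ δ p - 0 * Real.log C := by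
    have := Real.log_lt_log hρ hρr; linarith
  filter_upwards [h1.eventually_const_lt h2, eventually_gt_atTop 0] with n hn hn0
  by_contra! hcon
  have hn0' : (0 : ℝ) < n := by exact_mod_cast hn0
  have h3 := prod_max_le_of_forall_norm_le Finset.univ (α n) p hδ (B := C * ρ ^ n)
    fun z hz => by rw [← norm_nodePoly_eval]; exact hcon z hz
  have h4 : ∑ i, Real.log (max δ ‖p - α n i‖) ≤ Real.log C + n * Real.log ρ := by
    rw [← Real.log_prod fun i _ => (lt_of_lt_of_le hδ (le_max_left _ _)).ne', ← Real.log_pow,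
      ← Real.log_mul hC.ne' (pow_pos hρ n).ne']
    exact Real.log_le_log (Finset.prod_pos fun i _ => lt_of_lt_of_le hδ (le_max_left _ _)) h3
  rw [← mul_sub, lt_inv_mul_iff₀ hn0'] at hn
  linarith

theorem nonempty_of_compl_null (hμ : μ Sᶜ = 0) : S.Nonempty := by
  by_contra h
  rw [Set.not_nonempty_iff_eq_empty] at h
  simp [h] at hμ

theorem infDist_pos_of_notMem (hS : IsCompact S) (hμ : μ Sᶜ = 0) {z : ℂ} (hz : z ∉ S) :
    0 < Metric.infDist z S :=
  (hS.isClosed.notMem_iff_infDist_pos (nonempty_of_compl_null hμ)).1 hz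

theorem mem_potentialSublevel_iff_of_notMem (hS : IsCompact S) (hμ : μ Sᶜ = 0) {r : ℝ} (hr : 0 < r)
    {z : ℂ} (hz : z ∉ S) :
    z ∈ potentialSublevel μ (ENNReal.ofReal r) ↔ ∫ ζ, Real.log ‖z - ζ‖ ∂μ < Real.log r := by
  have hd := infDist_pos_of_notMem hS hμ hz
  rw [mem_potentialSublevel_iff hS hμ hr]
  constructor
  · rintro ⟨t, ht, h⟩
    rw [← truncPotential_eq hμ (min_le_right t _)]
    exact (truncPotential_mono hS hμ (lt_min ht hd) (min_le_left _ _) z).trans_lt h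
  · intro h
    exact ⟨_, hd, by rwa [truncPotential_eq hμ le_rfl]⟩

theorem continuousAt_integral_log (hS : IsCompact S) (hμ : μ Sᶜ = 0) {z : ℂ} (hz : z ∉ S) :
    ContinuousAt (fun z => ∫ ζ, Real.log ‖z - ζ‖ ∂μ) z := by
  have hd := infDist_pos_of_notMem hS hμ hz
  set t := Metric.infDist z S / 2 with ht
  have ht0 : 0 < t := by positivity
  have h1 : ∀ᶠ z' in 𝓝 z, truncPotential μ t z' = ∫ ζ, Real.log ‖z' - ζ‖ ∂μ := by
    have : ∀ᶠ z' in 𝓝 z, t < Metric.infDist z' S :=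
      (Metric.continuous_infDist_pt S).continuousAt.eventually (lt_mem_nhds (by linarith))
    exact this.mono fun z' h => truncPotential_eq hμ h.le
  refine ContinuousAt.congr ?_ h1
  have hL : LipschitzWith ⟨t⁻¹, by positivity⟩ (truncPotential μ t) := by
    refine LipschitzWith.of_le_add_mul _ fun x y => ?_
    have := truncPotential_le_add hS hμ ht0 x y
    rw [dist_eq_norm]
    change _ ≤ _ + t⁻¹ * _
    rw [inv_mul_eq_div]; exact this
  exact hL.continuous.continuousAt

/-- The counterpart of the principle of descent off `S`, where no truncation is needed. -/
theorem exists_forall_le_norm_nodePoly (hS : IsCompact S) (hμ : μ Sᶜ = 0) (hα : ∀ n i, α n i ∈ S)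
    (hdist : HasAsymptoticZeroDistribution α μ) {r ρ : ℝ} (hρ : 0 < ρ) (hρr : ρ < r) {z : ℂ}
    (hzS : z ∉ S) (hz : z ∉ potentialSublevel μ (ENNReal.ofReal r)) :
    ∃ δ > 0, ∀ᶠ n in atTop, ∀ z' ∈ Metric.ball z δ, ρ ^ n ≤ ‖(nodePoly α n).eval z'‖ := by
  have hr : 0 < r := hρ.trans hρr
  have hd := infDist_pos_of_notMem hS hμ hzS
  set t := Metric.infDist z S / 2 with ht
  have ht0 : 0 < t := by positivity
  have hU : Real.log r ≤ truncPotential μ t z := by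
    by_contra! h
    exact hz ((mem_potentialSublevel_iff hS hμ hr z).2 ⟨t, ht0, h⟩)
  obtain ⟨L1, hL1, hL1'⟩ := exists_between ((Real.log_lt_log hρ hρr).trans_le hU)
  refine ⟨min t (t * (L1 - Real.log ρ)), lt_min ht0 (mul_pos ht0 (by linarith)), ?_⟩
  filter_upwards [(tendsto_average_log_max hS hμ hα hdist ht0 z).eventually_const_lt hL1',
    eventually_gt_atTop 0] with n hn hn0 z' hz'
  have hn0' : (0 : ℝ) < n := by exact_mod_cast hn0
  rw [lt_inv_mul_iff₀ hn0'] at hn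
  rw [Metric.mem_ball, dist_eq_norm, lt_min_iff] at hz'
  have h1 : ‖z - z'‖ / t ≤ L1 - Real.log ρ := by
    rw [div_le_iff₀ ht0, norm_sub_rev]; linarith [hz'.2]
  rw [norm_nodePoly_eval]
  have h5 : ∀ i, t ≤ ‖z' - α n i‖ := by
    intro i
    have h6 := infDist_le_norm_sub (z := z) (hα n i)
    have h7 : ‖z - α n i‖ ≤ ‖z - z'‖ + ‖z' - α n i‖ := norm_sub_le_norm_sub_add_norm_sub _ _ _
    rw [norm_sub_rev z z'] at h7
    linarith [hz'.1]
  calc ρ ^ n = Real.exp (n * Real.log ρ) := by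
        rw [Real.exp_nat_mul, Real.exp_log hρ]
    _ ≤ Real.exp (∑ i, (Real.log (max t ‖z - α n i‖) - (L1 - Real.log ρ))) := by
        refine Real.exp_le_exp.2 ?_
        rw [Finset.sum_sub_distrib]
        simp only [Finset.sum_const, Finset.card_univ, Fintype.card_fin, nsmul_eq_mul]
        nlinarith
    _ = ∏ i, Real.exp (Real.log (max t ‖z - α n i‖) - (L1 - Real.log ρ)) := Real.exp_sum _ _
    _ ≤ _ := by
        refine Finset.prod_le_prod (fun i _ => (Real.exp_pos _).le) fun i _ => ?_
        have h2 := log_max_le_log_max_add ht0 z z' (α n i)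
        rw [max_eq_right (h5 i)] at h2
        calc _ ≤ Real.exp (Real.log ‖z' - α n i‖) := Real.exp_le_exp.2 (by linarith)
          _ = _ := Real.exp_log (ht0.trans_le (h5 i))

theorem closure_potentialSublevel_subset (hS : IsCompact S) (hμ : μ Sᶜ = 0) {r r' : ℝ} (hr : 0 < r)
    (hrr' : r < r') : closure (potentialSublevel μ (ENNReal.ofReal r)) ⊆
      potentialSublevel μ (ENNReal.ofReal r') ∪ S := by
  intro z hz
  by_cases hzS : z ∈ S
  · exact Or.inr hzS
  left
  rw [mem_potentialSublevel_iff_of_notMem hS hμ (hr.trans hrr') hzS]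
  refine lt_of_le_of_lt ?_ (Real.log_lt_log hr hrr')
  have hc := continuousAt_integral_log hS hμ hzS
  have hfreq : ∃ᶠ z' in 𝓝 z, ∫ ζ, Real.log ‖z' - ζ‖ ∂μ ≤ Real.log r := by
    rw [mem_closure_iff_frequently] at hz
    refine (hz.and_eventually (hS.isClosed.isOpen_compl.mem_nhds hzS)).mono fun z' h => ?_
    exact ((mem_potentialSublevel_iff_of_notMem hS hμ hr h.2).1 h.1).le
  exact le_of_tendsto_of_frequently hc hfreq

theorem isBounded_potentialSublevel (hS : IsCompact S) (hμ : μ Sᶜ = 0) {r : ℝ} (hr : 0 < r) :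
    Bornology.IsBounded (potentialSublevel μ (ENNReal.ofReal r)) := by
  obtain ⟨M, hM⟩ := hS.isBounded.subset_closedBall 0
  refine (Metric.isBounded_closedBall (x := (0 : ℂ)) (r := M + r)).subset fun z hz => ?_
  by_contra hcon
  rw [mem_closedBall_zero_iff, not_le] at hcon
  obtain ⟨t, ht, h⟩ := (mem_potentialSublevel_iff hS hμ hr z).1 hz
  have : ∫ _ζ, Real.log r ∂μ ≤ truncPotential μ t z := by
    refine integral_mono_ae (integrable_const _) (integrable_log_max hS hμ ht z)
      ((ae_mem_of_compl_null hμ).mono fun ζ hζ => ?_)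
    refine Real.log_le_log hr (le_trans ?_ (le_max_right _ _))
    have h1 := hM hζ
    rw [mem_closedBall_zero_iff] at h1
    have := norm_sub_norm_le z ζ
    linarith
  simp at this
  linarith

end NodePolynomials

/-! ### The minimum principle for the potential -/

section CauchyTransform

variable {S : Set ℂ} {μ : Measure ℂ} [IsProbabilityMeasure μ]

/-- Near a point off `S` the potential is, up to a constant, the real part of a holomorphic function
whose derivative is the Cauchy transform of `μ`. -/
theorem exists_hasDerivAt_cauchyTransform (hS : IsCompact S) (hμ : μ Sᶜ = 0) {a : ℂ} (ha : a ∉ S) :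
    ∃ g : ℂ → ℂ, ∀ᶠ z in 𝓝 a, HasDerivAt g (∫ ζ, (z - ζ)⁻¹ ∂μ) z ∧
      (g z).re = (∫ ζ, Real.log ‖z - ζ‖ ∂μ) - ∫ ζ, Real.log ‖a - ζ‖ ∂μ := by
  have hd := infDist_pos_of_notMem hS hμ ha
  set d := Metric.infDist a S with hd'
  have hsub : ∀ ζ ∈ S, ∀ z ∈ Metric.ball a (d / 2), ‖(z - a) / (a - ζ)‖ ≤ 1 / 2 := by
    intro ζ hζ z hz
    have h1 := infDist_le_norm_sub (z := a) hζ
    rw [Metric.mem_ball, dist_eq_norm] at hz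
    rw [norm_div, div_le_iff₀ (hd.trans_le h1)]
    linarith
  have hne : ∀ ζ ∈ S, a - ζ ≠ 0 := fun ζ hζ h => ha (by rw [sub_eq_zero.1 h]; exact hζ)
  have hne' : ∀ ζ ∈ S, ∀ z ∈ Metric.ball a (d / 2), z - ζ ≠ 0 := by
    intro ζ hζ z hz h
    have h1 := infDist_le_norm_sub (z := a) hζ
    rw [Metric.mem_ball, dist_eq_norm] at hz
    rw [← sub_eq_zero.1 h, norm_sub_rev] at h1
    linarith
  have hsl : ∀ ζ ∈ S, ∀ z ∈ Metric.ball a (d / 2), 1 + (z - a) / (a - ζ) ∈ Complex.slitPlane :=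
    fun ζ hζ z hz => Complex.mem_slitPlane_of_norm_lt_one ((hsub ζ hζ z hz).trans_lt (by norm_num))
  have hF : ∀ z ∈ Metric.ball a (d / 2),
      Integrable (fun ζ => Complex.log (1 + (z - a) / (a - ζ))) μ := by
    intro z hz
    refine integrable_of_continuous_of_compl_null hS hμ ?_
    refine ContinuousOn.clog ?_ fun ζ hζ => hsl ζ hζ z hz
    exact continuousOn_const.add (continuousOn_const.div (by fun_prop) hne)
  have hF' : ∀ z ∈ Metric.ball a (d / 2), Integrable (fun ζ => (z - ζ)⁻¹) μ := by
    intro z hz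
    refine integrable_of_continuous_of_compl_null hS hμ ?_
    exact ContinuousOn.inv₀ (by fun_prop) fun ζ hζ => hne' ζ hζ z hz
  -- `1 + (z - a) / (a - ζ) = (z - ζ) / (a - ζ)`, written so that the principal branch is available
  refine ⟨fun z => ∫ ζ, Complex.log (1 + (z - a) / (a - ζ)) ∂μ, ?_⟩
  filter_upwards [Metric.ball_mem_nhds a (half_pos hd)] with z hz
  refine ⟨?_, ?_⟩
  · refine (hasDerivAt_integral_of_dominated_loc_of_deriv_le
      (F := fun z ζ => Complex.log (1 + (z - a) / (a - ζ))) (F' := fun z ζ => (z - ζ)⁻¹)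
      (bound := fun _ => (d / 2)⁻¹) (s := Metric.ball a (d / 2))
      (Metric.isOpen_ball.mem_nhds hz) ?_ (hF z hz) (hF' z hz).aestronglyMeasurable ?_
      (integrable_const _) ?_).2
    · filter_upwards [Metric.isOpen_ball.mem_nhds hz] with w hw using (hF w hw).aestronglyMeasurable
    · refine (ae_mem_of_compl_null hμ).mono fun ζ hζ w hw => ?_
      rw [norm_inv]
      refine inv_anti₀ (by positivity) ?_
      have h1 := infDist_le_norm_sub (z := a) hζ
      rw [Metric.mem_ball, dist_eq_norm, norm_sub_rev] at hw
      have h7 : ‖a - ζ‖ ≤ ‖a - w‖ + ‖w - ζ‖ := norm_sub_le_norm_sub_add_norm_sub _ _ _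
      linarith
    · refine (ae_mem_of_compl_null hμ).mono fun ζ hζ w hw => ?_
      have h1 : HasDerivAt (fun w => 1 + (w - a) / (a - ζ)) (1 / (a - ζ)) w :=
        (((hasDerivAt_id w).sub_const a).div_const (a - ζ)).const_add 1
      refine (h1.clog (hsl ζ hζ w hw)).congr_deriv ?_
      have := hne ζ hζ
      have h3 := hne' ζ hζ w hw
      have h4 : 1 + (w - a) / (a - ζ) = (w - ζ) / (a - ζ) := by field_simp; ring
      rw [h4]; field_simp
  · have h1 : ∀ w ∉ S, Integrable (fun ζ => Real.log ‖w - ζ‖) μ := by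
      intro w hw
      refine integrable_of_continuous_of_compl_null hS hμ (ContinuousOn.log (by fun_prop) ?_)
      intro ζ hζ h
      exact hw (by rw [sub_eq_zero.1 (norm_eq_zero.1 h)]; exact hζ)
    have hzS : z ∉ S := fun h => hne' z h z hz (sub_self z)
    rw [← integral_sub (h1 z hzS) (h1 a ha)]
    rw [show (∫ ζ, Complex.log (1 + (z - a) / (a - ζ)) ∂μ).re
      = ∫ ζ, (Complex.log (1 + (z - a) / (a - ζ))).re ∂μ from (integral_re (hF z hz)).symm]
    refine integral_congr_ae ((ae_mem_of_compl_null hμ).mono fun ζ hζ => ?_)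
    simp only [Complex.log_re]
    have := hne ζ hζ
    have h3 := hne' ζ hζ z hz
    have h4 : 1 + (z - a) / (a - ζ) = (z - ζ) / (a - ζ) := by field_simp; ring
    rw [h4, norm_div, Real.log_div (norm_ne_zero_iff.2 h3) (norm_ne_zero_iff.2 this)]

theorem differentiableOn_cauchyTransform (hS : IsCompact S) (hμ : μ Sᶜ = 0) :
    DifferentiableOn ℂ (fun z => ∫ ζ, (z - ζ)⁻¹ ∂μ) Sᶜ := by
  intro a ha
  obtain ⟨g, hg⟩ := exists_hasDerivAt_cauchyTransform hS hμ ha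
  have h1 : AnalyticAt ℂ g a := by
    rw [Complex.analyticAt_iff_eventually_differentiableAt]
    exact hg.mono fun z h => h.1.differentiableAt
  have h2 : deriv g =ᶠ[𝓝 a] fun z => ∫ ζ, (z - ζ)⁻¹ ∂μ := hg.mono fun z h => h.1.deriv
  exact (h1.deriv.differentiableAt.congr_of_eventuallyEq h2.symm).differentiableWithinAt

/-- The Cauchy transform of a probability measure does not vanish far from the support. -/
theorem exists_cauchyTransform_ne_zero (hS : IsCompact S) (hμ : μ Sᶜ = 0) :
    ∃ z ∉ S, ∫ ζ, (z - ζ)⁻¹ ∂μ ≠ 0 := by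
  obtain ⟨M, hM⟩ := hS.isBounded.subset_closedBall 0
  have hM' : ∀ ζ ∈ S, ‖ζ‖ ≤ max M 1 := fun ζ hζ =>
    (mem_closedBall_zero_iff.1 (hM hζ)).trans (le_max_left _ _)
  set M' : ℝ := max M 1
  have hM0 : 0 < M' := lt_of_lt_of_le one_pos (le_max_right _ _)
  -- `z ∫ (z - ζ)⁻¹ dμ(ζ)` differs from `1` by at most `M' / (2 M')`
  set z : ℂ := ((3 * M' : ℝ) : ℂ)
  have hz : ‖z‖ = 3 * M' := by simp [z, abs_of_pos hM0]
  have hzζ : ∀ ζ ∈ S, 2 * M' ≤ ‖z - ζ‖ := by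
    intro ζ hζ
    have := norm_sub_norm_le z ζ
    have := hM' ζ hζ
    linarith
  refine ⟨z, fun h => by have := hM' z h; linarith, fun h0 => ?_⟩
  have hne : ∀ ζ ∈ S, z - ζ ≠ 0 := fun ζ hζ h => by
    have := hzζ ζ hζ; rw [h, norm_zero] at this; linarith
  have hint : Integrable (fun ζ => (z - ζ)⁻¹) μ :=
    integrable_of_continuous_of_compl_null hS hμ (ContinuousOn.inv₀ (by fun_prop) hne)
  have h1 : ∫ ζ, (1 - z * (z - ζ)⁻¹) ∂μ = 1 := by
    rw [integral_sub (integrable_const _) (hint.const_mul _), integral_const_mul, h0]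
    simp
  have h2 : ‖∫ ζ, (1 - z * (z - ζ)⁻¹) ∂μ‖ ≤ 1 / 2 * μ.real Set.univ := by
    refine norm_integral_le_of_norm_le_const ((ae_mem_of_compl_null hμ).mono fun ζ hζ => ?_)
    have h3 : 1 - z * (z - ζ)⁻¹ = -ζ / (z - ζ) := by
      have := hne ζ hζ
      field_simp; ring
    rw [h3, norm_div, norm_neg, div_le_iff₀ (by have := hzζ ζ hζ; linarith)]
    have := hzζ ζ hζ
    have := hM' ζ hζ
    linarith
  rw [h1] at h2
  norm_num at h2

/-- The minimum principle: off `S`, whose complement is connected, the harmonic function `-P` has no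
local minimum. -/
theorem not_isLocalMin_integral_log (hS : IsCompact S) (hμ : μ Sᶜ = 0) (hSc : IsConnected Sᶜ)
    {a : ℂ} (ha : a ∉ S) : ¬ IsLocalMin (fun z => ∫ ζ, Real.log ‖z - ζ‖ ∂μ) a := by
  intro hmin
  obtain ⟨g, hg⟩ := exists_hasDerivAt_cauchyTransform hS hμ ha
  -- at a local minimum `exp (-g)` is locally constant, so that the Cauchy transform vanishes
  -- identically off `S`
  have hmax : IsLocalMax (norm ∘ fun z => Complex.exp (-g z)) a := by
    have hga := hg.self_of_nhds
    filter_upwards [hmin, hg] with z hz hgz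
    simp only [Function.comp, Complex.norm_exp, Complex.neg_re]
    rw [hgz.2, hga.2]
    refine Real.exp_le_exp.2 ?_
    linarith
  have hdiff : ∀ᶠ z in 𝓝 a, DifferentiableAt ℂ (fun z => Complex.exp (-g z)) z :=
    hg.mono fun z h => h.1.differentiableAt.neg.cexp
  have hconst := Complex.eventually_eq_of_isLocalMax_norm hdiff hmax
  have hzero : ∀ᶠ z in 𝓝 a, ∫ ζ, (z - ζ)⁻¹ ∂μ = 0 := by
    filter_upwards [hconst.eventually_nhds, hg] with z hz hgz
    have h1 : HasDerivAt (fun z => Complex.exp (-g z)) 0 z :=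
      (hasDerivAt_const z _).congr_of_eventuallyEq hz
    have h2 := hgz.1.neg.cexp.unique h1
    simpa using h2
  have han : AnalyticOnNhd ℂ (fun z => ∫ ζ, (z - ζ)⁻¹ ∂μ) Sᶜ :=
    (differentiableOn_cauchyTransform hS hμ).analyticOnNhd hS.isClosed.isOpen_compl
  have := han.eqOn_zero_of_preconnected_of_eventuallyEq_zero hSc.isPreconnected ha hzero
  obtain ⟨z, hz, hz0⟩ := exists_cauchyTransform_ne_zero hS hμ
  exact hz0 (this hz)

end CauchyTransform

/-! ### A two-constants inequality for polynomials -/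

section Interpolation

theorem prod_erase_abs_sub_eq (N j : ℕ) (hj : j ≤ N) :
    ∏ i ∈ (Finset.range (N + 1)).erase j, |(j : ℝ) - i| = (j.factorial * (N - j).factorial : ℕ) := by
  have h1 : ∏ i ∈ (Finset.range (N + 1)).erase j, |(j : ℝ) - i|
      = ∏ i ∈ Finset.range (N + 1), if i = j then 1 else |(j : ℝ) - i| := by
    rw [← Finset.mul_prod_erase (Finset.range (N + 1)) _ (Finset.mem_range.2 (by omega : j < N + 1))]
    rw [if_pos rfl, one_mul]
    exact Finset.prod_congr rfl fun i hi => by rw [if_neg (Finset.ne_of_mem_erase hi)]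
  rw [h1, show N + 1 = j + 1 + (N - j) by omega, Finset.prod_range_add, Finset.prod_range_succ,
    if_pos rfl, mul_one, Nat.cast_mul]
  congr 1
  · rw [← Finset.prod_range_add_one_eq_factorial, ← Finset.prod_range_reflect, Nat.cast_prod]
    refine Finset.prod_congr rfl fun i hi => ?_
    have hi' := Finset.mem_range.1 hi
    rw [if_neg (by omega)]
    have : ((j - 1 - i : ℕ) : ℝ) = j - 1 - i := by
      rw [Nat.cast_sub (by omega), Nat.cast_sub (by omega)]; simp
    push_cast
    rw [this, show (j : ℝ) - (j - 1 - i) = i + 1 by ring, abs_of_nonneg (by positivity)]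
  · rw [← Finset.prod_range_add_one_eq_factorial, Nat.cast_prod]
    refine Finset.prod_congr rfl fun i hi => ?_
    rw [if_neg (by omega), abs_sub_comm]
    push_cast
    rw [show ((j : ℝ) + 1 + i - j) = i + 1 by ring, abs_of_nonneg (by positivity)]

/-- The Lebesgue function of nodes at equally spaced distances from `p`. -/
theorem sum_norm_eval_basis_le {p : ℂ} {c : ℕ → ℂ} {N : ℕ} (hN : 0 < N) {η R : ℝ} (hη : 0 < η)
    (hc : ∀ j ≤ N, ‖c j - p‖ = η / 2 + j * (η / (2 * N))) {z : ℂ} (hz : ‖z - p‖ ≤ R) :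
    ∑ j ∈ Finset.range (N + 1), ‖(Lagrange.basis (Finset.range (N + 1)) c j).eval z‖
      ≤ (4 * Real.exp 1 * (R + η) / η) ^ N := by
  have hN' : (0 : ℝ) < N := by exact_mod_cast hN
  have hR : 0 ≤ R := (norm_nonneg _).trans hz
  have hzc : ∀ i ≤ N, ‖z - c i‖ ≤ R + η := by
    intro i hi
    have h1 : ‖z - c i‖ ≤ ‖z - p‖ + ‖p - c i‖ := norm_sub_le_norm_sub_add_norm_sub _ _ _
    rw [norm_sub_rev p, hc i hi] at h1
    have : (i : ℝ) * (η / (2 * N)) ≤ η / 2 := by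
      have h2 : (i : ℝ) ≤ N := by exact_mod_cast hi
      rw [← mul_div_assoc, div_le_div_iff₀ (by positivity) (by norm_num)]
      nlinarith
    linarith
  have hcc : ∀ i ≤ N, ∀ j ≤ N, |(j : ℝ) - i| * (η / (2 * N)) ≤ ‖c j - c i‖ := by
    intro i hi j hj
    have h1 := abs_norm_sub_norm_le (c j - p) (c i - p)
    rw [hc i hi, hc j hj, sub_sub_sub_cancel_right] at h1
    refine le_trans (le_of_eq ?_) h1
    rw [show η / 2 + ↑j * (η / (2 * ↑N)) - (η / 2 + ↑i * (η / (2 * ↑N)))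
      = ((j : ℝ) - i) * (η / (2 * N)) by ring, abs_mul, abs_of_pos (by positivity : 0 < η / (2 * N))]
  have hb : ∀ j ∈ Finset.range (N + 1),
      ‖(Lagrange.basis (Finset.range (N + 1)) c j).eval z‖
        ≤ ((R + η) * (2 * N) / η) ^ N * ((N.choose j : ℝ) / N.factorial) := by
    intro j hj
    have hj' : j ≤ N := by have := Finset.mem_range.1 hj; omega
    have hcard : ((Finset.range (N + 1)).erase j).card = N := by
      rw [Finset.card_erase_of_mem hj]; simp
    rw [Lagrange.basis, eval_prod, norm_prod]
    calc ∏ i ∈ (Finset.range (N + 1)).erase j, ‖(Lagrange.basisDivisor (c j) (c i)).eval z‖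
        ≤ ∏ i ∈ (Finset.range (N + 1)).erase j,
            ((R + η) * (2 * N) / η) * |(j : ℝ) - i|⁻¹ := by
          refine Finset.prod_le_prod (fun i _ => norm_nonneg _) fun i hi => ?_
          have hij : i ≠ j := Finset.ne_of_mem_erase hi
          have hi' : i ≤ N := by
            have := Finset.mem_range.1 (Finset.mem_of_mem_erase hi); omega
          have hij0 : 0 < |(j : ℝ) - i| := by
            rw [abs_pos, sub_ne_zero]; exact_mod_cast hij.symm
          rw [Lagrange.basisDivisor]
          simp only [eval_mul, eval_C, eval_sub, eval_X, norm_mul, norm_inv]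
          have h1 := hcc i hi' j hj'
          have h2 : 0 < |(j : ℝ) - i| * (η / (2 * N)) := by positivity
          calc ‖c j - c i‖⁻¹ * ‖z - c i‖ ≤ (|(j : ℝ) - i| * (η / (2 * N)))⁻¹ * (R + η) := by
                gcongr; exact hzc i hi'
            _ = _ := by field_simp
      _ = ((R + η) * (2 * N) / η) ^ N * ((N.choose j : ℝ) / N.factorial) := by
          rw [Finset.prod_mul_distrib, Finset.prod_const, hcard, Finset.prod_inv_distrib,
            prod_erase_abs_sub_eq N j hj']
          congr 1
          rw [Nat.cast_choose ℝ hj']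
          push_cast
          have h1 : (N.factorial : ℝ) ≠ 0 := by positivity
          have h2 : (j.factorial : ℝ) ≠ 0 := by positivity
          have h3 : ((N - j).factorial : ℝ) ≠ 0 := by positivity
          field_simp
  refine (Finset.sum_le_sum hb).trans ?_
  rw [← Finset.mul_sum, ← Finset.sum_div, ← Nat.cast_sum, Nat.sum_range_choose]
  have hexp : (N : ℝ) ^ N / N.factorial ≤ Real.exp 1 ^ N := by
    rw [← Real.exp_nat_mul, mul_one]
    exact Real.pow_div_factorial_le_exp _ hN'.le N
  calc ((R + η) * (2 * N) / η) ^ N * (((2 ^ N : ℕ) : ℝ) / N.factorial)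
      = (4 * (R + η) / η) ^ N * ((N : ℝ) ^ N / N.factorial) := by
        push_cast
        rw [← mul_div_assoc, ← mul_div_assoc, ← mul_pow, ← mul_pow]
        congr 2
        ring
    _ ≤ (4 * (R + η) / η) ^ N * Real.exp 1 ^ N := by gcongr
    _ = _ := by rw [← mul_pow]; congr 1; ring

/-- A two-constants inequality: a polynomial bounded by `b` on a unit circle and by `a` at `N + 1`
points equally spaced in distance from the centre, on the scale `η`, is nearly as small as `a` on
the disc of radius `η`. It is compared with its interpolation polynomial at these points. -/
theorem norm_eval_le_of_equispaced {w : ℂ[X]} {p : ℂ} {c : ℕ → ℂ} {N : ℕ} (hN : 0 < N) {η a b : ℝ}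
    (hη : 0 < η) (hη4 : 4 * η ≤ 1) (hb : 0 ≤ b)
    (hc : ∀ j ≤ N, ‖c j - p‖ = η / 2 + j * (η / (2 * N)))
    (hwa : ∀ j ≤ N, ‖w.eval (c j)‖ ≤ a) (hwb : ∀ z, ‖z - p‖ = 1 → ‖w.eval z‖ ≤ b)
    {z : ℂ} (hz : ‖z - p‖ ≤ η) :
    ‖w.eval z‖ ≤ 2 * (32 * Real.exp 1) ^ N * a + (4 * η) ^ N * b := by
  have hN' : (0 : ℝ) < N := by exact_mod_cast hN
  have ha : 0 ≤ a := (norm_nonneg _).trans (hwa 0 (Nat.zero_le _))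
  have hcη : ∀ i ≤ N, ‖c i - p‖ ≤ η := by
    intro i hi
    rw [hc i hi]
    have : (i : ℝ) * (η / (2 * N)) ≤ η / 2 := by
      have h2 : (i : ℝ) ≤ N := by exact_mod_cast hi
      rw [← mul_div_assoc, div_le_div_iff₀ (by positivity) (by norm_num)]
      nlinarith
    linarith
  set s := Finset.range (N + 1) with hs
  have hmem : ∀ i ∈ s, i ≤ N := fun i hi => by have := Finset.mem_range.1 hi; omega
  have hinj : Set.InjOn c s := by
    intro i hi j hj hij
    have h1 := hc i (hmem i hi)
    rw [hij, hc j (hmem j hj)] at h1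
    have h2 : (j : ℝ) = i := by
      have h3 : (j : ℝ) * (η / (2 * N)) = i * (η / (2 * N)) := by linarith
      exact mul_right_cancel₀ (by positivity) h3
    exact_mod_cast h2.symm
  -- `I` is the interpolation polynomial, and `w - I = W q` is estimated by the maximum principle
  set W := Lagrange.nodal s c with hW
  set I := w %ₘ W with hI
  set q := w /ₘ W with hq
  have hWm : W.Monic := Lagrange.nodal_monic
  have hwq : ∀ x, w.eval x = I.eval x + W.eval x * q.eval x := by
    intro x
    rw [← eval_mul, ← eval_add, modByMonic_add_div]
  have hIeq : I = Lagrange.interpolate s c fun i => w.eval (c i) := by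
    refine Lagrange.eq_interpolate_of_eval_eq _ hinj ?_ fun i hi => ?_
    · rw [← Lagrange.degree_nodal (s := s) (v := c)]
      exact degree_modByMonic_lt _ hWm
    · rw [hwq, hW, Lagrange.eval_nodal_at_node hi]; simp
  have hIb : ∀ R, ∀ x, ‖x - p‖ ≤ R → ‖I.eval x‖ ≤ (4 * Real.exp 1 * (R + η) / η) ^ N * a := by
    intro R x hx
    rw [hIeq, Lagrange.interpolate_apply, eval_finsetSum]
    refine (norm_sum_le _ _).trans ?_
    refine le_trans ?_ (mul_le_mul_of_nonneg_right (sum_norm_eval_basis_le hN hη hc hx) ha)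
    rw [Finset.sum_mul]
    refine Finset.sum_le_sum fun i hi => ?_
    rw [eval_mul, eval_C, norm_mul, mul_comm]
    exact mul_le_mul_of_nonneg_left (hwa i (hmem i hi)) (norm_nonneg _)
  have hcard : s.card = N + 1 := by simp [hs]
  have hWlow : ∀ x, ‖x - p‖ = 1 → (1 / 2 : ℝ) ^ (N + 1) ≤ ‖W.eval x‖ := by
    intro x hx
    rw [Lagrange.eval_nodal, norm_prod, ← hcard, ← Finset.prod_const]
    refine Finset.prod_le_prod (fun _ _ => by norm_num) fun i hi => ?_
    have h1 := norm_sub_norm_le (x - p) (c i - p)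
    rw [sub_sub_sub_cancel_right, hx] at h1
    have := hcη i (hmem i hi)
    linarith
  have hWup : ‖W.eval z‖ ≤ (2 * η) ^ (N + 1) := by
    rw [Lagrange.eval_nodal, norm_prod, ← hcard, ← Finset.prod_const]
    refine Finset.prod_le_prod (fun _ _ => norm_nonneg _) fun i hi => ?_
    have h1 : ‖z - c i‖ ≤ ‖z - p‖ + ‖p - c i‖ := norm_sub_le_norm_sub_add_norm_sub _ _ _
    rw [norm_sub_rev p] at h1
    have := hcη i (hmem i hi)
    linarith
  set A : ℝ := (8 * Real.exp 1 / η) ^ N * a with hA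
  have hA0 : 0 ≤ A := by positivity
  have hqb : ‖q.eval z‖ ≤ 2 ^ (N + 1) * (b + A) := by
    refine Complex.norm_le_of_forall_mem_frontier_norm_le (U := Metric.ball p 1)
      Metric.isBounded_ball (q.differentiable.diffContOnCl) (fun x hx => ?_) ?_
    · rw [frontier_ball p one_ne_zero, mem_sphere_iff_norm] at hx
      have h1 : ‖W.eval x * q.eval x‖ ≤ b + A := by
        rw [show W.eval x * q.eval x = w.eval x - I.eval x by rw [hwq]; ring]
        refine (norm_sub_le _ _).trans (add_le_add (hwb x hx) ?_)
        refine (hIb 1 x hx.le).trans ?_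
        have h8 : 4 * Real.exp 1 * (1 + η) ≤ 8 * Real.exp 1 := by nlinarith [Real.exp_pos 1]
        rw [hA]
        refine mul_le_mul_of_nonneg_right ?_ ha
        exact pow_le_pow_left₀ (by positivity) (div_le_div_of_nonneg_right h8 hη.le) N
      rw [norm_mul] at h1
      have h2 := mul_le_mul_of_nonneg_right (hWlow x hx) (norm_nonneg (q.eval x))
      have h3 : (1 / 2 : ℝ) ^ (N + 1) * ‖q.eval x‖ ≤ b + A := h2.trans h1
      calc ‖q.eval x‖ = 2 ^ (N + 1) * ((1 / 2 : ℝ) ^ (N + 1) * ‖q.eval x‖) := by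
            rw [← mul_assoc, ← mul_pow]; norm_num
        _ ≤ _ := by gcongr
    · refine subset_closure ?_
      rw [Metric.mem_ball, dist_eq_norm]; linarith
  have h4 : ‖W.eval z * q.eval z‖ ≤ (4 * η) ^ N * (b + A) := by
    rw [norm_mul]
    calc ‖W.eval z‖ * ‖q.eval z‖ ≤ (2 * η) ^ (N + 1) * (2 ^ (N + 1) * (b + A)) := by gcongr
      _ = (4 * η) ^ N * (4 * η) * (b + A) := by rw [← mul_assoc, ← mul_pow, ← pow_succ]; ring_nf
      _ ≤ (4 * η) ^ N * 1 * (b + A) := by gcongr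
      _ = _ := by ring
  have h5 : (4 * η) ^ N * A = (32 * Real.exp 1) ^ N * a := by
    rw [hA, ← mul_assoc, ← mul_pow]
    congr 2
    field_simp
    ring
  have h6 := hIb η z hz
  have h7 : (4 * Real.exp 1 * (η + η) / η) ^ N * a ≤ (32 * Real.exp 1) ^ N * a := by
    have : 4 * Real.exp 1 * (η + η) / η = 8 * Real.exp 1 := by field_simp; ring
    rw [this]
    gcongr
    norm_num
  rw [hwq]
  refine (norm_add_le _ _).trans ?_
  rw [mul_add, h5] at h4
  linarith

end Interpolation

/-! ### Connected components of lemniscates -/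

section Milloux

variable {S : Set ℂ} {μ : Measure ℂ} [IsProbabilityMeasure μ] {α : (n : ℕ) → Fin n → ℂ}

/-- Near a point `p` with `exp (-P) ≥ r` the connected pieces of the lemniscates
`{|w_n| ≤ ρ ^ n}`, `ρ < r`, are small: one that reaches a fixed distance from `p` would make
`|w_n|` too small on a whole circle around `p`. -/
theorem forall_isPreconnected_subset_ball (hS : IsCompact S) (hμ : μ Sᶜ = 0)
    (hα : ∀ n i, α n i ∈ S) (hdist : HasAsymptoticZeroDistribution α μ) {r ρ : ℝ} (hρ : 0 < ρ)
    (hρr : ρ < r) {p : ℂ} (hp : p ∉ potentialSublevel μ (ENNReal.ofReal r)) {η₀ : ℝ}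
    (hη₀ : 0 < η₀) :
    ∃ δ > 0, ∀ᶠ n in atTop, ∀ T : Set ℂ, IsPreconnected T →
      (∀ z ∈ T, ‖(nodePoly α n).eval z‖ ≤ ρ ^ n) → (T ∩ Metric.ball p δ).Nonempty →
        T ⊆ Metric.ball p η₀ := by
  obtain ⟨ρ₁, hρ₁, hρ₁r⟩ := exists_between hρr
  have hρ₁0 : 0 < ρ₁ := hρ.trans hρ₁
  -- with `n / k` interpolation points the factor `(32 e)^(n / k)` is compensated by `ρ < ρ₁`
  obtain ⟨k, hk⟩ := pow_unbounded_of_one_lt (32 * Real.exp 1) ((one_lt_div hρ).2 hρ₁)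
  have he : 1 ≤ 32 * Real.exp 1 := by
    have := Real.add_one_le_exp (1 : ℝ); linarith
  have hk0 : 0 < k := by
    rcases Nat.eq_zero_or_pos k with h | h
    · subst h; simp at hk; linarith
    · exact h
  obtain ⟨M₀, hM₀⟩ := hS.isBounded.subset_closedBall p
  set M : ℝ := max ρ (1 + M₀) with hM
  have hMpos : 0 < M := hρ.trans_le (le_max_left _ _)
  -- `η` is so small that `(4 η)^(n / k) M ^ n ≤ ρ ^ n`, where `M ^ n` bounds `|w_n|` on the unit
  -- circle around `p`
  set η : ℝ := min (min η₀ (1 / 4)) ((ρ / M) ^ (2 * k) / 4) with hη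
  have hη0 : 0 < η := by positivity
  have h4η : 4 * η ≤ (ρ / M) ^ (2 * k) := by
    have := min_le_right (min η₀ (1 / 4)) ((ρ / M) ^ (2 * k) / 4); linarith
  have h4η1 : 4 * η ≤ 1 := by
    have := (min_le_left (min η₀ (1 / 4)) ((ρ / M) ^ (2 * k) / 4)).trans (min_le_right _ _)
    linarith
  have hηη₀ : η ≤ η₀ := (min_le_left _ _).trans (min_le_left _ _)
  refine ⟨η / 2, by positivity, ?_⟩
  filter_upwards [exists_lt_norm_nodePoly hS hμ hα hdist hρ₁0 hρ₁r hp hη0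
    (by norm_num : (0 : ℝ) < 3), eventually_ge_atTop k] with n hn hnk T hT hTρ hTp
  by_contra hcon
  obtain ⟨y, hyT, hy⟩ := Set.not_subset.1 hcon
  obtain ⟨x, hxT, hx⟩ := hTp
  rw [Metric.mem_ball, dist_eq_norm] at hx hy
  obtain ⟨z, hz, hnz⟩ := hn
  set N : ℕ := n / k with hNdef
  have hN : 0 < N := Nat.div_pos hnk hk0
  have hNn : k * N ≤ n := Nat.mul_div_le n k
  have hnN : n ≤ 2 * k * N := by
    have := Nat.lt_mul_div_succ n hk0
    have h2 : k * (N + 1) ≤ 2 * k * N := by nlinarith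
    exact this.le.trans h2
  have hN' : (0 : ℝ) < N := by exact_mod_cast hN
  -- by connectedness `T` contains points at every distance between `η / 2` and `η` from `p`
  have hex : ∀ j : ℕ, j ≤ N → ∃ c ∈ T, ‖c - p‖ = η / 2 + j * (η / (2 * N)) := by
    intro j hj
    have hiv := hT.intermediate_value hxT hyT (f := fun c => ‖c - p‖) (by fun_prop)
    have h2 : (j : ℝ) * (η / (2 * N)) ≤ η / 2 := by
      have h2 : (j : ℝ) ≤ N := by exact_mod_cast hj
      rw [← mul_div_assoc, div_le_div_iff₀ (by positivity) (by norm_num)]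
      nlinarith
    have h3 : η / 2 + j * (η / (2 * N)) ∈ Set.Icc ‖x - p‖ ‖y - p‖ := by
      constructor
      · have : 0 ≤ (j : ℝ) * (η / (2 * N)) := by positivity
        linarith
      · linarith
    obtain ⟨c, hc, hc'⟩ := hiv h3
    exact ⟨c, hc, hc'⟩
  choose! c hcT hc using hex
  have hmain := norm_eval_le_of_equispaced (w := nodePoly α n) (b := M ^ n) hN hη0 h4η1
    (by positivity) hc (fun j hj => hTρ _ (hcT j hj)) (fun z hz => ?_) hz.le
  · have h1 : (32 * Real.exp 1) ^ N * ρ ^ n ≤ ρ₁ ^ n := by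
      calc (32 * Real.exp 1) ^ N * ρ ^ n ≤ ((ρ₁ / ρ) ^ k) ^ N * ρ ^ n := by gcongr
        _ = (ρ₁ / ρ) ^ (k * N) * ρ ^ n := by rw [pow_mul]
        _ ≤ (ρ₁ / ρ) ^ n * ρ ^ n := by
            gcongr
            exact ((one_lt_div hρ).2 hρ₁).le
        _ = ρ₁ ^ n := by rw [← mul_pow]; congr 1; field_simp
    have h2 : (4 * η) ^ N * M ^ n ≤ ρ₁ ^ n := by
      have hle : ρ / M ≤ 1 := (div_le_one hMpos).2 (le_max_left _ _)
      calc (4 * η) ^ N * M ^ n ≤ ((ρ / M) ^ (2 * k)) ^ N * M ^ n := by gcongr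
        _ = (ρ / M) ^ (2 * k * N) * M ^ n := by rw [← pow_mul]
        _ ≤ (ρ / M) ^ n * M ^ n := by
            have := pow_le_pow_of_le_one (by positivity) hle hnN
            gcongr
        _ = ρ ^ n := by rw [← mul_pow]; congr 1; field_simp
        _ ≤ ρ₁ ^ n := by gcongr
    linarith
  · rw [norm_nodePoly_eval]
    calc ∏ i, ‖z - α n i‖ ≤ ∏ _i : Fin n, M := by
          refine Finset.prod_le_prod (fun _ _ => norm_nonneg _) fun i _ => ?_
          have h1 : ‖z - α n i‖ ≤ ‖z - p‖ + ‖p - α n i‖ := norm_sub_le_norm_sub_add_norm_sub _ _ _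
          have h2 := hM₀ (hα n i)
          rw [mem_closedBall_iff_norm, norm_sub_rev] at h2
          exact (by linarith : ‖z - α n i‖ ≤ 1 + M₀).trans (le_max_right _ _)
      _ = M ^ n := by simp

/-- Every component of a lemniscate contains a zero, by the maximum principle for `1 / w`. -/
theorem exists_root_mem_connectedComponentIn {w : ℂ[X]} (hw : 0 < w.natDegree) {c : ℝ} {z : ℂ}
    (hz : ‖w.eval z‖ < c) :
    ∃ a ∈ connectedComponentIn {x | ‖w.eval x‖ < c} z, w.eval a = 0 := by
  set U : Set ℂ := {x | ‖w.eval x‖ < c} with hU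
  have hUo : IsOpen U := isOpen_lt (by fun_prop) continuous_const
  set L := connectedComponentIn U z with hL
  have hLo : IsOpen L := hUo.connectedComponentIn
  have hzL : z ∈ L := mem_connectedComponentIn hz
  have hLU : L ⊆ U := connectedComponentIn_subset _ _
  have hc : 0 < c := (norm_nonneg _).trans_lt hz
  by_contra! hcon
  -- without a zero `1 / w` would be holomorphic on the bounded set `L`, of modulus at most `1 / c`
  -- on its frontier, against `hz`
  have hfr : ∀ x ∈ frontier L, c ≤ ‖w.eval x‖ := by
    intro x hx
    by_contra! hxc
    have hxU : x ∈ U := hxc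
    have hV : IsOpen (connectedComponentIn U x) := hUo.connectedComponentIn
    obtain ⟨y, hyx, hyL⟩ := mem_closure_iff.1 hx.1 _ hV (mem_connectedComponentIn hxU)
    have h1 := connectedComponentIn_eq hyx
    have h2 := connectedComponentIn_eq hyL
    have h3 : x ∈ L := by
      rw [hL, h2, ← h1]; exact mem_connectedComponentIn hxU
    exact hx.2 (by rwa [hLo.interior_eq])
  have hne : ∀ x ∈ closure L, w.eval x ≠ 0 := by
    intro x hx
    by_cases hxL : x ∈ L
    · exact hcon x hxL
    · have : x ∈ frontier L := ⟨hx, by rwa [hLo.interior_eq]⟩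
      intro h0
      have := hfr x this
      rw [h0, norm_zero] at this; linarith
  have hbd : Bornology.IsBounded L := by
    have hdeg : 0 < w.degree := natDegree_pos_iff_degree_pos.1 hw
    have := w.tendsto_norm_atTop hdeg (tendsto_norm_cocompact_atTop (E := ℂ))
    have h1 : ∀ᶠ x in cocompact ℂ, c ≤ ‖w.eval x‖ := this.eventually_ge_atTop c
    rw [← Bornology.isCobounded_compl_iff, Bornology.isCobounded_def,
      Metric.cobounded_eq_cocompact]
    filter_upwards [h1] with x hx hxL
    exact absurd hx (not_le.2 (hLU hxL))
  have hdc : DiffContOnCl ℂ (fun x => (w.eval x)⁻¹) L := by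
    refine ⟨fun x hx => ?_, fun x hx => ?_⟩
    · exact (w.differentiable.differentiableAt.inv (hne x (subset_closure hx))).differentiableWithinAt
    · exact (w.continuous.continuousAt.inv₀ (hne x hx)).continuousWithinAt
  have h1 := Complex.norm_le_of_forall_mem_frontier_norm_le hbd hdc (C := c⁻¹) (fun x hx => by
    rw [norm_inv]; exact inv_anti₀ hc (hfr x hx)) (subset_closure hzL)
  rw [norm_inv] at h1
  have h2 := (inv_le_inv₀ (norm_pos_iff.2 (hne z (subset_closure hzL))) hc).1 h1
  exact absurd h2 (not_le.2 hz)

/-- The lemniscate component of a fixed point eventually avoids a compact set on which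
`exp (-P) ≥ r`. -/
theorem eventually_disjoint_connectedComponentIn (hS : IsCompact S) (hμ : μ Sᶜ = 0)
    (hα : ∀ n i, α n i ∈ S) (hdist : HasAsymptoticZeroDistribution α μ) {r ρ : ℝ} (hρ : 0 < ρ)
    (hρr : ρ < r) {K : Set ℂ} (hK : IsCompact K)
    (hKr : Disjoint K (potentialSublevel μ (ENNReal.ofReal r))) {z : ℂ} (hz : z ∉ K) :
    ∀ᶠ n in atTop, ‖(nodePoly α n).eval z‖ < ρ ^ n →
      Disjoint (connectedComponentIn {x | ‖(nodePoly α n).eval x‖ < ρ ^ n} z) K := by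
  have h1 : ∀ p ∈ K, ∃ δ > 0, ∀ᶠ n in atTop, ∀ T : Set ℂ, IsPreconnected T →
      (∀ z ∈ T, ‖(nodePoly α n).eval z‖ ≤ ρ ^ n) → (T ∩ Metric.ball p δ).Nonempty →
        T ⊆ Metric.ball p ‖z - p‖ := fun p hp =>
    forall_isPreconnected_subset_ball hS hμ hα hdist hρ hρr (Set.disjoint_left.1 hKr hp)
      (norm_pos_iff.2 (sub_ne_zero.2 fun h => hz (h ▸ hp)))
  choose! δ hδ hev using h1
  obtain ⟨t, htK, ht⟩ := hK.elim_nhds_subcover (fun p => Metric.ball p (δ p))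
    fun p hp => Metric.ball_mem_nhds p (hδ p hp)
  have h2 : ∀ᶠ n in atTop, ∀ p ∈ t, ∀ T : Set ℂ, IsPreconnected T →
      (∀ z ∈ T, ‖(nodePoly α n).eval z‖ ≤ ρ ^ n) → (T ∩ Metric.ball p (δ p)).Nonempty →
        T ⊆ Metric.ball p ‖z - p‖ :=
    (Filter.eventually_all_finset t).2 fun p hp => hev p (htK p hp)
  filter_upwards [h2] with n hn hzn
  rw [Set.disjoint_left]
  intro x hxL hxK
  obtain ⟨p, hp, hxp⟩ := Set.mem_iUnion₂.1 (ht hxK)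
  have h3 := hn p hp _ isPreconnected_connectedComponentIn
    (fun y hy => (connectedComponentIn_subset _ _ hy).le) ⟨x, hxL, hxp⟩
    (mem_connectedComponentIn hzn)
  rw [Metric.mem_ball, dist_eq_norm] at h3
  exact lt_irrefl _ h3

end Milloux

/-! ### Gluing a continuation with the given function -/

section Carrier

variable {S : Set ℂ} {μ : Measure ℂ} [IsProbabilityMeasure μ] {α : (n : ℕ) → Fin n → ℂ}

theorem mem_of_nodePoly_eval_eq_zero (hα : ∀ n i, α n i ∈ S) {n : ℕ} {a : ℂ}
    (ha : (nodePoly α n).eval a = 0) : a ∈ S := by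
  rw [nodePoly_eval, Finset.prod_eq_zero_iff] at ha
  obtain ⟨i, -, hi⟩ := ha
  rw [sub_eq_zero.1 hi]; exact hα n i

theorem eventually_norm_nodePoly_lt (hS : IsCompact S) (hμ : μ Sᶜ = 0) (hα : ∀ n i, α n i ∈ S)
    (hdist : HasAsymptoticZeroDistribution α μ) {r : ℝ} (hr : 0 < r) {z : ℂ}
    (hz : z ∈ potentialSublevel μ (ENNReal.ofReal r)) :
    ∀ᶠ n in atTop, ‖(nodePoly α n).eval z‖ < r ^ n := by
  obtain ⟨ρ, hρ, hρr, δ, hδ, h⟩ := exists_forall_norm_nodePoly_le hS hμ hα hdist hr hz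
  filter_upwards [h, eventually_ge_atTop 1] with n hn hn1
  exact (hn z (Metric.mem_ball_self hδ)).trans_lt (pow_lt_pow_left₀ hρr hρ.le (by omega))

/-- The value of `exp (-P)` at a point off `S` exceeds its value at some point of `S`. -/
theorem exists_mem_carrier_of_notMem (hS : IsCompact S) (hμ : μ Sᶜ = 0) (hSc : IsConnected Sᶜ)
    (hα : ∀ n i, α n i ∈ S) (hdist : HasAsymptoticZeroDistribution α μ) {z : ℂ} (hz : z ∉ S) :
    (S ∩ potentialSublevel μ
      (ENNReal.ofReal (Real.exp (∫ ζ, Real.log ‖z - ζ‖ ∂μ)))).Nonempty := by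
  set r := Real.exp (∫ ζ, Real.log ‖z - ζ‖ ∂μ) with hr
  have hr0 : 0 < r := Real.exp_pos _
  by_contra hcon
  have hdisj : Disjoint S (potentialSublevel μ (ENNReal.ofReal r)) := by
    rwa [Set.disjoint_iff_inter_eq_empty, ← Set.not_nonempty_iff_eq_empty]
  have hmin := not_isLocalMin_integral_log hS hμ hSc hz
  have hfreq : ∃ᶠ z' in 𝓝 z, ∫ ζ, Real.log ‖z' - ζ‖ ∂μ < ∫ ζ, Real.log ‖z - ζ‖ ∂μ := by
    intro h
    exact hmin (h.mono fun x hx => not_lt.1 hx)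
  obtain ⟨z', hz', hz'S⟩ :=
    (hfreq.and_eventually (hS.isClosed.isOpen_compl.mem_nhds hz)).exists
  -- a component of a lemniscate around `z'` avoids `S` although it contains a node
  obtain ⟨L, hL, hL'⟩ := exists_between hz'
  have hLr : Real.exp L < r := Real.exp_lt_exp.2 hL'
  have hz'E : z' ∈ potentialSublevel μ (ENNReal.ofReal (Real.exp L)) := by
    rw [mem_potentialSublevel_iff_of_notMem hS hμ (Real.exp_pos _) hz'S, Real.log_exp]
    exact hL
  obtain ⟨n, h1, h2, h3⟩ := ((eventually_norm_nodePoly_lt hS hμ hα hdist (Real.exp_pos _) hz'E).and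
    ((eventually_disjoint_connectedComponentIn hS hμ hα hdist (Real.exp_pos L) hLr hS hdisj
      hz'S).and (eventually_gt_atTop 0))).exists
  obtain ⟨a, haL, ha0⟩ := exists_root_mem_connectedComponentIn
    (w := nodePoly α n) (by rwa [nodePoly_natDegree]) h1
  exact Set.disjoint_left.1 (h2 h1) haL (mem_of_nodePoly_eval_eq_zero hα ha0)

/-- Some sublevel set of `exp (-P)` meets `S` and lies in the given neighbourhood of `S`; hence the
radius of meromorphy is larger than the infimum of `exp (-P)` on `S`. -/
theorem exists_potentialSublevel_subset (hS : IsCompact S) (hμ : μ Sᶜ = 0) (hSc : IsConnected Sᶜ)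
    (hα : ∀ n i, α n i ∈ S) (hdist : HasAsymptoticZeroDistribution α μ) {V : Set ℂ}
    (hV : IsOpen V) (hSV : S ⊆ V) :
    ∃ r : ℝ, 0 < r ∧ (S ∩ potentialSublevel μ (ENNReal.ofReal r)).Nonempty ∧
      potentialSublevel μ (ENNReal.ofReal r) ⊆ V := by
  obtain ⟨s, hs⟩ := nonempty_of_compl_null hμ
  set r₁ := Real.exp (truncPotential μ 1 s + 1) with hr₁
  have hr₁0 : 0 < r₁ := Real.exp_pos _
  have hsE : s ∈ potentialSublevel μ (ENNReal.ofReal r₁) := by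
    rw [mem_potentialSublevel_iff hS hμ hr₁0, hr₁, Real.log_exp]
    exact ⟨1, one_pos, by linarith⟩
  obtain ⟨B, hB⟩ := (isBounded_potentialSublevel hS hμ hr₁0).subset_closedBall 0
  have hK : IsCompact (Metric.closedBall (0 : ℂ) B \ V) :=
    (isCompact_closedBall 0 B).diff hV
  rcases (Metric.closedBall (0 : ℂ) B \ V).eq_empty_or_nonempty with hKe | hKne
  · refine ⟨r₁, hr₁0, ⟨s, hs, hsE⟩, fun z hz => ?_⟩
    by_contra hzV
    exact Set.notMem_empty z (hKe ▸ ⟨hB hz, hzV⟩)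
  -- below the minimum over the part of a large disc outside `V` the sublevel set stays in `V`
  obtain ⟨y, hyK, hy⟩ := hK.exists_isMinOn hKne (f := fun z => ∫ ζ, Real.log ‖z - ζ‖ ∂μ)
    fun z hz => (continuousAt_integral_log hS hμ fun h => hz.2 (hSV h)).continuousWithinAt
  have hyS : y ∉ S := fun h => hyK.2 (hSV h)
  set r₂ := Real.exp (∫ ζ, Real.log ‖y - ζ‖ ∂μ) with hr₂
  have hr₂0 : 0 < r₂ := Real.exp_pos _
  have hr0 : 0 < min r₁ r₂ := lt_min hr₁0 hr₂0
  refine ⟨min r₁ r₂, hr0, ?_, fun z hz => ?_⟩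
  · rcases min_choice r₁ r₂ with h | h
    · rw [h]; exact ⟨s, hs, hsE⟩
    · rw [h]; exact exists_mem_carrier_of_notMem hS hμ hSc hα hdist hyS
  · by_contra hzV
    have hzS : z ∉ S := fun h => hzV (hSV h)
    have hzB := hB (potentialSublevel_mono (ENNReal.ofReal_le_ofReal (min_le_left r₁ r₂)) hz)
    have h1 := (mem_potentialSublevel_iff_of_notMem hS hμ hr0 hzS).1 hz
    have h2 : ∫ ζ, Real.log ‖y - ζ‖ ∂μ ≤ ∫ ζ, Real.log ‖z - ζ‖ ∂μ := hy ⟨hzB, hzV⟩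
    have h3 : Real.log (min r₁ r₂) ≤ Real.log r₂ := Real.log_le_log hr0 (min_le_right _ _)
    rw [hr₂, Real.log_exp] at h3
    linarith

/-- A continuation `φ` to `E_μ(r)` of a function `ψ` given near `S` agrees with `ψ` on `E_μ(r')`
near each point of `S`, even near the points outside `E_μ(r)`: a lemniscate component around a point
of `E_μ(r')` is small there, contains a node, and lies in `E_μ(r)`, so the identity theorem applies
on it. -/
theorem exists_ball_eqOn_continuation (hS : IsCompact S) (hμ : μ Sᶜ = 0)
    (hα : ∀ n i, α n i ∈ S) (hdist : HasAsymptoticZeroDistribution α μ) {V : Set ℂ}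
    (hV : IsOpen V) (hSV : S ⊆ V) {r r' : ℝ} (hr' : 0 < r') (hrr' : r' < r) {φ ψ : ℂ → ℂ}
    (hφ : DifferentiableOn ℂ φ (potentialSublevel μ (ENNReal.ofReal r)))
    (hψ : DifferentiableOn ℂ ψ V)
    (h : ∀ z ∈ S ∩ potentialSublevel μ (ENNReal.ofReal r), φ =ᶠ[𝓝 z] ψ) {p : ℂ} (hp : p ∈ S) :
    ∃ δ > 0, Metric.ball p δ ⊆ V ∧
      Set.EqOn φ ψ (Metric.ball p δ ∩ potentialSublevel μ (ENNReal.ofReal r')) := by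
  have hEo := isOpen_potentialSublevel hS hμ (hr'.trans hrr')
  obtain ⟨d, hd, hdV⟩ := Metric.isOpen_iff.1 hV p (hSV hp)
  by_cases hpE : p ∈ potentialSublevel μ (ENNReal.ofReal r)
  · obtain ⟨δ, hδ, hδ'⟩ := Metric.eventually_nhds_iff_ball.1 (h p ⟨hp, hpE⟩)
    refine ⟨min δ d, lt_min hδ hd, (Metric.ball_subset_ball (min_le_right _ _)).trans hdV, ?_⟩
    exact fun z hz => hδ' z (Metric.ball_subset_ball (min_le_left _ _) hz.1)
  obtain ⟨δ, hδ, hev⟩ := forall_isPreconnected_subset_ball hS hμ hα hdist hr' hrr' hpE hd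
  refine ⟨min δ d, lt_min hδ hd, (Metric.ball_subset_ball (min_le_right _ _)).trans hdV, ?_⟩
  rintro z ⟨hzb, hzE⟩
  have hK : IsCompact (Metric.closedBall p d \ potentialSublevel μ (ENNReal.ofReal r)) :=
    (isCompact_closedBall p d).diff hEo
  have hzr := potentialSublevel_mono (ENNReal.ofReal_le_ofReal hrr'.le) hzE
  obtain ⟨n, h1, h2, h3, h4⟩ := (hev.and
    ((eventually_norm_nodePoly_lt hS hμ hα hdist hr' hzE).and
    ((eventually_disjoint_connectedComponentIn hS hμ hα hdist hr' hrr' hK Set.disjoint_sdiff_left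
      fun hz => hz.2 hzr).and (eventually_gt_atTop 0)))).exists
  obtain ⟨a, haL, ha0⟩ := exists_root_mem_connectedComponentIn
    (w := nodePoly α n) (by rwa [nodePoly_natDegree]) h2
  set L := connectedComponentIn {x | ‖(nodePoly α n).eval x‖ < r' ^ n} z with hL
  have hLo : IsOpen L := (isOpen_lt (by fun_prop) continuous_const).connectedComponentIn
  have hzL : z ∈ L := mem_connectedComponentIn h2
  have hLb : L ⊆ Metric.ball p d := h1 L isPreconnected_connectedComponentIn
    (fun x hx => (connectedComponentIn_subset _ _ hx).le)
    ⟨z, hzL, Metric.ball_subset_ball (min_le_left _ _) hzb⟩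
  have hLE : L ⊆ potentialSublevel μ (ENNReal.ofReal r) := by
    intro x hx
    by_contra hxE
    exact Set.disjoint_left.1 (h3 h2) hx ⟨Metric.ball_subset_closedBall (hLb hx), hxE⟩
  have h5 := ((hφ.mono hLE).analyticOnNhd hLo).eqOn_of_preconnected_of_eventuallyEq
    ((hψ.mono (hLb.trans hdV)).analyticOnNhd hLo) isPreconnected_connectedComponentIn haL
    (h a ⟨mem_of_nodePoly_eval_eq_zero hα ha0, hLE haL⟩)
  exact h5 hzL

/-- The continuation and the given function glue to one holomorphic function around
`S ∪ closure E_μ(r')`, equal to the first on a slightly larger sublevel set and to the second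
elsewhere. -/
theorem exists_glued_continuation (hS : IsCompact S) (hμ : μ Sᶜ = 0)
    (hα : ∀ n i, α n i ∈ S) (hdist : HasAsymptoticZeroDistribution α μ) {V : Set ℂ}
    (hV : IsOpen V) (hSV : S ⊆ V) {r r' : ℝ} (hr' : 0 < r') (hrr' : r' < r) {φ ψ : ℂ → ℂ}
    (hφ : DifferentiableOn ℂ φ (potentialSublevel μ (ENNReal.ofReal r)))
    (hψ : DifferentiableOn ℂ ψ V)
    (h : ∀ z ∈ S ∩ potentialSublevel μ (ENNReal.ofReal r), φ =ᶠ[𝓝 z] ψ) :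
    ∃ (O : Set ℂ) (G : ℂ → ℂ), IsOpen O ∧ S ⊆ O ∧
      closure (potentialSublevel μ (ENNReal.ofReal r')) ⊆ O ∧ DifferentiableOn ℂ G O ∧
      ∀ z ∈ S, G =ᶠ[𝓝 z] ψ := by
  classical
  obtain ⟨r'', hr'', hr''r⟩ := exists_between hrr'
  have hr''0 : 0 < r'' := hr'.trans hr''
  have hEo := isOpen_potentialSublevel hS hμ hr''0
  have hb := fun p (hp : p ∈ S) => exists_ball_eqOn_continuation hS hμ hα hdist hV hSV hr''0 hr''r
    hφ hψ h hp
  choose! δ hδ hδV hδeq using hb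
  set E := potentialSublevel μ (ENNReal.ofReal r'') with hE
  set G : ℂ → ℂ := E.piecewise φ ψ with hG
  have hGb : ∀ p ∈ S, Set.EqOn G ψ (Metric.ball p (δ p)) := by
    intro p hp z hz
    by_cases hzE : z ∈ E
    · rw [hG, Set.piecewise_eq_of_mem _ _ _ hzE]; exact hδeq p hp ⟨hz, hzE⟩
    · rw [hG, Set.piecewise_eq_of_notMem _ _ _ hzE]
  have hSO : S ⊆ E ∪ ⋃ p ∈ S, Metric.ball p (δ p) := fun p hp =>
    Or.inr (Set.mem_iUnion₂.2 ⟨p, hp, Metric.mem_ball_self (hδ p hp)⟩)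
  refine ⟨E ∪ ⋃ p ∈ S, Metric.ball p (δ p), G,
    hEo.union (isOpen_biUnion fun _ _ => Metric.isOpen_ball), hSO, ?_, ?_, ?_⟩
  · refine (closure_potentialSublevel_subset hS hμ hr' hr'').trans ?_
    exact Set.union_subset Set.subset_union_left hSO
  · rintro z (hz | hz)
    · have h1 : DifferentiableAt ℂ φ z := (hφ.mono
        (potentialSublevel_mono (ENNReal.ofReal_le_ofReal hr''r.le))).differentiableAt
        (hEo.mem_nhds hz)
      refine (h1.congr_of_eventuallyEq ?_).differentiableWithinAt
      filter_upwards [hEo.mem_nhds hz] with x hx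
      exact Set.piecewise_eq_of_mem _ _ _ hx
    · obtain ⟨p, hp, hzp⟩ := Set.mem_iUnion₂.1 hz
      have hm := Metric.isOpen_ball.mem_nhds hzp
      have h1 : DifferentiableAt ℂ ψ z := (hψ.mono (hδV p hp)).differentiableAt hm
      exact (h1.congr_of_eventuallyEq (eventually_of_mem hm (hGb p hp))).differentiableWithinAt
  · intro p hp
    exact eventually_of_mem (Metric.ball_mem_nhds p (hδ p hp)) (hGb p hp)

end Carrier

/-! ### The residue at infinity -/

section SquareIntegral

/-- The integral of `f` along the boundary of the square with centre `0` and side `2R`, traversed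
counterclockwise. -/
noncomputable def squareIntegral (f : ℂ → ℂ) (R : ℝ) : ℂ :=
  ∫ t in (-R)..R, (f (t + (-R : ℝ) * Complex.I) - f (t + R * Complex.I)
    + Complex.I * f (R + t * Complex.I) - Complex.I * f ((-R : ℝ) + t * Complex.I))

theorem le_norm_re_add {R t : ℝ} : |R| ≤ ‖(t : ℂ) + R * Complex.I‖ := by
  have := Complex.abs_im_le_norm ((t : ℂ) + R * Complex.I)
  simpa using this

theorem le_norm_add_im {R t : ℝ} : |R| ≤ ‖(R : ℂ) + t * Complex.I‖ := by
  have := Complex.abs_re_le_norm ((R : ℂ) + t * Complex.I)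
  simpa using this

theorem squareIntegral_inv {R : ℝ} (hR : 0 < R) :
    squareIntegral (fun z => z⁻¹) R = 2 * Real.pi * Complex.I := by
  have h1 : ∀ t : ℝ, ((t : ℂ) + (-R : ℝ) * Complex.I)⁻¹ - ((t : ℂ) + R * Complex.I)⁻¹
      + Complex.I * ((R : ℂ) + t * Complex.I)⁻¹ - Complex.I * (((-R : ℝ) : ℂ) + t * Complex.I)⁻¹
      = ((4 * (R / (R ^ 2 + t ^ 2)) : ℝ) : ℂ) * Complex.I := by
    intro t
    have hne : ∀ z : ℂ, R ≤ ‖z‖ → z ≠ 0 := fun z hz h => by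
      rw [h, norm_zero] at hz; linarith
    have a1 := hne ((t : ℂ) + (-R : ℝ) * Complex.I) (by
      have := le_norm_re_add (R := -R) (t := t); rwa [abs_neg, abs_of_pos hR] at this)
    have a2 := hne ((t : ℂ) + R * Complex.I) (by
      have := le_norm_re_add (R := R) (t := t); rwa [abs_of_pos hR] at this)
    have a3 := hne ((R : ℂ) + t * Complex.I) (by
      have := le_norm_add_im (R := R) (t := t); rwa [abs_of_pos hR] at this)
    have a4 := hne (((-R : ℝ) : ℂ) + t * Complex.I) (by
      have := le_norm_add_im (R := -R) (t := t); rwa [abs_neg, abs_of_pos hR] at this)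
    have a5 : ((R : ℂ) ^ 2 + t ^ 2) ≠ 0 := by
      have : R ^ 2 + t ^ 2 ≠ 0 := by positivity
      exact_mod_cast this
    push_cast at *
    have hI : Complex.I ^ 2 = -1 := Complex.I_sq
    have e1 : ((t : ℂ) + -R * Complex.I) * (t + R * Complex.I) = R ^ 2 + t ^ 2 := by
      linear_combination -(R : ℂ) ^ 2 * hI
    have e2 : ((R : ℂ) + t * Complex.I) * (-R + t * Complex.I) = -(R ^ 2 + t ^ 2) := by
      linear_combination (t : ℂ) ^ 2 * hI
    have key : ∀ x y : ℂ, x ≠ 0 → x * y = R ^ 2 + t ^ 2 → x⁻¹ = y / (R ^ 2 + t ^ 2) := by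
      intro x y hx hxy
      rw [eq_div_iff a5, ← hxy, inv_mul_cancel_left₀ hx]
    rw [key _ _ a1 e1, key _ _ a2 ((mul_comm _ _).trans e1),
      key _ (-(-R + t * Complex.I)) a3 (by rw [mul_neg, e2, neg_neg]),
      key _ (-(R + t * Complex.I)) a4 (by rw [mul_neg, mul_comm, e2, neg_neg])]
    field_simp
    ring
  unfold squareIntegral
  simp only [h1]
  rw [intervalIntegral.integral_mul_const, intervalIntegral.integral_ofReal,
    intervalIntegral.integral_const_mul, integral_div_sq_add_sq, div_self hR.ne', neg_div,
    div_self hR.ne', Real.arctan_neg, Real.arctan_one]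
  push_cast
  ring

/-- The residue at infinity, computed on large squares. -/
theorem tendsto_squareIntegral {f : ℂ → ℂ} {R₁ : ℝ}
    (hf : ContinuousOn f {z | R₁ ≤ ‖z‖}) {c : ℂ}
    (h : Tendsto (fun z => z * f z) (Bornology.cobounded ℂ) (𝓝 c)) :
    Tendsto (squareIntegral f) atTop (𝓝 (c * (2 * Real.pi * Complex.I))) := by
  rw [Metric.tendsto_atTop]
  intro ε hε
  have h1 := (Metric.tendsto_nhds.1 h) (ε / 16) (by positivity)
  obtain ⟨B, -, hB⟩ := hasBasis_cobounded_norm.eventually_iff.1 h1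
  refine ⟨max (max R₁ B) 1, fun R hR => ?_⟩
  have hR1 : R₁ ≤ R := (le_max_left _ _).trans ((le_max_left _ _).trans hR)
  have hRB : B ≤ R := (le_max_right _ _).trans ((le_max_left _ _).trans hR)
  have hR0 : 0 < R := lt_of_lt_of_le one_pos ((le_max_right _ _).trans hR)
  have hside : ∀ z : ℂ, R ≤ ‖z‖ → ‖f z - c * z⁻¹‖ ≤ ε / 16 / R := by
    intro z hz
    have hz0 : z ≠ 0 := fun h => by rw [h, norm_zero] at hz; linarith
    have h2 : dist (z * f z) c < ε / 16 := hB (hRB.trans hz)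
    rw [dist_eq_norm] at h2
    have h3 : f z - c * z⁻¹ = (z * f z - c) / z := by field_simp
    rw [h3, norm_div]
    gcongr
  have b1 : ∀ t : ℝ, R ≤ ‖(t : ℂ) + (-R : ℝ) * Complex.I‖ := fun t => by
    have := le_norm_re_add (R := -R) (t := t); rwa [abs_neg, abs_of_pos hR0] at this
  have b2 : ∀ t : ℝ, R ≤ ‖(t : ℂ) + R * Complex.I‖ := fun t => by
    have := le_norm_re_add (R := R) (t := t); rwa [abs_of_pos hR0] at this
  have b3 : ∀ t : ℝ, R ≤ ‖(R : ℂ) + t * Complex.I‖ := fun t => by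
    have := le_norm_add_im (R := R) (t := t); rwa [abs_of_pos hR0] at this
  have b4 : ∀ t : ℝ, R ≤ ‖((-R : ℝ) : ℂ) + t * Complex.I‖ := fun t => by
    have := le_norm_add_im (R := -R) (t := t); rwa [abs_neg, abs_of_pos hR0] at this
  have hcont : ∀ g : ℂ → ℂ, ContinuousOn g {z | R ≤ ‖z‖} →
      Continuous fun t : ℝ => g (t + (-R : ℝ) * Complex.I) - g (t + R * Complex.I)
        + Complex.I * g (R + t * Complex.I) - Complex.I * g ((-R : ℝ) + t * Complex.I) := by
    intro g hg
    refine ((Continuous.sub ?_ ?_).add (continuous_const.mul ?_)).sub (continuous_const.mul ?_)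
    · exact hg.comp_continuous (by fun_prop) b1
    · exact hg.comp_continuous (by fun_prop) b2
    · exact hg.comp_continuous (by fun_prop) b3
    · exact hg.comp_continuous (by fun_prop) b4
  have hcf := hcont f (hf.mono fun z hz => hR1.trans hz)
  have hci := hcont (fun z => z⁻¹) (continuousOn_id.inv₀ fun z hz h => by
    have : R ≤ ‖z‖ := hz
    rw [id_eq] at h
    rw [h, norm_zero] at this; linarith)
  rw [← squareIntegral_inv hR0, dist_eq_norm]
  unfold squareIntegral
  rw [← intervalIntegral.integral_const_mul, ← intervalIntegral.integral_sub
    (hcf.intervalIntegrable _ _) ((hci.const_mul c).intervalIntegrable _ _)]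
  have h4 := intervalIntegral.norm_integral_le_of_norm_le_const (a := -R) (b := R)
    (C := 4 * (ε / 16 / R)) (f := fun t : ℝ =>
      (f (t + (-R : ℝ) * Complex.I) - f (t + R * Complex.I)
        + Complex.I * f (R + t * Complex.I) - Complex.I * f ((-R : ℝ) + t * Complex.I))
      - c * (((t : ℂ) + (-R : ℝ) * Complex.I)⁻¹ - ((t : ℂ) + R * Complex.I)⁻¹
        + Complex.I * ((R : ℂ) + t * Complex.I)⁻¹
        - Complex.I * (((-R : ℝ) : ℂ) + t * Complex.I)⁻¹)) (fun t _ => ?_)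
  · refine h4.trans_lt ?_
    rw [sub_neg_eq_add, abs_of_pos (by positivity)]
    have : 4 * (ε / 16 / R) * (R + R) = ε / 2 := by field_simp; ring
    rw [this]; linarith
  · have e : ∀ A B C D a b c' d : ℂ, (A - B + Complex.I * C - Complex.I * D)
        - c * (a - b + Complex.I * c' - Complex.I * d)
        = (A - c * a) - (B - c * b) + Complex.I * (C - c * c') - Complex.I * (D - c * d) := by
      intros; ring
    rw [e]
    refine (norm_sub_le _ _).trans ?_
    refine (add_le_add_left ((norm_add_le _ _).trans (add_le_add_left (norm_sub_le _ _) _)) _).trans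
      ?_
    rw [norm_mul, norm_mul, Complex.norm_I, one_mul, one_mul]
    have := hside _ (b1 t)
    have := hside _ (b2 t)
    have := hside _ (b3 t)
    have := hside _ (b4 t)
    linarith

theorem tendsto_eval_div_pow {p : ℂ[X]} {N : ℕ} (hp : p.natDegree ≤ N) :
    Tendsto (fun z => p.eval z / z ^ N) (Bornology.cobounded ℂ) (𝓝 (p.coeff N)) := by
  have h1 : ∀ z : ℂ, p.eval z / z ^ N = ∑ k ∈ Finset.range (N + 1), p.coeff k * (z ^ k / z ^ N) := by
    intro z
    rw [eval_eq_sum_range' (Nat.lt_succ_of_le hp), Finset.sum_div]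
    exact Finset.sum_congr rfl fun k _ => by ring
  simp only [h1]
  have h2 : p.coeff N = ∑ k ∈ Finset.range (N + 1), p.coeff k * (if k = N then 1 else 0) := by
    simp
  rw [h2]
  refine tendsto_finsetSum _ fun k hk => Tendsto.const_mul _ ?_
  have hne : ∀ᶠ z in Bornology.cobounded ℂ, z ≠ (0 : ℂ) :=
    hasBasis_cobounded_norm.eventually_iff.2 ⟨1, trivial, fun z (hz : (1 : ℝ) ≤ ‖z‖) h => by
      rw [h, norm_zero] at hz; linarith⟩
  split_ifs with hkN
  · subst hkN
    refine tendsto_const_nhds.congr' (hne.mono fun z hz => ?_)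
    exact (div_self (pow_ne_zero _ hz)).symm
  · have hlt : k < N := by have := Finset.mem_range.1 hk; omega
    have h3 : Tendsto (fun z : ℂ => (z⁻¹) ^ (N - k)) (Bornology.cobounded ℂ) (𝓝 0) := by
      have := (tendsto_inv₀_cobounded (α := ℂ)).pow (N - k)
      rwa [zero_pow (by omega)] at this
    refine h3.congr' (hne.mono fun z hz => ?_)
    rw [inv_pow, eq_div_iff (pow_ne_zero _ hz), inv_mul_eq_iff_eq_mul₀ (pow_ne_zero _ hz),
      ← pow_add]
    congr 1; omega

end SquareIntegral

/-! ### Leading coefficients of interpolating polynomials -/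

section Cutoff

/-- The operator `2i ∂/∂z̄`. -/
noncomputable def dbar (f : ℂ → ℂ) (z : ℂ) : ℂ :=
  Complex.I • fderiv ℝ f z 1 - fderiv ℝ f z Complex.I

theorem dbar_eq_zero {f : ℂ → ℂ} {z : ℂ} (h : DifferentiableAt ℂ f z) : dbar f z = 0 := by
  rw [dbar, h.fderiv_restrictScalars ℝ]
  have : fderiv ℂ f z Complex.I = Complex.I • fderiv ℂ f z 1 := by
    rw [← map_smul]; simp
  simp [this]

theorem Filter.EventuallyEq.dbar_eq {f g : ℂ → ℂ} {z : ℂ} (h : f =ᶠ[𝓝 z] g) :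
    dbar f z = dbar g z := by
  rw [dbar, dbar, h.fderiv_eq]

theorem dbar_mul_sub {χ f g : ℂ → ℂ} {z : ℂ} (hχ : DifferentiableAt ℝ χ z)
    (hf : DifferentiableAt ℂ f z) (hg : DifferentiableAt ℂ g z) :
    dbar (fun x => χ x * f x - g x) z = dbar χ z * f z := by
  have hf' := hf.restrictScalars ℝ
  have hg' := hg.restrictScalars ℝ
  have h1 := dbar_eq_zero hf
  have h2 := dbar_eq_zero hg
  rw [dbar] at h1 h2 ⊢
  rw [fderiv_fun_sub (hχ.fun_mul hf') hg', fderiv_fun_mul hχ hf']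
  simp only [sub_apply, add_apply, smul_apply, smul_eq_mul, dbar] at *
  linear_combination χ z * h1 - h2

theorem exists_cutoff {K O : Set ℂ} (hK : IsCompact K) (hO : IsOpen O) (hKO : K ⊆ O) :
    ∃ (χ : ℂ → ℂ) (Z : Set ℂ), ContDiff ℝ 1 χ ∧ IsCompact Z ∧ Z ⊆ O \ K ∧
      (∀ z ∈ K, χ =ᶠ[𝓝 z] 1) ∧ (∀ z ∉ O, χ =ᶠ[𝓝 z] 0) ∧
      (∀ᶠ z in Bornology.cobounded ℂ, χ z = 0) ∧
      ∀ z ∉ Z, fderiv ℝ χ =ᶠ[𝓝 z] 0 := by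
  obtain ⟨K', hK', hKK', hK'O⟩ := exists_compact_between hK hO hKO
  obtain ⟨f, hf0, hf1, -⟩ := exists_contMDiffMap_zero_one_nhds_of_isClosed (n := 1)
    (modelWithCornersSelf ℝ ℂ) (isOpen_interior.isClosed_compl : IsClosed (interior K')ᶜ)
    hK.isClosed (Set.disjoint_left.2 fun z hz hzK => hz (hKK' hzK))
  set χ : ℂ → ℂ := fun z => (f z : ℂ) with hχ
  have hχ0 : ∀ z ∉ interior K', χ =ᶠ[𝓝 z] 0 := fun z hz =>
    (eventually_nhdsSet_iff_forall.1 hf0 z hz).mono fun x hx => by simp [hχ, hx]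
  have hχ1 : ∀ z ∈ K, χ =ᶠ[𝓝 z] 1 := fun z hz =>
    (eventually_nhdsSet_iff_forall.1 hf1 z hz).mono fun x hx => by simp [hχ, hx]
  have hsub : tsupport (fderiv ℝ χ) ⊆ interior K' := by
    intro z hz
    by_contra hzK
    refine (notMem_tsupport_iff_eventuallyEq.2 ?_) hz
    filter_upwards [(hχ0 z hzK).eventually_nhds] with x hx
    rw [Filter.EventuallyEq.fderiv_eq hx]
    simp
  refine ⟨χ, tsupport (fderiv ℝ χ), ?_, ?_, ?_, hχ1, fun z hz => hχ0 z fun h =>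
    hz (hK'O (interior_subset h)), ?_, fun z hz => notMem_tsupport_iff_eventuallyEq.1 hz⟩
  · exact Complex.ofRealCLM.contDiff.comp f.contMDiff.contDiff
  · exact hK'.of_isClosed_subset (isClosed_tsupport _) (hsub.trans interior_subset)
  · intro z hz
    refine ⟨hK'O (interior_subset (hsub hz)), fun hzK => ?_⟩
    refine (notMem_tsupport_iff_eventuallyEq.2 ?_) hz
    filter_upwards [(hχ1 z hzK).eventually_nhds] with x hx
    rw [Filter.EventuallyEq.fderiv_eq hx]
    simp
  · filter_upwards [Bornology.isBounded_def.1 hK'.isBounded] with z hz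
    exact (hχ0 z fun h => hz (interior_subset h)).self_of_nhds

/-- The integral bound for a divided difference: `T` interpolates `Q G` at the zeros of `w`, with
remainder `h w`, and its coefficient is the residue at infinity of `T / w`. A cutoff function plays
the part of a contour around the zeros of `w`; the contour is the compact set `Z`. -/
theorem exists_norm_coeff_le {K O : Set ℂ} (hK : IsCompact K) (hO : IsOpen O) (hKO : K ⊆ O)
    {G : ℂ → ℂ} (hG : DifferentiableOn ℂ G O) :
    ∃ (Z : Set ℂ) (A : ℝ), IsCompact Z ∧ Z ⊆ O \ K ∧ 0 ≤ A ∧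
      ∀ (w Q T : ℂ[X]) (h : ℂ → ℂ) (N : ℕ) (b B : ℝ), w.Monic → w.natDegree = N + 1 →
        T.natDegree ≤ N → 0 < b → 0 ≤ B →
        (∀ z, w.eval z = 0 → z ∈ K ∧ ∀ᶠ x in 𝓝 z, DifferentiableAt ℂ h x ∧
          Q.eval x * G x - T.eval x = h x * w.eval x) →
        (∀ z ∈ Z, b ≤ ‖w.eval z‖) → (∀ z ∈ Z, ‖Q.eval z‖ ≤ B) → ‖T.coeff N‖ ≤ A * (B / b) := by
  obtain ⟨χ, Z, hχ, hZ, hZOK, hχ1, hχ0, hχb, hχZ⟩ := exists_cutoff hK hO hKO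
  obtain ⟨R₀, hR₀⟩ := hZ.isBounded.subset_ball 0
  have hχd : Differentiable ℝ χ := hχ.differentiable one_ne_zero
  have hdχ : Continuous (dbar χ) := by
    have h1 : Continuous (fderiv ℝ χ) := hχ.continuous_fderiv one_ne_zero
    exact ((h1.clm_apply continuous_const).const_smul Complex.I).sub
      (h1.clm_apply continuous_const)
  have hdχ0 : ∀ z ∉ Z, dbar χ =ᶠ[𝓝 z] 0 := fun z hz => (hχZ z hz).mono fun x hx => by
    simp [dbar, hx]
  obtain ⟨M, hM⟩ := hZ.exists_bound_of_continuousOn (f := fun z => dbar χ z * G z)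
    (hdχ.continuousOn.mul (hG.continuousOn.mono fun z hz => (hZOK hz).1))
  set R₁ := max R₀ 0 with hR₁
  have hR₁0 : 0 ≤ R₁ := le_max_right _ _
  refine ⟨Z, (max M 0) * (2 * R₁) ^ 2, hZ, hZOK, by positivity, ?_⟩
  intro w Q T h N b B hw hwN hT hb hB0 hroot hwb hQB
  classical
  -- `Y = (χ Q G - T) / w` extends smoothly across the zeros of `w`, where it equals `h`; Green's
  -- formula on large squares compares its residue at infinity with the integral of `D = dbar Y`
  set Y : ℂ → ℂ := fun z => if w.eval z = 0 then h z else
    χ z * (Q.eval z * G z / w.eval z) - T.eval z / w.eval z with hY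
  set D : ℂ → ℂ := fun z => dbar χ z * (Q.eval z * G z / w.eval z) with hD
  have hwne : ∀ z, w.eval z ≠ 0 → ∀ᶠ x in 𝓝 z, w.eval x ≠ 0 := fun z hz =>
    w.continuous.continuousAt.eventually_ne hz
  have hYD : ∀ z, DifferentiableAt ℝ Y z ∧ dbar Y z = D z := by
    intro z
    by_cases hz : w.eval z = 0
    · obtain ⟨hzK, hev⟩ := hroot z hz
      have hYh : Y =ᶠ[𝓝 z] h := by
        filter_upwards [hev, hχ1 z hzK] with x hx hx1
        by_cases hx0 : w.eval x = 0
        · simp [hY, hx0]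
        · simp only [hY, hx0, if_false]
          rw [hx1]
          simp only [Pi.one_apply, one_mul]
          rw [← sub_div, hx.2, mul_div_cancel_right₀ _ hx0]
      have hdh : DifferentiableAt ℂ h z := hev.self_of_nhds.1
      refine ⟨(hdh.restrictScalars ℝ).congr_of_eventuallyEq hYh, ?_⟩
      rw [hYh.dbar_eq, dbar_eq_zero hdh, hD]
      simp [hz]
    · have hYe : Y =ᶠ[𝓝 z] fun x => χ x * (Q.eval x * G x / w.eval x) - T.eval x / w.eval x := by
        filter_upwards [hwne z hz] with x hx
        simp [hY, hx]
      have hTd : DifferentiableAt ℂ (fun x => T.eval x / w.eval x) z :=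
        T.differentiable.differentiableAt.div w.differentiable.differentiableAt hz
      by_cases hzO : z ∈ O
      · have hGd : DifferentiableAt ℂ (fun x => Q.eval x * G x / w.eval x) z :=
          (Q.differentiable.differentiableAt.mul (hG.differentiableAt (hO.mem_nhds hzO))).div
            w.differentiable.differentiableAt hz
        refine ⟨DifferentiableAt.congr_of_eventuallyEq ?_ hYe, ?_⟩
        · exact ((hχd z).mul (hGd.restrictScalars ℝ)).sub (hTd.restrictScalars ℝ)
        · rw [hYe.dbar_eq, dbar_mul_sub (hχd z) hGd hTd]
      · have hY0 : Y =ᶠ[𝓝 z] fun x => -(T.eval x / w.eval x) := by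
          filter_upwards [hYe, hχ0 z hzO] with x hx hx0
          rw [hx, hx0]; simp
        refine ⟨(hTd.fun_neg.restrictScalars ℝ).congr_of_eventuallyEq hY0, ?_⟩
        rw [hY0.dbar_eq, dbar_eq_zero hTd.fun_neg, hD]
        have := (hdχ0 z fun hzZ => hzO (hZOK hzZ).1).self_of_nhds
        simp [this]
  have hD0 : ∀ z ∉ Z, D =ᶠ[𝓝 z] 0 := fun z hz => (hdχ0 z hz).mono fun x hx => by simp [hD, hx]
  have hwZ : ∀ z ∈ Z, w.eval z ≠ 0 := fun z hz h0 => (hZOK hz).2 (hroot z h0).1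
  have hDc : Continuous D := by
    rw [continuous_iff_continuousAt]
    intro z
    by_cases hz : z ∈ Z
    · have hGc : ContinuousAt G z := (hG.differentiableAt (hO.mem_nhds (hZOK hz).1)).continuousAt
      exact hdχ.continuousAt.mul ((Q.continuous.continuousAt.mul hGc).div
        w.continuous.continuousAt (hwZ z hz))
    · exact (continuousAt_const (y := (0 : ℂ))).congr (hD0 z hz).symm
  have hDb : ∀ z, ‖D z‖ ≤ (max M 0) * (B / b) ∨ D z = 0 := by
    intro z
    by_cases hz : z ∈ Z
    · left
      have h1 : D z = (dbar χ z * G z) * (Q.eval z / w.eval z) := by simp only [hD]; ring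
      rw [h1, norm_mul, norm_div]
      have h3 := hwb z hz
      have h4 := hQB z hz
      have h5 := (hM z hz).trans (le_max_left M 0)
      gcongr
    · exact Or.inr (hD0 z hz).self_of_nhds
  -- outside the square of side `2 R₁` the integrand vanishes, so the double integral is constant
  have hDR : ∀ x y : ℝ, (x ∉ Set.Ioc (-R₁) R₁ ∨ y ∉ Set.Ioc (-R₁) R₁) →
      D (x + y * Complex.I) = 0 := by
    intro x y hxy
    have hnZ : (x + y * Complex.I : ℂ) ∉ Z := by
      intro hz
      have h1 := mem_ball_zero_iff.1 (hR₀ hz)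
      have h2 := Complex.abs_re_le_norm (x + y * Complex.I : ℂ)
      have h3 := Complex.abs_im_le_norm (x + y * Complex.I : ℂ)
      simp only [Complex.add_re, Complex.ofReal_re, Complex.mul_re, Complex.I_re, mul_zero,
        Complex.ofReal_im, Complex.I_im, mul_one, sub_self, add_zero, Complex.add_im,
        Complex.mul_im, zero_add] at h2 h3
      have h4 : R₀ ≤ R₁ := le_max_left _ _
      have h5 := abs_lt.1 (lt_of_le_of_lt h2 (h1.trans_le h4))
      have h6 := abs_lt.1 (lt_of_le_of_lt h3 (h1.trans_le h4))
      rcases hxy with hx | hy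
      · exact hx ⟨h5.1, h5.2.le⟩
      · exact hy ⟨h6.1, h6.2.le⟩
    exact (hD0 _ hnZ).self_of_nhds
  set J : ℝ → ℂ := fun R => ∫ x in (-R)..R, ∫ y in (-R)..R, D (x + y * Complex.I) with hJ
  have hJc : ∀ R ≥ R₁, J R = ∫ x : ℝ, ∫ y : ℝ, D (x + y * Complex.I) := by
    intro R hR
    have hsub : Set.Ioc (-R₁) R₁ ⊆ Set.Ioc (-R) R := Set.Ioc_subset_Ioc (neg_le_neg hR) hR
    have h1 : ∀ x : ℝ, ∫ y in (-R)..R, D (x + y * Complex.I)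
        = ∫ y : ℝ, D (x + y * Complex.I) := fun x =>
      intervalIntegral.integral_eq_integral_of_support_subset fun y hy => by
        by_contra hyR
        exact hy (hDR x y (Or.inr fun h => hyR (hsub h)))
    rw [hJ]
    simp only [h1]
    refine intervalIntegral.integral_eq_integral_of_support_subset fun x hx => ?_
    by_contra hxR
    refine hx ?_
    have : ∀ y : ℝ, D (x + y * Complex.I) = 0 := fun y => hDR x y (Or.inl fun h => hxR (hsub h))
    simp [this]
  have hJb : ‖J R₁‖ ≤ (max M 0) * (2 * R₁) ^ 2 * (B / b) := by
    have hBb : 0 ≤ B / b := div_nonneg hB0 hb.le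
    have hb1 : ∀ z, ‖D z‖ ≤ (max M 0) * (B / b) := fun z => (hDb z).elim id fun h0 => by
      rw [h0, norm_zero]; positivity
    have h2 : ∀ x : ℝ, ‖∫ y in (-R₁)..R₁, D (x + y * Complex.I)‖
        ≤ (max M 0) * (B / b) * |R₁ - -R₁| := fun x =>
      intervalIntegral.norm_integral_le_of_norm_le_const fun y _ => hb1 _
    have h3 := intervalIntegral.norm_integral_le_of_norm_le_const (a := -R₁) (b := R₁)
      (f := fun x : ℝ => ∫ y in (-R₁)..R₁, D (x + y * Complex.I)) fun x _ => h2 x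
    refine h3.trans (le_of_eq ?_)
    rw [sub_neg_eq_add, ← two_mul, abs_of_nonneg (by positivity)]
    ring
  have hgreen : ∀ R, squareIntegral Y R = J R := by
    intro R
    have h1 := Complex.integral_boundary_rect_of_differentiableOn_real Y ⟨-R, -R⟩ ⟨R, R⟩
      (fun z _ => (hYD z).1.differentiableWithinAt) (by
        have : (fun z => Complex.I • fderiv ℝ Y z 1 - fderiv ℝ Y z Complex.I) = D :=
          funext fun z => (hYD z).2
        rw [this]
        exact hDc.continuousOn.integrableOn_compact (isCompact_uIcc.reProdIm isCompact_uIcc))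
    have h2 : ∀ z, Complex.I • fderiv ℝ Y z 1 - fderiv ℝ Y z Complex.I = D z :=
      fun z => (hYD z).2
    simp only [h2] at h1
    rw [hJ]
    simp only
    rw [← h1]
    have hYc : Continuous Y := (show Differentiable ℝ Y from fun z => (hYD z).1).continuous
    have c1 : Continuous fun t : ℝ => Y (t + (-R : ℝ) * Complex.I) := hYc.comp (by fun_prop)
    have c2 : Continuous fun t : ℝ => Y (t + R * Complex.I) := hYc.comp (by fun_prop)
    have c3 : Continuous fun t : ℝ => Complex.I * Y (R + t * Complex.I) :=
      continuous_const.mul (hYc.comp (by fun_prop))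
    have c4 : Continuous fun t : ℝ => Complex.I * Y ((-R : ℝ) + t * Complex.I) :=
      continuous_const.mul (hYc.comp (by fun_prop))
    have c12 : Continuous fun t : ℝ => Y (t + (-R : ℝ) * Complex.I) - Y (t + R * Complex.I) :=
      c1.sub c2
    have c123 : Continuous fun t : ℝ => Y (t + (-R : ℝ) * Complex.I) - Y (t + R * Complex.I)
        + Complex.I * Y (R + t * Complex.I) := c12.add c3
    rw [squareIntegral, intervalIntegral.integral_sub (c123.intervalIntegrable _ _)
      (c4.intervalIntegrable _ _), intervalIntegral.integral_add
      (c12.intervalIntegrable _ _) (c3.intervalIntegrable _ _),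
      intervalIntegral.integral_sub (c1.intervalIntegrable _ _) (c2.intervalIntegrable _ _),
      intervalIntegral.integral_const_mul, intervalIntegral.integral_const_mul]
    rfl
  have hlim : Tendsto (fun z => z * Y z) (Bornology.cobounded ℂ) (𝓝 (-T.coeff N)) := by
    have h1 := (tendsto_eval_div_pow hT).div (tendsto_eval_div_pow hwN.le)
      (by rw [← hwN, hw.coeff_natDegree]; exact one_ne_zero)
    rw [← hwN, hw.coeff_natDegree, div_one, hwN] at h1
    refine h1.neg.congr' ?_
    filter_upwards [hχb, Bornology.isBounded_def.1 hK.isBounded,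
      Bornology.isBounded_def.1 (Bornology.isBounded_singleton (x := (0 : ℂ)))] with z hz hzK hz0
    have hz0' : z ≠ 0 := hz0
    have hwz : w.eval z ≠ 0 := fun h0 => hzK (hroot z h0).1
    simp only [hY, hwz, if_false, hz, zero_mul, zero_sub, Pi.div_apply, pow_succ]
    field_simp
  have hYc : Continuous Y := (show Differentiable ℝ Y from fun z => (hYD z).1).continuous
  have h1 := tendsto_squareIntegral (R₁ := 0) hYc.continuousOn hlim
  have h2 : Tendsto (squareIntegral Y) atTop (𝓝 (J R₁)) := by
    refine tendsto_const_nhds.congr' ?_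
    filter_upwards [eventually_ge_atTop R₁] with R hR
    rw [hgreen, hJc R hR, hJc R₁ le_rfl]
  have h3 := tendsto_nhds_unique h1 h2
  rw [← h3] at hJb
  have h4 : ‖-T.coeff N * (2 * Real.pi * Complex.I)‖ = ‖T.coeff N‖ * (2 * Real.pi) := by
    simp [abs_of_pos Real.pi_pos]
  rw [h4] at hJb
  have h5 := Real.pi_gt_three
  nlinarith [norm_nonneg (T.coeff N)]

end Cutoff

/-! ### Padé pairs and normalized denominators -/

section Pade

/-- Hermite interpolation with holomorphic remainder. -/
theorem exists_interpolation {ι : Type*} {V : Set ℂ} (hV : IsOpen V) {f : ℂ → ℂ}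
    (hf : DifferentiableOn ℂ f V) (s : Finset ι) (a : ι → ℂ) (ha : ∀ i ∈ s, a i ∈ V) :
    ∃ (I : ℂ[X]) (h : ℂ → ℂ), DifferentiableOn ℂ h V ∧
      ∀ z ∈ V, f z = I.eval z + h z * (∏ i ∈ s, (X - C (a i))).eval z := by
  classical
  induction s using Finset.induction_on with
  | empty => exact ⟨0, f, hf, fun z _ => by simp⟩
  | insert i s hi ih =>
    obtain ⟨I, h, hh, hI⟩ := ih fun j hj => ha j (Finset.mem_insert_of_mem hj)
    refine ⟨I + C (h (a i)) * ∏ j ∈ s, (X - C (a j)), dslope h (a i),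
      (Complex.differentiableOn_dslope (hV.mem_nhds (ha i (Finset.mem_insert_self i s)))).2 hh,
      fun z hz => ?_⟩
    have h1 := sub_smul_dslope h (a i) z
    rw [smul_eq_mul] at h1
    rw [Finset.prod_insert hi, hI z hz]
    simp only [eval_add, eval_mul, eval_C, eval_sub, eval_X]
    linear_combination -(∏ j ∈ s, (X - C (a j))).eval z * h1

theorem prod_dvd_of_eval_eq_mul {ι : Type*} {V : Set ℂ} (hV : IsOpen V) {k : ℂ → ℂ}
    (hk : ContinuousOn k V) (s : Finset ι) (a : ι → ℂ) (ha : ∀ i ∈ s, a i ∈ V) (D : ℂ[X])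
    (h : ∀ z ∈ V, D.eval z = k z * (∏ i ∈ s, (X - C (a i))).eval z) :
    (∏ i ∈ s, (X - C (a i))) ∣ D := by
  classical
  induction s using Finset.induction_on generalizing D with
  | empty => simp
  | insert i s hi ih =>
    rw [Finset.prod_insert hi] at h ⊢
    have hiV := ha i (Finset.mem_insert_self i s)
    obtain ⟨D₁, rfl⟩ : X - C (a i) ∣ D := by
      rw [dvd_iff_isRoot, IsRoot.def, h _ hiV]; simp
    refine mul_dvd_mul_left _ (ih (fun j hj => ha j (Finset.mem_insert_of_mem hj)) D₁ ?_)
    have hne : ∀ z ∈ V, z ≠ a i → D₁.eval z = k z * (∏ j ∈ s, (X - C (a j))).eval z := by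
      intro z hz hza
      have h1 := h z hz
      simp only [eval_mul, eval_sub, eval_X, eval_C] at h1
      refine mul_left_cancel₀ (sub_ne_zero.2 hza) ?_
      linear_combination h1
    intro z hz
    by_cases hza : z = a i
    · subst hza
      have hc : ContinuousAt (fun z => k z * (∏ j ∈ s, (X - C (a j))).eval z) (a i) :=
        (hk.continuousAt (hV.mem_nhds hiV)).mul (Polynomial.continuous _).continuousAt
      refine ((ContinuousAt.eventuallyEq_nhds_iff_eventuallyEq_nhdsNE D₁.continuous.continuousAt
        hc).1 ?_).eq_of_nhds
      filter_upwards [nhdsWithin_le_nhds (hV.mem_nhds hiV), self_mem_nhdsWithin] with x hx hxa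
      exact hne x hx hxa
    · exact hne z hz hza

variable {S V : Set ℂ} {f : ℂ → ℂ} {α : (n : ℕ) → Fin n → ℂ} {m n : ℕ}

/-- Existence of Padé pairs: the `m` conditions that the remainder of `Q I` modulo `w_{n+1}`, `I`
interpolating `f`, have degree at most `n - m` are linear in the `m + 1` coefficients of `Q`. -/
theorem exists_isPadePair (hV : IsOpen V) (hf : DifferentiableOn ℂ f V)
    (hα : ∀ n i, α n i ∈ V) (hmn : m ≤ n) :
    ∃ P Q : ℂ[X], IsPadePair f V α n m P Q := by
  obtain ⟨I, h, hh, hI⟩ := exists_interpolation hV hf Finset.univ (α (n + 1)) fun i _ => hα _ i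
  set w := nodePoly α (n + 1) with hw
  have hwm : w.Monic := nodePoly_monic α (n + 1)
  let L : degreeLT ℂ (m + 1) →ₗ[ℂ] (Fin m → ℂ) := LinearMap.pi fun j =>
    (lcoeff ℂ (n - m + 1 + j)).comp ((modByMonicHom w).comp
      ((LinearMap.mulRight ℂ I).comp (degreeLT ℂ (m + 1)).subtype))
  have hfr : Module.finrank ℂ (degreeLT ℂ (m + 1)) = m + 1 := by
    rw [(degreeLTEquiv ℂ (m + 1)).finrank_eq]; simp
  have : FiniteDimensional ℂ (degreeLT ℂ (m + 1)) :=
    Module.Finite.equiv (degreeLTEquiv ℂ (m + 1)).symm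
  obtain ⟨Q, hQ, hQ0⟩ := (Submodule.ne_bot_iff _).1
    (L.ker_ne_bot_of_finrank_lt (by rw [hfr]; simp))
  have hQL : ∀ j : Fin m, ((Q : ℂ[X]) * I %ₘ w).coeff (n - m + 1 + j) = 0 := fun j =>
    congrFun (LinearMap.mem_ker.1 hQ) j
  refine ⟨(Q : ℂ[X]) * I %ₘ w, Q, ?_, ?_, by simpa using hQ0, ?_⟩
  · rw [natDegree_le_iff_coeff_eq_zero]
    intro k hk
    rcases le_or_gt k n with hkn | hkn
    · have := hQL ⟨k - (n - m + 1), by omega⟩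
      simp only at this
      rwa [show n - m + 1 + (k - (n - m + 1)) = k by omega] at this
    · refine coeff_eq_zero_of_degree_lt ((degree_modByMonic_lt _ hwm).trans_le ?_)
      rw [degree_eq_natDegree hwm.ne_zero, hw, nodePoly_natDegree]
      exact_mod_cast hkn
  · have := mem_degreeLT.1 Q.2
    exact Nat.lt_succ_iff.1 ((natDegree_lt_iff_degree_lt (by simpa using hQ0)).2 this)
  · refine ⟨fun z => (Q : ℂ[X]).eval z * h z + ((Q : ℂ[X]) * I /ₘ w).eval z,
      (Polynomial.differentiable _).differentiableOn.mul hh |>.add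
        (Polynomial.differentiable _).differentiableOn, fun z hz => ?_⟩
    have h1 := congrArg (eval z) (modByMonic_add_div ((Q : ℂ[X]) * I) w)
    rw [eval_add, eval_mul, eval_mul] at h1
    have h2 : f z = I.eval z + h z * w.eval z := hI z hz
    rw [h2]
    linear_combination -h1

theorem IsPadePair.C_mul {P Q : ℂ[X]} (h : IsPadePair f V α n m P Q) {c : ℂ} (hc : c ≠ 0) :
    IsPadePair f V α n m (C c * P) (C c * Q) := by
  obtain ⟨h1, h2, h3, k, hk, h4⟩ := h
  refine ⟨(natDegree_C_mul_le _ _).trans h1, (natDegree_C_mul_le _ _).trans h2,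
    mul_ne_zero (C_ne_zero.2 hc) h3, fun z => c * k z, hk.const_mul c, fun z hz => ?_⟩
  simp only [eval_mul, eval_C]
  linear_combination c * h4 z hz

theorem exists_isNormalizedDenominator_C_mul {Q : ℂ[X]} (hQ : Q ≠ 0) :
    ∃ c : ℂ, c ≠ 0 ∧ IsNormalizedDenominator (C c * Q) := by
  have hprod : ∀ s : Multiset ℂ, ∃ c : ℂ, c ≠ 0 ∧
      (s.map fun ζ => if ‖ζ‖ ≤ 1 then X - C ζ else 1 - C ζ⁻¹ * X).prod
        = C c * (s.map fun ζ => X - C ζ).prod := by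
    intro s
    induction s using Multiset.induction_on with
    | empty => exact ⟨1, one_ne_zero, by simp⟩
    | cons ζ s ih =>
      obtain ⟨c, hc, hs⟩ := ih
      simp only [Multiset.map_cons, Multiset.prod_cons, hs]
      by_cases hζ : ‖ζ‖ ≤ 1
      · exact ⟨c, hc, by rw [if_pos hζ]; ring⟩
      · have hζ0 : ζ ≠ 0 := fun h => hζ (by simp [h])
        refine ⟨-ζ⁻¹ * c, by simp [hc, hζ0], ?_⟩
        have h1 : (C ζ⁻¹ * C ζ : ℂ[X]) = 1 := by rw [← C_mul, inv_mul_cancel₀ hζ0, C_1]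
        rw [if_neg hζ, C_mul, C_neg]
        linear_combination -C c * (s.map fun ζ => X - C ζ).prod * h1
  obtain ⟨c, hc, h⟩ := hprod Q.roots
  have h1 := (IsAlgClosed.splits Q).eq_prod_roots
  have hl : Q.leadingCoeff ≠ 0 := leadingCoeff_ne_zero.2 hQ
  refine ⟨c * Q.leadingCoeff⁻¹, mul_ne_zero hc (inv_ne_zero hl), ?_⟩
  rw [IsNormalizedDenominator, roots_C_mul _ (mul_ne_zero hc (inv_ne_zero hl)), h]
  calc C (c * Q.leadingCoeff⁻¹) * Q
      = C (c * Q.leadingCoeff⁻¹) *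
          (C Q.leadingCoeff * (Q.roots.map fun ζ => X - C ζ).prod) := congrArg _ h1
    _ = _ := by rw [← mul_assoc, ← C_mul, inv_mul_cancel_right₀ hl]

/-- The normalization makes the Mahler measure of the denominator equal to `1`. -/
theorem IsNormalizedDenominator.mahlerMeasure_eq_one {Q : ℂ[X]} (h : IsNormalizedDenominator Q) :
    Q.mahlerMeasure = 1 := by
  rw [h, prod_mahlerMeasure_eq_mahlerMeasure_prod, Multiset.map_map]
  refine Multiset.prod_eq_one fun x hx => ?_
  obtain ⟨ζ, -, rfl⟩ := Multiset.mem_map.1 hx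
  by_cases hζ : ‖ζ‖ ≤ 1
  · simp [hζ, mahlerMeasure_X_sub_C]
  · have hζ0 : ζ ≠ 0 := fun h => hζ (by simp [h])
    have h1 : (1 - C ζ⁻¹ * X : ℂ[X]) = C (-ζ⁻¹) * X + C 1 := by rw [C_neg, C_1]; ring
    simp only [Function.comp, hζ, if_false]
    rw [h1, mahlerMeasure_C_mul_X_add_C (by simp [hζ0])]
    rw [norm_one, norm_neg, norm_inv, max_eq_right]
    exact inv_le_one_of_one_le₀ (not_le.1 hζ).le

theorem IsNormalizedDenominator.norm_eval_le {Q : ℂ[X]} (h : IsNormalizedDenominator Q)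
    (hm : Q.natDegree ≤ m) {R : ℝ} {z : ℂ} (hz : ‖z‖ ≤ R) : ‖Q.eval z‖ ≤ (1 + R) ^ m := by
  have hR : 0 ≤ R := (norm_nonneg z).trans hz
  have hs : ∀ s : Multiset ℂ,
      ‖(s.map fun ζ => if ‖ζ‖ ≤ 1 then X - C ζ else 1 - C ζ⁻¹ * X).prod.eval z‖
        ≤ (1 + R) ^ s.card := by
    intro s
    induction s using Multiset.induction_on with
    | empty => simp
    | cons ζ s ih =>
      rw [Multiset.map_cons, Multiset.prod_cons, eval_mul, norm_mul, Multiset.card_cons, pow_succ']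
      refine mul_le_mul ?_ ih (norm_nonneg _) (by positivity)
      split_ifs with hζ
      · simp only [eval_sub, eval_X, eval_C]
        exact (norm_sub_le _ _).trans (by linarith)
      · simp only [eval_sub, eval_one, eval_mul, eval_C, eval_X]
        refine (norm_sub_le _ _).trans ?_
        rw [norm_one, norm_mul, norm_inv]
        have : ‖ζ‖⁻¹ ≤ 1 := inv_le_one_of_one_le₀ (not_le.1 hζ).le
        nlinarith [norm_nonneg z]
  rw [h]
  refine (hs _).trans (pow_le_pow_right₀ (by linarith) ?_)
  exact (card_roots' Q).trans hm

theorem IsNormalizedDenominator.norm_coeff_le_one {Q : ℂ[X]} (h : IsNormalizedDenominator Q)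
    (hm : Q.natDegree ≤ m) : ‖Q.coeff m‖ ≤ 1 := by
  refine (norm_coeff_le_choose_mul_mahlerMeasure m Q).trans ?_
  rw [h.mahlerMeasure_eq_one, mul_one]
  rcases hm.eq_or_lt with h1 | h1
  · rw [h1]; simp
  · rw [Nat.choose_eq_zero_of_lt h1]; simp

/-- The difference of consecutive approximants, and the product formula for its coefficient. -/
theorem IsPadePair.mul_sub_mul_eq (hV : IsOpen V) (hα : ∀ n i, α n i ∈ V)
    (hnewton : IsNewtonianTable α) (hmn : m ≤ n) {P Q P' Q' : ℂ[X]}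
    (h : IsPadePair f V α n m P Q) (h' : IsPadePair f V α (n + 1) m P' Q') :
    P' * Q - P * Q' = C (P'.coeff (n + 1 - m) * Q.coeff m) * nodePoly α (n + 1) := by
  obtain ⟨hP, hQ, -, k, hk, e⟩ := h
  obtain ⟨hP', hQ', -, k', hk', e'⟩ := h'
  obtain ⟨q, hq⟩ := hnewton (n + 1)
  have hdvd : nodePoly α (n + 1) ∣ P' * Q - P * Q' := by
    refine prod_dvd_of_eval_eq_mul hV (k := fun z => k z * Q'.eval z - k' z * q.eval z * Q.eval z)
      ?_ Finset.univ (α (n + 1)) (fun i _ => hα _ i) _ fun z hz => ?_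
    · exact (hk.continuousOn.mul Q'.continuous.continuousOn).sub
        ((hk'.continuousOn.mul q.continuous.continuousOn).mul Q.continuous.continuousOn)
    · have e1 := e z hz
      have e2 := e' z hz
      rw [hq, eval_mul] at e2
      simp only [eval_sub, eval_mul]
      change _ = _ * (nodePoly α (n + 1)).eval z
      linear_combination Q'.eval z * e1 - Q.eval z * e2
  obtain ⟨c, hc⟩ := hdvd
  have hw := nodePoly_monic α (n + 1)
  have hdeg : (P' * Q - P * Q').natDegree ≤ n + 1 := by
    refine (natDegree_sub_le _ _).trans (max_le ?_ ?_)
    · exact natDegree_mul_le.trans (by omega)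
    · exact natDegree_mul_le.trans (by omega)
  have hc0 : c.natDegree = 0 := by
    rcases eq_or_ne c 0 with h0 | h0
    · simp [h0]
    · rw [hc, hw.natDegree_mul' h0, nodePoly_natDegree] at hdeg
      omega
  rw [eq_C_of_natDegree_eq_zero hc0] at hc
  have hcoef : (P' * Q - P * Q').coeff (n + 1) = P'.coeff (n + 1 - m) * Q.coeff m := by
    have h1 : (P' * Q).coeff (n + 1) = P'.coeff (n + 1 - m) * Q.coeff m := by
      have := coeff_mul_add_eq_of_natDegree_le hP' hQ
      rwa [show n + 1 - m + m = n + 1 by omega] at this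
    have h2 : (P * Q').coeff (n + 1) = 0 :=
      coeff_eq_zero_of_natDegree_lt (natDegree_mul_le.trans_lt (by omega))
    rw [coeff_sub, h1, h2, sub_zero]
  have h3 : (nodePoly α (n + 1)).coeff (n + 1) = 1 := by
    have := hw.coeff_natDegree; rwa [nodePoly_natDegree] at this
  rw [hc, coeff_mul_C, h3, one_mul] at hcoef
  rw [hc, hcoef, mul_comm]

end Pade

/-! ### Clearing of poles -/

section Clearing

/-- Multiplication by a monic polynomial of degree `m` removes at most `m` poles. -/
theorem IsMeromorphicWithAtMost.exists_clearing {F : ℂ → ℂ} {U : Set ℂ} {m : ℕ}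
    (hF : IsMeromorphicWithAtMost F U m) :
    ∃ (s : ℂ[X]) (φ : ℂ → ℂ), s.Monic ∧ s.natDegree = m ∧ DifferentiableOn ℂ φ U ∧
      ∀ z ∈ U, φ =ᶠ[𝓝[≠] z] fun x => s.eval x * F x := by
  classical
  obtain ⟨hmer, hcount⟩ := hF
  -- the order of the pole at `z`, equal to `0` where `F` has none
  set p : ℂ → ℕ := fun z => (-(meromorphicOrderAt F z).untop₀).toNat with hp
  have hsum : ∀ T : Finset ℂ, (T : Set ℂ) ⊆ U → ∑ z ∈ T, p z ≤ m := by
    intro T hT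
    have h1 := hcount T hT
    have h2 : ((∑ z ∈ T, p z : ℕ) : ℤ) = ∑ z ∈ T, max 0 (-(meromorphicOrderAt F z).untop₀) := by
      rw [Nat.cast_sum]
      refine Finset.sum_congr rfl fun z _ => ?_
      rw [hp, Int.toNat_eq_max, max_comm]
    exact_mod_cast h2.trans_le h1
  have hfin : {z ∈ U | p z ≠ 0}.Finite := by
    by_contra hinf
    obtain ⟨T, hT, hcard⟩ := Set.Infinite.exists_subset_card_eq hinf (m + 1)
    have h1 : T.card • 1 ≤ ∑ z ∈ T, p z :=
      Finset.card_nsmul_le_sum _ _ _ fun z hz => Nat.one_le_iff_ne_zero.2 (hT hz).2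
    have h2 := hsum T fun z hz => (hT hz).1
    rw [hcard] at h1
    simp at h1
    omega
  set T := hfin.toFinset with hT
  have hTU : (T : Set ℂ) ⊆ U := fun z hz => by
    have : z ∈ {z ∈ U | p z ≠ 0} := by simpa [hT] using hz
    exact this.1
  set s : ℂ[X] := (∏ z ∈ T, (X - C z) ^ p z) * X ^ (m - ∑ z ∈ T, p z) with hs
  have hm1 : (∏ z ∈ T, (X - C z) ^ p z).Monic :=
    monic_prod_of_monic _ _ fun z _ => (monic_X_sub_C z).pow _
  have hdvd : ∀ z ∈ U, (X - C z) ^ p z ∣ s := by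
    intro z hz
    by_cases hpz : p z = 0
    · rw [hpz, pow_zero]; exact one_dvd _
    · refine Dvd.dvd.mul_right (Finset.dvd_prod_of_mem (fun z => (X - C z) ^ p z) ?_) _
      simpa [hT] using ⟨hz, hpz⟩
  have hsmer : MeromorphicOn (fun x => s.eval x) U := fun z _ =>
    (s.differentiable.analyticAt z).meromorphicAt
  have hprod : MeromorphicOn (fun x => s.eval x * F x) U := hsmer.fun_mul hmer
  refine ⟨s, toMeromorphicNFOn (fun x => s.eval x * F x) U, hm1.mul (monic_X_pow _), ?_, ?_, ?_⟩
  · rw [hs, hm1.natDegree_mul (monic_X_pow _), natDegree_X_pow,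
      natDegree_prod_of_monic _ _ fun z _ => (monic_X_sub_C z).pow _]
    have h1 : ∑ z ∈ T, ((X - C z) ^ p z).natDegree = ∑ z ∈ T, p z :=
      Finset.sum_congr rfl fun z _ => by rw [natDegree_pow, natDegree_X_sub_C, mul_one]
    rw [h1, Nat.add_sub_cancel' (hsum T hTU)]
  · intro z hz
    refine AnalyticAt.differentiableWithinAt ?_
    refine ((meromorphicNFOn_toMeromorphicNFOn _ _
      hz).meromorphicOrderAt_nonneg_iff_analyticAt).1 ?_
    rw [meromorphicOrderAt_toMeromorphicNFOn hprod hz]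
    obtain ⟨q, hq⟩ := hdvd z hz
    have hqa : MeromorphicAt (fun x => q.eval x) z := (q.differentiable.analyticAt z).meromorphicAt
    have hpa : MeromorphicAt (fun x => (x - z) ^ p z) z := by fun_prop
    have h1 : (fun x => s.eval x * F x) = (fun x => (x - z) ^ p z) * ((fun x => q.eval x) * F) := by
      funext x
      simp only [hq, eval_mul, eval_pow, eval_sub, eval_X, eval_C, Pi.mul_apply, mul_assoc]
    rw [h1, meromorphicOrderAt_mul hpa (hqa.mul (hmer z hz)), meromorphicOrderAt_mul hqa (hmer z hz)]
    have h2 : meromorphicOrderAt (fun x : ℂ => (x - z) ^ p z) z = p z :=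
      fun_meromorphicOrderAt_pow_id_sub_const
    have h3 : 0 ≤ meromorphicOrderAt (fun x => q.eval x) z :=
      (q.differentiable.analyticAt z).meromorphicOrderAt_nonneg
    have h4 : (0 : WithTop ℤ) ≤ (p z : WithTop ℤ) + meromorphicOrderAt F z := by
      cases hF : meromorphicOrderAt F z with
      | top => simp
      | coe k =>
        have : p z = (-k).toNat := by simp [hp, hF]
        have h5 : (0 : ℤ) ≤ p z + k := by omega
        exact_mod_cast h5
    rw [h2, add_left_comm]
    exact add_nonneg h3 h4
  · intro z hz
    exact hprod.toMeromorphicNFOn_eq_self_on_nhdsNE hz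

end Clearing

/-! ### Decay of the coefficients from a continuation -/

section DirectInequality

variable {S : Set ℂ} {μ : Measure ℂ} [IsProbabilityMeasure μ] {α : (n : ℕ) → Fin n → ℂ}

/-- If `f` continues to `E_μ(r)` with at most `m` poles, the leading coefficients of the numerators
of its Padé approximants are `O(ρ⁻ⁿ)` for every `ρ < r`. -/
theorem exists_norm_coeff_numerator_le (hS : IsCompact S) (hμ : μ Sᶜ = 0)
    (hα : ∀ n i, α n i ∈ S) (hdist : HasAsymptoticZeroDistribution α μ) {V : Set ℂ}
    (hV : IsOpen V) (hSV : S ⊆ V) {f : ℂ → ℂ} (hf : DifferentiableOn ℂ f V) {m : ℕ} {ρ r : ℝ}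
    (hρ : 0 < ρ) (hρr : ρ < r)
    (h : HasMeromorphicContinuation f S (potentialSublevel μ (ENNReal.ofReal r)) m) :
    ∃ A : ℝ, 0 ≤ A ∧ ∀ᶠ n in atTop, ∀ P Q : ℂ[X], IsPadePair f V α n m P Q →
      IsNormalizedDenominator Q → ‖P.coeff (n - m)‖ ≤ A / ρ ^ n := by
  obtain ⟨F, hF, hFf⟩ := h
  have hr : 0 < r := hρ.trans hρr
  obtain ⟨r', hr', hr'r⟩ := exists_between hρr
  have hr'0 : 0 < r' := hρ.trans hr'
  obtain ⟨s, φ, hs, hsm, hφ, hφs⟩ := hF.exists_clearing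
  have hsd : Differentiable ℂ fun x => s.eval x := s.differentiable
  -- `φ` is known to equal `s F` only off a discrete set; continuity fills in the centre of the disc
  have hφf : ∀ z ∈ S ∩ potentialSublevel μ (ENNReal.ofReal r),
      φ =ᶠ[𝓝 z] fun x => s.eval x * f x := by
    intro z hz
    have hc1 : ContinuousAt φ z :=
      hφ.continuousOn.continuousAt ((isOpen_potentialSublevel hS hμ hr).mem_nhds hz.2)
    have hc2 : ContinuousAt (fun x => s.eval x * f x) z :=
      s.continuous.continuousAt.mul (hf.continuousOn.continuousAt (hV.mem_nhds (hSV hz.1)))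
    refine (hc1.eventuallyEq_nhds_iff_eventuallyEq_nhdsNE hc2).1 ?_
    filter_upwards [hφs z hz.2, nhdsWithin_le_nhds (hFf z hz)] with x hx hx'
    rw [hx, hx']
  obtain ⟨O, G, hO, hSO, hEO, hG, hGf⟩ := exists_glued_continuation hS hμ hα hdist hV hSV hr'0 hr'r
    hφ (hsd.differentiableOn.mul hf) hφf
  have hK : IsCompact (S ∪ closure (potentialSublevel μ (ENNReal.ofReal r'))) :=
    hS.union (isBounded_potentialSublevel hS hμ hr'0).isCompact_closure
  obtain ⟨Z, A, hZ, hZO, hA, hmain⟩ :=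
    exists_norm_coeff_le hK hO (Set.union_subset hSO hEO) hG
  obtain ⟨R, hR⟩ := hZ.exists_bound_of_continuousOn (f := fun z => z) continuousOn_id
  have hlow : ∀ᶠ n in atTop, ∀ z ∈ Z, ρ ^ n ≤ ‖(nodePoly α n).eval z‖ := by
    refine hZ.induction_on (p := fun s => ∀ᶠ n in atTop, ∀ z ∈ s,
      ρ ^ n ≤ ‖(nodePoly α n).eval z‖) (by simp) (fun s t hst ht => ht.mono fun n hn z hz =>
        hn z (hst hz)) (fun s t hs ht => ?_) fun z hz => ?_
    · filter_upwards [hs, ht] with n h1 h2 z hz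
      exact hz.elim (h1 z) (h2 z)
    · have hzK := (hZO hz).2
      obtain ⟨δ, hδ, hn⟩ := exists_forall_le_norm_nodePoly hS hμ hα hdist hρ hr'
        (fun h => hzK (Or.inl h)) (fun h => hzK (Or.inr (subset_closure h)))
      exact ⟨Metric.ball z δ, mem_nhdsWithin_of_mem_nhds (Metric.ball_mem_nhds z hδ), hn⟩
  -- `s P` interpolates `Q G` at the zeros of `w_{n+1}`; as `s` is monic of degree `m`, its
  -- coefficient of order `n` is that of `P` of order `n - m`
  refine ⟨A * ((1 + max R 0) ^ m / ρ), by positivity, ?_⟩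
  filter_upwards [(tendsto_add_atTop_nat 1).eventually hlow, eventually_ge_atTop m]
    with n hn hmn P Q hPQ hQ
  obtain ⟨hP, hQm, -, k, hk, e⟩ := hPQ
  have h1 := hmain (nodePoly α (n + 1)) Q (s * P) (fun z => s.eval z * k z) n (ρ ^ (n + 1))
    ((1 + max R 0) ^ m) (nodePoly_monic _ _) (nodePoly_natDegree _ _)
    (natDegree_mul_le.trans (by omega)) (by positivity) (by positivity) ?_ hn
    (fun z hz => hQ.norm_eval_le hQm ((hR z hz).trans (le_max_left _ _)))
  · have h2 : (s * P).coeff n = P.coeff (n - m) := by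
      have h3 := coeff_mul_add_eq_of_natDegree_le hsm.le hP
      have h4 : s.coeff m = 1 := hsm ▸ hs.coeff_natDegree
      rwa [Nat.add_sub_cancel' hmn, h4, one_mul] at h3
    rw [h2] at h1
    refine h1.trans_eq ?_
    rw [pow_succ]
    field_simp
  · intro z hz
    have hzS := mem_of_nodePoly_eval_eq_zero hα hz
    refine ⟨Or.inl hzS, ?_⟩
    filter_upwards [hGf z hzS, hV.mem_nhds (hSV hzS)] with x hx hxV
    refine ⟨hsd.differentiableAt.mul (hk.differentiableAt (hV.mem_nhds hxV)), ?_⟩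
    rw [hx, eval_mul, Pi.mul_apply]
    linear_combination s.eval x * e x hxV

theorem eventually_le_inv_pow_of_le_div_pow {a : ℕ → ℝ} {C ρ ρ' : ℝ} (hρ : 0 < ρ)
    (hρρ' : ρ < ρ') (h : ∀ᶠ n in atTop, a n ≤ C / ρ' ^ n) :
    ∀ᶠ n in atTop, a n ≤ (ρ ^ n)⁻¹ := by
  have hρ' := hρ.trans hρρ'
  filter_upwards [h, (tendsto_pow_atTop_atTop_of_one_lt ((one_lt_div hρ).2 hρρ')).eventually
    (eventually_ge_atTop C)] with n hn hC
  refine hn.trans ?_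
  rw [div_pow] at hC
  calc C / ρ' ^ n ≤ (ρ' ^ n / ρ ^ n) / ρ' ^ n := by gcongr
    _ = _ := by field_simp

/-- The direct half of the radius formula. -/
theorem eventually_norm_coeff_mul_coeff_le (hS : IsCompact S) (hμ : μ Sᶜ = 0)
    (hα : ∀ n i, α n i ∈ S) (hdist : HasAsymptoticZeroDistribution α μ) {V : Set ℂ}
    (hV : IsOpen V) (hSV : S ⊆ V) {f : ℂ → ℂ} (hf : DifferentiableOn ℂ f V) {m : ℕ} {ρ r : ℝ}
    (hρ : 0 < ρ) (hρr : ρ < r)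
    (h : HasMeromorphicContinuation f S (potentialSublevel μ (ENNReal.ofReal r)) m)
    {P Q : ℕ → ℂ[X]} (hPQ : ∀ n, m ≤ n → IsPadePair f V α n m (P n) (Q n) ∧
      IsNormalizedDenominator (Q n)) :
    ∀ᶠ n in atTop, ‖(P (n + 1)).coeff (n + 1 - m) * (Q n).coeff m‖ ≤ (ρ ^ n)⁻¹ := by
  obtain ⟨σ, hρσ, hσr⟩ := exists_between hρr
  have hσ : 0 < σ := hρ.trans hρσ
  obtain ⟨A, hA, hn⟩ := exists_norm_coeff_numerator_le hS hμ hα hdist hV hSV hf hσ hσr h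
  refine eventually_le_inv_pow_of_le_div_pow (C := A / σ) hρ hρσ ?_
  filter_upwards [(tendsto_add_atTop_nat 1).eventually hn, eventually_ge_atTop m] with n hn hmn
  have h1 := hn _ _ (hPQ (n + 1) (by omega)).1 (hPQ (n + 1) (by omega)).2
  have h2 := (hPQ n hmn).2.norm_coeff_le_one (hPQ n hmn).1.2.1
  rw [norm_mul]
  calc _ ≤ A / σ ^ (n + 1) * 1 := mul_le_mul h1 h2 (norm_nonneg _) (by positivity)
    _ = _ := by rw [pow_succ]; field_simp

end DirectInequality

/-! ### Limits and lower bounds of normalized denominators -/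

section Denominators

variable {m : ℕ}

/-- A normalized polynomial is bounded from below away from its zeros. -/
theorem IsNormalizedDenominator.le_norm_eval {Q : ℂ[X]} (h : IsNormalizedDenominator Q)
    (hm : Q.natDegree ≤ m) {R ε : ℝ} {z : ℂ} (hz : ‖z‖ ≤ R) (hR : 1 ≤ R) (hε : 0 < ε)
    (hε1 : ε ≤ 1) (hroots : ∀ ζ ∈ Q.roots, ε ≤ ‖z - ζ‖) :
    (ε / (2 * R)) ^ m ≤ ‖Q.eval z‖ := by
  have h1 : ε / (2 * R) ≤ 1 := (div_le_one (by positivity)).2 (by linarith)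
  have hs : ∀ s : Multiset ℂ, (∀ ζ ∈ s, ε ≤ ‖z - ζ‖) → (ε / (2 * R)) ^ s.card ≤
      ‖(s.map fun ζ => if ‖ζ‖ ≤ 1 then X - C ζ else 1 - C ζ⁻¹ * X).prod.eval z‖ := by
    intro s
    induction s using Multiset.induction_on with
    | empty => simp
    | cons ζ s ih =>
      intro hζs
      have hεζ := hζs ζ (Multiset.mem_cons_self ζ s)
      rw [Multiset.map_cons, Multiset.prod_cons, eval_mul, norm_mul, Multiset.card_cons, pow_succ']
      refine mul_le_mul ?_ (ih fun ζ' h => hζs ζ' (Multiset.mem_cons_of_mem h)) (by positivity)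
        (norm_nonneg _)
      split_ifs with hζ
      · simp only [eval_sub, eval_X, eval_C]
        refine (div_le_self hε.le (by linarith)).trans hεζ
      · have hζ1 := not_le.1 hζ
        have hζ0 : ζ ≠ 0 := fun h => hζ (by simp [h])
        have h2 : (1 - C ζ⁻¹ * X : ℂ[X]).eval z = (ζ - z) / ζ := by
          simp only [eval_sub, eval_one, eval_mul, eval_C, eval_X]
          field_simp
        rw [h2, norm_div, norm_sub_rev]
        have hζp : 0 < ‖ζ‖ := by linarith
        rw [div_le_div_iff₀ (by positivity) hζp]
        -- distant zeros contribute factors that are at least `1 / 2`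
        rcases le_total ‖ζ‖ (2 * R) with h3 | h3
        · exact mul_le_mul hεζ h3 hζp.le (norm_nonneg _)
        · have h4 : ‖ζ‖ ≤ ‖z - ζ‖ + ‖z‖ := by
            have := norm_sub_le z (z - ζ)
            rw [sub_sub_cancel] at this
            linarith
          nlinarith [norm_nonneg (z - ζ)]
  conv_rhs => rw [h]
  refine (pow_le_pow_of_le_one (by positivity) h1 ((card_roots' Q).trans hm)).trans (hs _ hroots)

/-- Normalized denominators of bounded degree have a subsequence converging to a nonzero
polynomial: the Mahler measure bounds the coefficients, and their sum from below. -/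
theorem exists_subseq_tendsto_coeff {Q : ℕ → ℂ[X]}
    (hQ : ∀ n, m ≤ n → IsNormalizedDenominator (Q n) ∧ (Q n).natDegree ≤ m) :
    ∃ (φ : ℕ → ℕ) (q : ℂ[X]), StrictMono φ ∧ (∀ j, m ≤ φ j) ∧ q ≠ 0 ∧ q.natDegree ≤ m ∧
      ∀ i, Tendsto (fun j => (Q (φ j)).coeff i) atTop (𝓝 (q.coeff i)) := by
  set x : ℕ → Fin (m + 1) → ℂ := fun n i => (Q (n + m)).coeff i with hx
  have hxb : ∀ n, x n ∈ Metric.closedBall (0 : Fin (m + 1) → ℂ) (2 ^ m) := by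
    intro n
    obtain ⟨h1, h2⟩ := hQ (n + m) (by omega)
    rw [mem_closedBall_zero_iff, pi_norm_le_iff_of_nonneg (by positivity)]
    intro i
    have h3 := norm_coeff_le_choose_mul_mahlerMeasure (i : ℕ) (Q (n + m))
    rw [h1.mahlerMeasure_eq_one, mul_one] at h3
    refine h3.trans ?_
    have h4 : (Q (n + m)).natDegree.choose i ≤ 2 ^ m :=
      (Nat.choose_le_two_pow _ _).trans (Nat.pow_le_pow_right (by norm_num) h2)
    exact_mod_cast h4
  obtain ⟨a, -, ψ, hψ, hlim⟩ := tendsto_subseq_of_bounded Metric.isBounded_closedBall hxb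
  have hcoef : ∀ i : Fin (m + 1), Tendsto (fun j => (Q (ψ j + m)).coeff i) atTop (𝓝 (a i)) :=
    fun i => (tendsto_pi_nhds.1 hlim) i
  set q : ℂ[X] := ∑ i : Fin (m + 1), C (a i) * X ^ (i : ℕ) with hq
  have hqc : ∀ i : ℕ, q.coeff i = if h : i < m + 1 then a ⟨i, h⟩ else 0 := by
    intro i
    rw [hq, finsetSum_coeff]
    simp only [coeff_C_mul, coeff_X_pow]
    split_ifs with h
    · rw [Finset.sum_eq_single ⟨i, h⟩]
      · simp
      · intro b _ hb
        rw [if_neg, mul_zero]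
        exact fun h' => hb (Fin.ext h'.symm)
      · simp
    · refine Finset.sum_eq_zero fun b _ => ?_
      rw [if_neg, mul_zero]
      have := b.2
      omega
  have hall : ∀ i, Tendsto (fun j => (Q (ψ j + m)).coeff i) atTop (𝓝 (q.coeff i)) := by
    intro i
    rw [hqc]
    split_ifs with h
    · exact hcoef ⟨i, h⟩
    · refine tendsto_const_nhds.congr fun j => ?_
      rw [coeff_eq_zero_of_natDegree_lt]
      exact (hQ (ψ j + m) (by omega)).2.trans_lt (by omega)
  refine ⟨fun j => ψ j + m, q, fun i j h => Nat.add_lt_add_right (hψ h) m, fun j => Nat.le_add_left m _, ?_, ?_,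
    hall⟩
  · intro hq0
    have h1 : Tendsto (fun j => ∑ i ∈ Finset.range (m + 1), ‖(Q (ψ j + m)).coeff i‖) atTop
        (𝓝 (∑ i ∈ Finset.range (m + 1), ‖q.coeff i‖)) :=
      tendsto_finsetSum _ fun i _ => (hall i).norm
    have h2 : (1 : ℝ) ≤ ∑ i ∈ Finset.range (m + 1), ‖q.coeff i‖ := by
      refine ge_of_tendsto' h1 fun j => ?_
      obtain ⟨h3, h4⟩ := hQ (ψ j + m) (by omega)
      rw [← h3.mahlerMeasure_eq_one]
      refine (mahlerMeasure_le_sum_norm_coeff _).trans_eq ?_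
      exact sum_over_range' _ (fun _ => norm_zero) _ (Nat.lt_succ_of_le h4)
    rw [hq0] at h2
    simp at h2
    linarith
  · rw [natDegree_le_iff_coeff_eq_zero]
    intro k hk
    rw [hqc, dif_neg (by omega)]

/-- Coefficientwise convergence in bounded degree is locally uniform convergence. -/
theorem tendstoUniformlyOn_eval_of_tendsto_coeff {p : ℕ → ℂ[X]} {q : ℂ[X]}
    (hp : ∀ j, (p j).natDegree ≤ m) (hq : q.natDegree ≤ m)
    (h : ∀ i, Tendsto (fun j => (p j).coeff i) atTop (𝓝 (q.coeff i))) {K : Set ℂ}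
    (hK : Bornology.IsBounded K) :
    TendstoUniformlyOn (fun j z => (p j).eval z) (fun z => q.eval z) atTop K := by
  obtain ⟨R, hR⟩ := hK.exists_norm_le
  have h1 : Tendsto (fun j => ∑ i ∈ Finset.range (m + 1),
      ‖q.coeff i - (p j).coeff i‖ * (max R 0) ^ i) atTop (𝓝 0) := by
    have : Tendsto (fun j => ∑ i ∈ Finset.range (m + 1),
        ‖q.coeff i - (p j).coeff i‖ * (max R 0) ^ i) atTop
        (𝓝 (∑ i ∈ Finset.range (m + 1), ‖q.coeff i - q.coeff i‖ * (max R 0) ^ i)) :=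
      tendsto_finsetSum _ fun i _ => ((tendsto_const_nhds.sub (h i)).norm.mul_const _)
    simpa using this
  rw [Metric.tendstoUniformlyOn_iff]
  intro ε hε
  filter_upwards [h1.eventually (gt_mem_nhds hε)] with j hj z hz
  rw [dist_eq_norm, eval_eq_sum_range' (Nat.lt_succ_of_le hq),
    eval_eq_sum_range' (Nat.lt_succ_of_le (hp j)), ← Finset.sum_sub_distrib]
  refine (norm_sum_le _ _).trans_lt (lt_of_le_of_lt (Finset.sum_le_sum fun i _ => ?_) hj)
  rw [← sub_mul, norm_mul, norm_pow]
  gcongr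
  exact (hR z hz).trans (le_max_left _ _)

/-- Almost every circle keeps, from some index on, a distance `(k + 1)⁻²` to the zeros of the
`k`-th polynomial, by the Borel–Cantelli lemma. -/
theorem exists_radius_forall_roots {Q : ℕ → ℂ[X]} (hQ : ∀ᶠ n in atTop, (Q n).natDegree ≤ m)
    (z₀ : ℂ) {a b : ℝ} (hab : a < b) :
    ∃ t ∈ Set.Ioo a b, ∀ᶠ k : ℕ in atTop, ∀ z, ‖z - z₀‖ = t → ∀ ζ ∈ (Q k).roots,
      1 / ((k : ℝ) + 1) ^ 2 ≤ ‖z - ζ‖ := by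
  obtain ⟨N, hN⟩ := eventually_atTop.1 hQ
  -- the radii spoilt by the `k`-th polynomial, the indices being shifted by `N`
  set B : ℕ → Set ℝ := fun k => ⋃ ζ ∈ (Q (k + N)).roots.toFinset,
    Metric.ball ‖ζ - z₀‖ (1 / ((k : ℝ) + 1) ^ 2) with hB
  have hBm : ∀ k, volume (B k) ≤ ENNReal.ofReal (m * (2 * (1 / ((k : ℝ) + 1) ^ 2))) := by
    intro k
    refine (measure_biUnion_finset_le _ _).trans ?_
    simp only [Real.volume_ball]
    rw [Finset.sum_const, nsmul_eq_mul,
      ENNReal.ofReal_mul (p := (m : ℝ)) (by positivity), ENNReal.ofReal_natCast]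
    gcongr
    exact (Multiset.toFinset_card_le _).trans ((card_roots' _).trans (hN _ (by omega)))
  have hsum : Summable fun k : ℕ => (m : ℝ) * (2 * (1 / ((k : ℝ) + 1) ^ 2)) := by
    refine Summable.mul_left _ (Summable.mul_left _ ?_)
    have := (summable_nat_add_iff 1).2 (Real.summable_one_div_nat_pow.2 (one_lt_two))
    simpa using this
  have hlim : volume (limsup B atTop) = 0 := by
    refine measure_limsup_atTop_eq_zero (ne_top_of_le_ne_top ?_ (ENNReal.tsum_le_tsum hBm))
    rw [← ENNReal.ofReal_tsum_of_nonneg (fun k => by positivity) hsum]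
    exact ENNReal.ofReal_ne_top
  obtain ⟨t, ht, htB⟩ : ∃ t ∈ Set.Ioo a b, t ∉ limsup B atTop := by
    by_contra! h
    have h1 : volume (Set.Ioo a b) ≤ volume (limsup B atTop) := measure_mono h
    rw [hlim, Real.volume_Ioo] at h1
    have := ENNReal.ofReal_eq_zero.1 (le_antisymm h1 bot_le)
    linarith
  refine ⟨t, ht, ?_⟩
  rw [mem_limsup_iff_frequently_mem, not_frequently] at htB
  have h2 := (tendsto_sub_atTop_nat N).eventually htB
  filter_upwards [h2, eventually_ge_atTop N] with k hk hkN z hz ζ hζ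
  have h3 : ¬ ‖t - ‖ζ - z₀‖‖ < 1 / (((k - N : ℕ) : ℝ) + 1) ^ 2 := fun h =>
    hk (Set.mem_biUnion (x := ζ) (by simpa [Nat.sub_add_cancel hkN] using hζ) (by
      rwa [Metric.mem_ball, dist_eq_norm]))
  rw [not_lt] at h3
  refine le_trans ?_ (h3.trans ?_)
  · have : ((k - N : ℕ) : ℝ) ≤ k := by exact_mod_cast Nat.sub_le _ _
    gcongr
  · rw [← hz, Real.norm_eq_abs]
    have := abs_norm_sub_norm_le (z - z₀) (ζ - z₀)
    rwa [sub_sub_sub_cancel_right] at this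

end Denominators

/-! ### Convergence of the numerators -/

section Numerators

variable {S : Set ℂ} {μ : Measure ℂ} [IsProbabilityMeasure μ] {α : (n : ℕ) → Fin n → ℂ} {m : ℕ}

theorem summable_geometric_mul_pow {q C : ℝ} (hq0 : 0 < q) (hq : q < 1) (d : ℕ) :
    Summable fun k : ℕ => C * (q ^ k * ((k : ℝ) + 2) ^ d) := by
  refine Summable.mul_left _ ?_
  have h1 := (summable_nat_add_iff 2).2
    (summable_pow_mul_geometric_of_norm_lt_one d (r := q) (by rwa [Real.norm_of_nonneg hq0.le]))
  refine (h1.mul_left (q ^ 2)⁻¹).congr fun k => ?_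
  push_cast
  rw [pow_add]
  field_simp

/-- The maximum principle for a sequence of polynomials on a disc. -/
theorem uniformCauchySeqOn_closedBall_of_sphere {p : ℕ → ℂ[X]} {z₀ : ℂ} {t : ℝ} (ht : 0 < t)
    (h : UniformCauchySeqOn (fun j z => (p j).eval z) atTop (Metric.sphere z₀ t)) :
    UniformCauchySeqOn (fun j z => (p j).eval z) atTop (Metric.closedBall z₀ t) := by
  rw [Metric.uniformCauchySeqOn_iff] at h ⊢
  intro ε hε
  obtain ⟨N, hN⟩ := h (ε / 2) (half_pos hε)
  refine ⟨N, fun i hi j hj z hz => ?_⟩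
  have h1 : ‖(p i - p j).eval z‖ ≤ ε / 2 := by
    refine Complex.norm_le_of_forall_mem_frontier_norm_le (U := Metric.ball z₀ t)
      Metric.isBounded_ball (p i - p j).differentiable.diffContOnCl (fun x hx => ?_)
      (by rwa [closure_ball z₀ ht.ne'])
    rw [frontier_ball z₀ ht.ne'] at hx
    have := (hN i hi j hj x hx).le
    rwa [dist_eq_norm, ← eval_sub] at this
  rw [dist_eq_norm, ← eval_sub]
  linarith

/-- If `|A_n| ≤ ρ⁻ⁿ`, the numerators converge near each point of `E_μ(ρ)` along every subsequence
along which the denominators do. -/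
theorem exists_uniformCauchySeqOn_numerator (hS : IsCompact S) (hμ : μ Sᶜ = 0)
    (hα : ∀ n i, α n i ∈ S) (hdist : HasAsymptoticZeroDistribution α μ) {ρ : ℝ} (hρ : 0 < ρ)
    {P Q : ℕ → ℂ[X]} {A : ℕ → ℂ}
    (hQ : ∀ n, m ≤ n → IsNormalizedDenominator (Q n) ∧ (Q n).natDegree ≤ m)
    (hA : ∀ n, m ≤ n →
      P (n + 1) * Q n - P n * Q (n + 1) = C (A n) * nodePoly α (n + 1))
    (hAρ : ∀ᶠ n in atTop, ‖A n‖ ≤ (ρ ^ n)⁻¹) {φ : ℕ → ℕ} (hφ : StrictMono φ) {q : ℂ[X]}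
    (hq : ∀ K : Set ℂ, Bornology.IsBounded K →
      TendstoUniformlyOn (fun j z => (Q (φ j)).eval z) (fun z => q.eval z) atTop K)
    {z₀ : ℂ} (hz₀ : z₀ ∈ potentialSublevel μ (ENNReal.ofReal ρ)) {δ₀ : ℝ} (hδ₀ : 0 < δ₀) :
    ∃ t, 0 < t ∧ t < δ₀ ∧
      UniformCauchySeqOn (fun j z => (P (φ j)).eval z) atTop (Metric.closedBall z₀ t) := by
  obtain ⟨σ, hσ, hσρ, δ₁, hδ₁, hw⟩ := exists_forall_norm_nodePoly_le hS hμ hα hdist hρ hz₀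
  obtain ⟨t, ⟨ht0, htδ⟩, ht⟩ := exists_radius_forall_roots (m := m)
    ((eventually_ge_atTop m).mono fun n hn => (hQ n hn).2) z₀
    (lt_min hδ₀ hδ₁)
  refine ⟨t, ht0, htδ.trans_le (min_le_left _ _), uniformCauchySeqOn_closedBall_of_sphere ht0 ?_⟩
  set R : ℝ := ‖z₀‖ + t + 1 with hR
  have hR1 : 1 ≤ R := by have := norm_nonneg z₀; linarith
  have hzR : ∀ z ∈ Metric.sphere z₀ t, ‖z‖ ≤ R := by
    intro z hz
    rw [mem_sphere_iff_norm] at hz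
    have := norm_add_le (z - z₀) z₀
    rw [sub_add_cancel] at this
    linarith
  have hlow : ∀ᶠ k : ℕ in atTop, ∀ z ∈ Metric.sphere z₀ t,
      (1 / ((k : ℝ) + 1) ^ 2 / (2 * R)) ^ m ≤ ‖(Q k).eval z‖ := by
    filter_upwards [ht, eventually_ge_atTop m] with k hk hkm z hz
    refine (hQ k hkm).1.le_norm_eval (hQ k hkm).2 (hzR z hz) hR1 (by positivity) ?_
      (hk z (mem_sphere_iff_norm.1 hz))
    rw [div_le_one (by positivity)]
    exact one_le_pow₀ (by linarith [(Nat.cast_nonneg k : (0 : ℝ) ≤ k)])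
  obtain ⟨k₀, hk₀⟩ := eventually_atTop.1 (hlow.and (((tendsto_add_atTop_nat 1).eventually hw).and
    (hAρ.and (eventually_ge_atTop m))))
  have hQ0 : ∀ k, k₀ ≤ k → ∀ z ∈ Metric.sphere z₀ t, (Q k).eval z ≠ 0 := by
    intro k hk z hz h
    have := (hk₀ k hk).1 z hz
    rw [h, norm_zero] at this
    have h2 : 0 < (1 / ((k : ℝ) + 1) ^ 2 / (2 * R)) ^ m := by positivity
    linarith
  -- the approximants, with those of small index replaced by zero
  set p : ℕ → ℂ → ℂ := fun k z => if k < k₀ then 0 else (P k).eval z / (Q k).eval z with hp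
  have hpc : ∀ k, ContinuousOn (p k) (Metric.sphere z₀ t) := by
    intro k
    by_cases hk : k < k₀
    · simp only [hp, hk, if_true]; exact continuousOn_const
    · simp only [hp, hk, if_false]
      exact (P k).continuous.continuousOn.div (Q k).continuous.continuousOn
        (hQ0 k (not_lt.1 hk))
  have hdiff : ∀ᶠ k : ℕ in atTop, ∀ z ∈ Metric.sphere z₀ t, ‖p (k + 1) z - p k z‖ ≤
      σ * (2 * R) ^ (2 * m) * ((σ / ρ) ^ k * ((k : ℝ) + 2) ^ (4 * m)) := by
    filter_upwards [eventually_ge_atTop k₀] with k hk z hz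
    obtain ⟨h1, h2, h3, h4⟩ := hk₀ k hk
    have h1' := (hk₀ (k + 1) (by omega)).1 z hz
    have e1 := hQ0 k hk z hz
    have e2 := hQ0 (k + 1) (by omega) z hz
    have e3 := congrArg (eval z) (hA k h4)
    simp only [eval_sub, eval_mul, eval_C] at e3
    have e4 : p (k + 1) z - p k z =
        A k * (nodePoly α (k + 1)).eval z / ((Q k).eval z * (Q (k + 1)).eval z) := by
      simp only [hp, not_lt.2 hk, not_lt.2 (show k₀ ≤ k + 1 by omega), if_false]
      rw [← e3]
      field_simp
    have hzb : z ∈ Metric.ball z₀ δ₁ := by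
      rw [Metric.mem_ball, Metric.mem_sphere.1 hz]
      exact htδ.trans_le (min_le_right _ _)
    have h5 := h2 z hzb
    rw [e4, norm_div, norm_mul, norm_mul]
    have h6 : (1 / ((k : ℝ) + 2) ^ 2 / (2 * R)) ^ m ≤ ‖(Q k).eval z‖ := by
      refine le_trans ?_ (h1 z hz)
      gcongr
      norm_num
    have h7 : (1 / ((k : ℝ) + 2) ^ 2 / (2 * R)) ^ m ≤ ‖(Q (k + 1)).eval z‖ := by
      refine le_trans (le_of_eq ?_) h1'
      push_cast
      ring
    calc _ ≤ (ρ ^ k)⁻¹ * σ ^ (k + 1) /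
          ((1 / ((k : ℝ) + 2) ^ 2 / (2 * R)) ^ m * (1 / ((k : ℝ) + 2) ^ 2 / (2 * R)) ^ m) := by
          gcongr
      _ = _ := by
          rw [← mul_pow]
          have : (1 / ((k : ℝ) + 2) ^ 2 / (2 * R) * (1 / ((k : ℝ) + 2) ^ 2 / (2 * R))) =
            (((2 * R) ^ 2) * ((k : ℝ) + 2) ^ 4)⁻¹ := by field_simp
          rw [this, inv_pow, mul_pow, ← pow_mul, ← pow_mul, div_inv_eq_mul, div_pow, pow_succ]
          field_simp
  have hunif := tendstoUniformlyOn_tsum_nat_eventually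
    (summable_geometric_mul_pow (C := σ * (2 * R) ^ (2 * m)) (div_pos hσ hρ)
      ((div_lt_one hρ).2 hσρ) (4 * m)) hdiff
  set g : ℂ → ℂ := fun z => ∑' k, (p (k + 1) z - p k z) + p 0 z with hg
  have hpg : TendstoUniformlyOn p g atTop (Metric.sphere z₀ t) := by
    rw [Metric.tendstoUniformlyOn_iff] at hunif ⊢
    intro ε hε
    filter_upwards [hunif ε hε] with k hk z hz
    have := hk z hz
    rw [Finset.sum_range_sub (fun k => p k z), dist_eq_norm] at this
    rw [dist_eq_norm]
    convert this using 2
    simp only [hg]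
    ring
  have hgc : ContinuousOn g (Metric.sphere z₀ t) :=
    hpg.continuousOn (Frequently.of_forall hpc)
  have hsph : IsCompact (Metric.sphere z₀ t) := isCompact_sphere z₀ t
  have hpφ : TendstoUniformlyOn (fun j => p (φ j)) g atTop (Metric.sphere z₀ t) :=
    fun u hu => hφ.tendsto_atTop.eventually (hpg u hu)
  have hmul := hpφ.tendstoLocallyUniformlyOn.mul₀
    (hq _ hsph.isBounded).tendstoLocallyUniformlyOn hgc q.continuous.continuousOn
  rw [tendstoLocallyUniformlyOn_iff_tendstoUniformlyOn_of_compact hsph] at hmul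
  refine (hmul.congr ?_).uniformCauchySeqOn
  filter_upwards [hφ.tendsto_atTop.eventually (eventually_ge_atTop k₀)] with j hj z hz
  simp only [hp, Pi.mul_apply, not_lt.2 hj, if_false]
  exact div_mul_cancel₀ _ (hQ0 _ hj z hz)

end Numerators

/-! ### A continuation from decay of the coefficients -/

section InverseInequality

variable {S : Set ℂ} {μ : Measure ℂ} [IsProbabilityMeasure μ] {α : (n : ℕ) → Fin n → ℂ} {m : ℕ}

theorem tendsto_card_nodes_atTop (hS : IsCompact S) (hμ : μ Sᶜ = 0) (hα : ∀ n i, α n i ∈ S)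
    (hdist : HasAsymptoticZeroDistribution α μ) {z₀ : ℂ} (hz₀ : z₀ ∈ μ.support) {s : ℝ}
    (hs : 0 < s) :
    Tendsto (fun n => (Finset.univ.filter fun i => ‖α n i - z₀‖ < s).card) atTop atTop := by
  -- the averages of a bump function bound the proportion of nodes in the disc from below
  set φ : ℂ → ℝ := fun z => max 0 (1 - ‖z - z₀‖ / s) with hφ
  have hφc : Continuous φ := by fun_prop
  have hφ1 : ∀ z, φ z ≤ if ‖z - z₀‖ < s then 1 else 0 := by
    intro z
    split_ifs with h
    · exact max_le zero_le_one (by linarith [div_nonneg (norm_nonneg (z - z₀)) hs.le])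
    · refine max_le le_rfl ?_
      linarith [(one_le_div hs).2 (not_lt.1 h)]
  have hpos : 0 < ∫ z, φ z ∂μ := by
    rw [integral_pos_iff_support_of_nonneg (f := φ) (fun z => le_max_left _ _)
      (integrable_of_continuous_of_compl_null hS hμ hφc.continuousOn)]
    refine ((Measure.mem_support_iff_forall z₀).1 hz₀ _ (Metric.ball_mem_nhds z₀ hs)).trans_le
      (measure_mono fun z hz => ?_)
    have h1 : ‖z - z₀‖ / s < 1 := (div_lt_one hs).2 (mem_ball_iff_norm.1 hz)
    exact (lt_max_of_lt_right (by linarith : 0 < 1 - ‖z - z₀‖ / s)).ne'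
  have h1 := (hdist.tendsto_average hS hμ hα hφc).eventually (lt_mem_nhds (half_lt_self hpos))
  rw [← tendsto_natCast_atTop_iff (R := ℝ)]
  refine tendsto_atTop_mono' _ ?_ (tendsto_natCast_atTop_atTop.const_mul_atTop (half_pos hpos))
  filter_upwards [h1, eventually_gt_atTop 0] with n hn hn0
  have hn0' : (0 : ℝ) < n := Nat.cast_pos.2 hn0
  have h2 : ∑ i, φ (α n i) ≤ ((Finset.univ.filter fun i => ‖α n i - z₀‖ < s).card : ℝ) := by
    rw [Finset.card_filter, Nat.cast_sum]
    refine Finset.sum_le_sum fun i _ => (hφ1 _).trans_eq ?_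
    split_ifs <;> simp
  rw [inv_mul_eq_div, lt_div_iff₀ hn0'] at hn
  exact hn.le.trans h2

/-- A holomorphic function with many zeros near the centre of a disc is small there. -/
theorem norm_le_mul_pow_card_nodes {ι : Type*} [Fintype ι] {D k : ℂ → ℂ} {V : Set ℂ}
    (hk : DifferentiableOn ℂ k V) {z₀ : ℂ} {t M : ℝ} (ht : 0 < t)
    (hb : Metric.closedBall z₀ t ⊆ V) (a : ι → ℂ) (hD : ∀ z ∈ V, D z = k z * ∏ i, (z - a i))
    (hM : ∀ z ∈ Metric.sphere z₀ t, ‖D z‖ ≤ M) {z : ℂ} (hz : ‖z - z₀‖ < t / 4) :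
    ‖D z‖ ≤ M * (2 / 3) ^ (Finset.univ.filter fun i => ‖a i - z₀‖ < t / 4).card := by
  classical
  set I := Finset.univ.filter fun i => ‖a i - z₀‖ < t / 4 with hI
  have hI' : ∀ i ∈ I, ‖a i - z₀‖ < t / 4 := fun i hi => (Finset.mem_filter.1 hi).2
  -- `D` divided by its factors with zeros near the centre; on the circle these are at least
  -- `3 t / 4` in modulus, near the centre at most `t / 2`
  set g : ℂ → ℂ := fun z => k z * ∏ i ∈ Iᶜ, (z - a i) with hg
  have hDg : ∀ z ∈ V, D z = g z * ∏ i ∈ I, (z - a i) := by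
    intro z hz
    rw [hD z hz, ← Finset.prod_compl_mul_prod I, hg, mul_assoc]
  have hgd : DifferentiableOn ℂ g V := by
    refine hk.mul fun z _ => ?_
    exact (DifferentiableAt.fun_finsetProd fun i _ => by fun_prop).differentiableWithinAt
  have hgM : ‖g z‖ ≤ M / (3 * t / 4) ^ I.card := by
    refine Complex.norm_le_of_forall_mem_frontier_norm_le (U := Metric.ball z₀ t)
      Metric.isBounded_ball ?_ (fun x hx => ?_) ?_
    · refine (hgd.mono ?_).diffContOnCl
      rwa [closure_ball z₀ ht.ne']
    · rw [frontier_ball z₀ ht.ne'] at hx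
      rw [le_div_iff₀ (by positivity)]
      refine le_trans ?_ (hM x hx)
      rw [hDg x (hb (Metric.sphere_subset_closedBall hx)), norm_mul (g x), norm_prod]
      refine mul_le_mul_of_nonneg_left ?_ (norm_nonneg (g x))
      rw [← Finset.prod_const]
      refine Finset.prod_le_prod (fun _ _ => by positivity) fun i hi => ?_
      have h1 := norm_sub_norm_le (x - z₀) (a i - z₀)
      rw [sub_sub_sub_cancel_right, mem_sphere_iff_norm.1 hx] at h1
      linarith [hI' i hi]
    · rw [closure_ball z₀ ht.ne', mem_closedBall_iff_norm]
      linarith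
  have hzV : z ∈ V := hb (mem_closedBall_iff_norm.2 (by linarith))
  rw [hDg z hzV, norm_mul, norm_prod]
  calc ‖g z‖ * ∏ i ∈ I, ‖z - a i‖ ≤ M / (3 * t / 4) ^ I.card * (t / 2) ^ I.card := by
        refine mul_le_mul hgM ?_ (Finset.prod_nonneg fun i _ => norm_nonneg _)
          ((norm_nonneg _).trans hgM)
        rw [← Finset.prod_const]
        refine Finset.prod_le_prod (fun i _ => norm_nonneg _) fun i hi => ?_
        have h1 := norm_sub_le (z - z₀) (a i - z₀)
        rw [sub_sub_sub_cancel_right] at h1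
        linarith [hI' i hi]
    _ = _ := by
        rw [div_mul_eq_mul_div, mul_div_assoc, ← div_pow]
        congr 2
        field_simp
        norm_num

theorem meromorphicOrderAt_eval {q : ℂ[X]} (hq : q ≠ 0) (z : ℂ) :
    meromorphicOrderAt (fun x => q.eval x) z = q.rootMultiplicity z := by
  obtain ⟨p, hp, hpz⟩ := exists_eq_pow_rootMultiplicity_mul_and_not_dvd q hq z
  have h1 : (fun x => q.eval x) =
      (fun x => (x - z) ^ q.rootMultiplicity z) * fun x => p.eval x := by
    funext x
    conv_lhs => rw [hp]
    simp
  have hpa := p.differentiable.analyticAt z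
  have h2 : meromorphicOrderAt (fun x => p.eval x) z = 0 := by
    rw [hpa.meromorphicNFAt.meromorphicOrderAt_eq_zero_iff]
    rwa [dvd_iff_isRoot] at hpz
  rw [h1, meromorphicOrderAt_mul (by fun_prop) hpa.meromorphicAt, h2, add_zero]
  exact fun_meromorphicOrderAt_pow_id_sub_const

/-- The quotient of a holomorphic function by a nonzero polynomial of degree at most `m` has at
most `m` poles. -/
theorem isMeromorphicWithAtMost_toMeromorphicNFOn_div {U : Set ℂ} (hU : IsOpen U) {g : ℂ → ℂ}
    (hg : DifferentiableOn ℂ g U) {q : ℂ[X]} (hq : q ≠ 0) (hqm : q.natDegree ≤ m) :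
    MeromorphicOn (fun z => g z / q.eval z) U ∧
    IsMeromorphicWithAtMost (toMeromorphicNFOn (fun z => g z / q.eval z) U) U m := by
  classical
  have hga : ∀ z ∈ U, AnalyticAt ℂ g z := fun z hz => hg.analyticAt (hU.mem_nhds hz)
  have hqa : ∀ z, MeromorphicAt (fun x => q.eval x) z := fun z =>
    (q.differentiable.analyticAt z).meromorphicAt
  have hmer : MeromorphicOn (fun z => g z / q.eval z) U := fun z hz =>
    (hga z hz).meromorphicAt.div (hqa z)
  refine ⟨hmer, (meromorphicNFOn_toMeromorphicNFOn _ _).meromorphicOn, fun T hT => ?_⟩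
  have h1 : ∀ z ∈ T, max 0 (-(meromorphicOrderAt
      (toMeromorphicNFOn (fun z => g z / q.eval z) U) z).untop₀) ≤ (q.roots.count z : ℤ) := by
    intro z hz
    rw [meromorphicOrderAt_toMeromorphicNFOn hmer (hT hz), count_roots]
    have h2 : (fun z => g z / q.eval z) = g * (fun x => q.eval x)⁻¹ := by
      funext x; simp [div_eq_mul_inv]
    rw [h2, meromorphicOrderAt_mul (hga z (hT hz)).meromorphicAt (hqa z).inv,
      meromorphicOrderAt_inv, meromorphicOrderAt_eval hq]
    have h3 := (hga z (hT hz)).meromorphicOrderAt_nonneg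
    refine max_le (by positivity) ?_
    cases hgo : meromorphicOrderAt g z with
    | top => simp
    | coe k =>
      rw [hgo] at h3
      have h4 : (0 : ℤ) ≤ k := by exact_mod_cast h3
      have h5 : ((k : ℤ) : WithTop ℤ) + -((q.rootMultiplicity z : ℕ) : WithTop ℤ)
          = ((k - q.rootMultiplicity z : ℤ) : WithTop ℤ) := by
        rw [sub_eq_add_neg]; rfl
      rw [h5, WithTop.untop₀_coe]
      omega
  refine (Finset.sum_le_sum h1).trans ?_
  have h6 : ∑ z ∈ T, q.roots.count z ≤ q.roots.card := by
    calc ∑ z ∈ T, q.roots.count z ≤ ∑ z ∈ T ∪ q.roots.toFinset, q.roots.count z :=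
          Finset.sum_le_sum_of_subset Finset.subset_union_left
      _ = q.roots.card := Multiset.sum_count_eq_card fun a ha =>
          Finset.mem_union_right _ (Multiset.mem_toFinset.2 ha)
  exact_mod_cast h6.trans ((card_roots' q).trans hqm)

/-- The inverse half of the radius formula: along a subsequence the denominators converge to a
polynomial `q ≠ 0` and the numerators to a function `g` holomorphic on `E_μ(ρ)`. Near a point of
the support `q f - g` is the limit of functions with many zeros, hence it vanishes there. -/
theorem hasMeromorphicContinuation_support_of_norm_le (hS : IsCompact S) (hμ : μ Sᶜ = 0)
    (hα : ∀ n i, α n i ∈ S) (hdist : HasAsymptoticZeroDistribution α μ) {V : Set ℂ}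
    (hV : IsOpen V) (hSV : S ⊆ V) {f : ℂ → ℂ} (hf : DifferentiableOn ℂ f V) {ρ : ℝ} (hρ : 0 < ρ)
    {P Q : ℕ → ℂ[X]} {A : ℕ → ℂ}
    (hPQ : ∀ n, m ≤ n → IsPadePair f V α n m (P n) (Q n) ∧ IsNormalizedDenominator (Q n))
    (hA : ∀ n, m ≤ n →
      P (n + 1) * Q n - P n * Q (n + 1) = C (A n) * nodePoly α (n + 1))
    (hAρ : ∀ᶠ n in atTop, ‖A n‖ ≤ (ρ ^ n)⁻¹) :
    HasMeromorphicContinuation f μ.support (potentialSublevel μ (ENNReal.ofReal ρ)) m := by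
  set E := potentialSublevel μ (ENNReal.ofReal ρ) with hE
  have hEo : IsOpen E := isOpen_potentialSublevel hS hμ hρ
  have hQ : ∀ n, m ≤ n → IsNormalizedDenominator (Q n) ∧ (Q n).natDegree ≤ m := fun n hn =>
    ⟨(hPQ n hn).2, (hPQ n hn).1.2.1⟩
  obtain ⟨φ, q, hφ, hφm, hq0, hqm, hqc⟩ := exists_subseq_tendsto_coeff hQ
  have hqu : ∀ K : Set ℂ, Bornology.IsBounded K →
      TendstoUniformlyOn (fun j z => (Q (φ j)).eval z) (fun z => q.eval z) atTop K := fun K hK =>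
    tendstoUniformlyOn_eval_of_tendsto_coeff (fun j => (hQ _ (hφm j)).2) hqm hqc hK
  have hcau : ∀ z₀ ∈ E, ∀ δ > 0, ∃ t, 0 < t ∧ t < δ ∧
      UniformCauchySeqOn (fun j z => (P (φ j)).eval z) atTop (Metric.closedBall z₀ t) :=
    fun z₀ hz₀ δ hδ => exists_uniformCauchySeqOn_numerator hS hμ hα hdist hρ hQ hA hAρ hφ hqu hz₀ hδ
  have hlim : ∀ z ∈ E, ∃ y, Tendsto (fun j => (P (φ j)).eval z) atTop (𝓝 y) := by
    intro z hz
    obtain ⟨t, ht, -, h⟩ := hcau z hz 1 one_pos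
    exact cauchySeq_tendsto_of_complete (h.cauchySeq (Metric.mem_closedBall_self ht.le))
  choose! g hg using hlim
  have hunif : ∀ z₀ ∈ E, ∀ δ > 0, ∃ t, 0 < t ∧ t < δ ∧ Metric.closedBall z₀ t ⊆ E ∧
      TendstoUniformlyOn (fun j z => (P (φ j)).eval z) g atTop (Metric.closedBall z₀ t) := by
    intro z₀ hz₀ δ hδ
    obtain ⟨ε, hε, hεE⟩ := Metric.isOpen_iff.1 hEo z₀ hz₀
    obtain ⟨t, ht, htδ, h⟩ := hcau z₀ hz₀ (min δ ε) (lt_min hδ hε)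
    have hsub : Metric.closedBall z₀ t ⊆ E :=
      (Metric.closedBall_subset_ball (htδ.trans_le (min_le_right _ _))).trans hεE
    exact ⟨t, ht, htδ.trans_le (min_le_left _ _), hsub,
      h.tendstoUniformlyOn_of_tendsto fun z hz => hg z (hsub hz)⟩
  have hgd : DifferentiableOn ℂ g E := by
    refine TendstoLocallyUniformlyOn.differentiableOn (φ := atTop)
      (F := fun j z => (P (φ j)).eval z) (fun u hu z hz => ?_)
      (Eventually.of_forall fun j => (P (φ j)).differentiable.differentiableOn) hEo
    obtain ⟨t, ht, -, -, h⟩ := hunif z hz 1 one_pos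
    exact ⟨_, mem_nhdsWithin_of_mem_nhds (Metric.closedBall_mem_nhds z ht), h u hu⟩
  obtain ⟨hmer, hF⟩ := isMeromorphicWithAtMost_toMeromorphicNFOn_div hEo hgd hq0 hqm
  refine ⟨_, hF, fun z₀ hz₀ => ?_⟩
  have hz₀S : z₀ ∈ S := Measure.support_subset_of_isClosed hS.isClosed
    (mem_ae_iff.2 hμ) hz₀.1
  obtain ⟨δ, hδ, hδV⟩ := Metric.isOpen_iff.1 hV z₀ (hSV hz₀S)
  obtain ⟨t, ht, htδ, htE, htu⟩ := hunif z₀ hz₀.2 δ hδ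
  have htV : Metric.closedBall z₀ t ⊆ V := (Metric.closedBall_subset_ball htδ).trans hδV
  -- the functions `Q_n f - P_n` are bounded on the disc and have many zeros in it
  have hzero : ∀ z, ‖z - z₀‖ < t / 4 → q.eval z * f z - g z = 0 := by
    intro z hz
    have hzb : z ∈ Metric.closedBall z₀ t := mem_closedBall_iff_norm.2 (by linarith)
    obtain ⟨M₁, hM₁⟩ := (isCompact_closedBall z₀ t).exists_bound_of_continuousOn
      (hf.continuousOn.mono htV)
    obtain ⟨M₂, hM₂⟩ := (isCompact_closedBall z₀ t).exists_bound_of_continuousOn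
      (hgd.continuousOn.mono htE)
    have hcard := (tendsto_card_nodes_atTop hS hμ hα hdist hz₀.1 (s := t / 4) (by positivity)).comp
      ((tendsto_add_atTop_nat 1).comp hφ.tendsto_atTop)
    have hsmall := ((tendsto_pow_atTop_nhds_zero_of_lt_one (r := (2 / 3 : ℝ)) (by norm_num)
      (by norm_num)).comp hcard).const_mul ((1 + (‖z₀‖ + t)) ^ m * M₁ + (M₂ + 1))
    rw [mul_zero] at hsmall
    have hconv : Tendsto (fun j => (Q (φ j)).eval z * f z - (P (φ j)).eval z) atTop
        (𝓝 (q.eval z * f z - g z)) :=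
      (((hqu _ Metric.isBounded_closedBall).tendsto_at hzb).mul_const _).sub (htu.tendsto_at hzb)
    refine tendsto_nhds_unique hconv (squeeze_zero_norm' ?_ hsmall)
    filter_upwards [(Metric.tendstoUniformlyOn_iff.1 htu) 1 one_pos] with j hj
    obtain ⟨⟨-, -, -, k, hk, hke⟩, hnorm⟩ := hPQ (φ j) (hφm j)
    refine norm_le_mul_pow_card_nodes (D := fun z => (Q (φ j)).eval z * f z - (P (φ j)).eval z) hk
      ht htV (α (φ j + 1)) (fun z hz => by rw [hke z hz, nodePoly_eval]) (fun x hx => ?_) hz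
    have hxb := Metric.sphere_subset_closedBall hx
    refine (norm_sub_le _ _).trans (add_le_add ?_ ?_)
    · rw [norm_mul]
      refine mul_le_mul (hnorm.norm_eval_le (hQ _ (hφm j)).2 ?_) (hM₁ x hxb) (norm_nonneg _)
        (by positivity)
      have := norm_add_le (x - z₀) z₀
      rw [sub_add_cancel, mem_sphere_iff_norm.1 hx] at this
      linarith
    · have h1 := hj x hxb
      rw [dist_eq_norm, norm_sub_rev] at h1
      have h2 := norm_add_le ((P (φ j)).eval x - g x) (g x)
      rw [sub_add_cancel] at h2
      linarith [hM₂ x hxb]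
  refine ((meromorphicNFOn_toMeromorphicNFOn _ _ hz₀.2).eventuallyEq_nhdsNE_iff_eventuallyEq_nhds
    (hf.analyticAt (hV.mem_nhds (hSV hz₀S))).meromorphicNFAt).1 ?_
  have hqne : ∀ᶠ x in 𝓝[≠] z₀, q.eval x ≠ 0 := by
    have h1 : {x | q.eval x = 0}.Finite := by
      refine (q.roots.toFinset.finite_toSet).subset fun x hx => ?_
      simpa [hq0] using hx
    have h3 : ({x | q.eval x = 0} \ {z₀}).Finite := h1.subset Set.sdiff_subset
    have h4 : ({x | q.eval x = 0} \ {z₀})ᶜ ∈ 𝓝 z₀ :=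
      h3.isClosed.isOpen_compl.mem_nhds fun h => h.2 rfl
    filter_upwards [nhdsWithin_le_nhds h4, self_mem_nhdsWithin] with x hx hx' h
    exact hx ⟨h, hx'⟩
  have hball : Metric.ball z₀ (t / 4) ∈ 𝓝[≠] z₀ :=
    nhdsWithin_le_nhds (Metric.ball_mem_nhds z₀ (by positivity))
  filter_upwards [hmer.toMeromorphicNFOn_eq_self_on_nhdsNE hz₀.2, hqne, hball] with x h1 h2 h3
  rw [h1, div_eq_iff h2, ← sub_eq_zero.1 (hzero x (mem_ball_iff_norm.1 h3)), mul_comm]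

end InverseInequality

/-! ### The radius of meromorphy -/

theorem potentialInf_lt_iff {S : Set ℂ} {μ : Measure ℂ} {r : ℝ≥0∞} :
    potentialInf S μ < r ↔ (S ∩ potentialSublevel μ r).Nonempty := by
  simp only [potentialInf, iInf_lt_iff, exists_prop]
  rfl

theorem le_meromorphyRadius {S : Set ℂ} {μ : Measure ℂ} {f : ℂ → ℂ} {m : ℕ} {r : ℝ}
    (hr : (S ∩ potentialSublevel μ (ENNReal.ofReal r)).Nonempty)
    (h : HasMeromorphicContinuation f S (potentialSublevel μ (ENNReal.ofReal r)) m) :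
    ENNReal.ofReal r ≤ meromorphyRadius S μ f m :=
  le_iSup₂_of_le r.toNNReal ⟨potentialInf_lt_iff.2 hr, h⟩ le_rfl

section Radius

variable {S : Set ℂ} {μ : Measure ℂ} [IsProbabilityMeasure μ] {α : (n : ℕ) → Fin n → ℂ} {m : ℕ}
  {V : Set ℂ} {f : ℂ → ℂ}

theorem enorm_rpow_le_inv_ofReal_iff {a : ℂ} {ρ : ℝ} (hρ : 0 < ρ) {n : ℕ} (hn : 0 < n) :
    ‖a‖ₑ ^ (1 / (n : ℝ)) ≤ (ENNReal.ofReal ρ)⁻¹ ↔ ‖a‖ ≤ (ρ ^ n)⁻¹ := by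
  rw [one_div, ENNReal.rpow_inv_le_iff (Nat.cast_pos.2 hn), ENNReal.rpow_natCast,
    ← ENNReal.ofReal_inv_of_pos hρ, ← ENNReal.ofReal_pow (inv_nonneg.2 hρ.le), inv_pow,
    ← ofReal_norm, ENNReal.ofReal_le_ofReal_iff (by positivity)]

theorem limsup_enorm_rpow_le {A : ℕ → ℂ} {ρ : ℝ} (hρ : 0 < ρ)
    (h : ∀ᶠ n in atTop, ‖A n‖ ≤ (ρ ^ n)⁻¹) :
    limsup (fun n : ℕ => ‖A n‖ₑ ^ (1 / (n : ℝ))) atTop ≤ (ENNReal.ofReal ρ)⁻¹ := by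
  refine limsup_le_of_le (by isBoundedDefault) ?_
  filter_upwards [h, eventually_gt_atTop 0] with n hn hn0
  exact (enorm_rpow_le_inv_ofReal_iff hρ hn0).2 hn

theorem eventually_norm_le_of_limsup_lt {A : ℕ → ℂ} {ρ : ℝ} (hρ : 0 < ρ)
    (h : limsup (fun n : ℕ => ‖A n‖ₑ ^ (1 / (n : ℝ))) atTop < (ENNReal.ofReal ρ)⁻¹) :
    ∀ᶠ n in atTop, ‖A n‖ ≤ (ρ ^ n)⁻¹ := by
  filter_upwards [eventually_lt_of_limsup_lt h, eventually_gt_atTop 0] with n hn hn0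
  exact (enorm_rpow_le_inv_ofReal_iff hρ hn0).1 hn.le

theorem hasMeromorphicContinuation_self (hV : IsOpen V) (hf : DifferentiableOn ℂ f V)
    {U A : Set ℂ} (hU : U ⊆ V) : HasMeromorphicContinuation f A U m := by
  have hfa : ∀ z ∈ U, AnalyticAt ℂ f z := fun z hz => hf.analyticAt (hV.mem_nhds (hU hz))
  refine ⟨f, ⟨fun z hz => (hfa z hz).meromorphicAt, fun T hT => ?_⟩, fun z _ => EventuallyEq.rfl⟩
  rw [Finset.sum_eq_zero]
  · positivity
  · intro z hz
    have h1 := (hfa z (hT hz)).meromorphicOrderAt_nonneg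
    refine max_eq_left ?_
    cases h : meromorphicOrderAt f z with
    | top => simp
    | coe k =>
      rw [h] at h1
      have h4 : (0 : ℤ) ≤ k := by exact_mod_cast h1
      simpa using h4

/-- The sublevel sets contained in `V` are admissible: the radius exceeds `r₀`. -/
theorem exists_ofReal_le_meromorphyRadius (hS : IsCompact S) (hμ : μ Sᶜ = 0)
    (hSc : IsConnected Sᶜ) (hα : ∀ n i, α n i ∈ S) (hdist : HasAsymptoticZeroDistribution α μ)
    (hV : IsOpen V) (hSV : S ⊆ V) (hf : DifferentiableOn ℂ f V) :
    ∃ r, 0 < r ∧ potentialInf S μ < ENNReal.ofReal r ∧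
      ENNReal.ofReal r ≤ meromorphyRadius S μ f m := by
  obtain ⟨r, hr, hne, hrV⟩ := exists_potentialSublevel_subset hS hμ hSc hα hdist hV hSV
  exact ⟨r, hr, potentialInf_lt_iff.2 hne,
    le_meromorphyRadius hne (hasMeromorphicContinuation_self hV hf hrV)⟩

/-- The Cauchy–Hadamard formula for the radius of `m`-meromorphy. -/
theorem inv_meromorphyRadius_eq_limsup (hS : IsCompact S) (hSc : IsConnected Sᶜ) (hμ : μ Sᶜ = 0)
    (hV : IsOpen V) (hSV : S ⊆ V) (hf : DifferentiableOn ℂ f V) (hα : ∀ n i, α n i ∈ S)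
    (hnewton : IsNewtonianTable α) (hdist : HasAsymptoticZeroDistribution α μ)
    (hsingle : ∀ r : ℝ≥0, potentialInf S μ < r →
      HasMeromorphicContinuation f μ.support (potentialSublevel μ r) m →
      HasMeromorphicContinuation f S (potentialSublevel μ r) m)
    {P Q : ℕ → ℂ[X]} (hPQ : ∀ n, m ≤ n → IsPadePair f V α n m (P n) (Q n) ∧
      IsNormalizedDenominator (Q n)) :
    (meromorphyRadius S μ f m)⁻¹ = limsup (fun n : ℕ =>
      ‖(P (n + 1)).coeff (n + 1 - m) * (Q n).coeff m‖ₑ ^ (1 / (n : ℝ))) atTop := by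
  set A : ℕ → ℂ := fun n => (P (n + 1)).coeff (n + 1 - m) * (Q n).coeff m with hA
  set L := limsup (fun n : ℕ => ‖A n‖ₑ ^ (1 / (n : ℝ))) atTop with hL
  refine le_antisymm ?_ ?_
  · refine ENNReal.inv_le_iff_inv_le.1 (le_of_forall_lt_imp_le_of_dense fun c hc => ?_)
    have hctop : c ≠ ⊤ := hc.ne_top
    rcases eq_or_ne c 0 with rfl | hc0
    · exact zero_le
    have hcr : ENNReal.ofReal c.toReal = c := ENNReal.ofReal_toReal hctop
    have hr : 0 < c.toReal := ENNReal.toReal_pos hc0 hctop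
    by_cases hinf : potentialInf S μ < c
    · have hcont := hasMeromorphicContinuation_support_of_norm_le hS hμ hα hdist hV hSV hf hr hPQ
        (A := A) (fun n hn => IsPadePair.mul_sub_mul_eq hV (fun n i => hSV (hα n i)) hnewton hn
          (hPQ n hn).1 (hPQ (n + 1) (by omega)).1)
        (eventually_norm_le_of_limsup_lt hr (by rw [hcr]; exact ENNReal.lt_inv_iff_lt_inv.1 hc))
      rw [← hcr]
      rw [← hcr] at hinf
      exact le_meromorphyRadius (potentialInf_lt_iff.1 hinf) (hsingle _ hinf hcont)
    -- for levels up to `r₀` single-valuedness is not assumed, but `f` itself reaches beyond `r₀`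
    · obtain ⟨r, -, hr1, hr2⟩ := exists_ofReal_le_meromorphyRadius (m := m) hS hμ hSc hα hdist
        hV hSV hf
      exact (not_lt.1 hinf).trans (hr1.le.trans hr2)
  · refine ENNReal.le_inv_iff_le_inv.1 (iSup₂_le fun r hr => ?_)
    refine le_of_forall_lt_imp_le_of_dense fun c hc => ?_
    have hctop : c ≠ ⊤ := hc.ne_top
    rcases eq_or_ne c 0 with rfl | hc0
    · exact zero_le
    have hcr : ENNReal.ofReal c.toReal = c := ENNReal.ofReal_toReal hctop
    have hρ : 0 < c.toReal := ENNReal.toReal_pos hc0 hctop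
    have hcr' : c.toReal < r := (ENNReal.toReal_lt_toReal hctop ENNReal.coe_ne_top).2 hc
    have h1 := eventually_norm_coeff_mul_coeff_le hS hμ hα hdist hV hSV hf hρ hcr'
      (by rw [ENNReal.ofReal_coe_nnreal]; exact hr.2) hPQ
    have h2 := limsup_enorm_rpow_le hρ h1
    rw [hcr] at h2
    exact ENNReal.le_inv_iff_le_inv.1 h2

end Radius

/-! ### Divergence outside the set of meromorphy -/

section Divergence

variable {S : Set ℂ} {μ : Measure ℂ} [IsProbabilityMeasure μ] {α : (n : ℕ) → Fin n → ℂ} {m : ℕ}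
  {V : Set ℂ} {f : ℂ → ℂ}

theorem eval_eq_of_sphereValue_eq {P Q : ℂ[X]} (hQ : Q ≠ 0) {z v : ℂ}
    (h : sphereValue (ratQuot P Q) z = (v : OnePoint ℂ)) : P.eval z = v * Q.eval z := by
  rw [sphereValue] at h
  split_ifs at h with hd
  · exact absurd h (OnePoint.infty_ne_coe v)
  · have h1 : (ratQuot P Q).num.eval z / (ratQuot P Q).denom.eval z = v := OnePoint.coe_injective h
    have h2 := congrArg (eval z) ((RatFunc.num_mul_eq_mul_denom_iff hQ).2 rfl :
      (ratQuot P Q).num * Q = P * (ratQuot P Q).denom)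
    rw [eval_mul, eval_mul] at h2
    rw [← h1]
    field_simp
    exact h2.symm

theorem ratQuot_C_mul_C_mul {c : ℂ} (hc : c ≠ 0) (P Q : ℂ[X]) :
    ratQuot (C c * P) (C c * Q) = ratQuot P Q := by
  rw [ratQuot, ratQuot, map_mul, map_mul, mul_div_mul_left]
  exact (map_ne_zero_iff _ (RatFunc.algebraMap_injective ℂ)).2 (C_ne_zero.2 hc)

theorem ratQuot_sub_ratQuot {P Q P' Q' W : ℂ[X]} (hQ : Q ≠ 0) (hQ' : Q' ≠ 0)
    (h : P' * Q - P * Q' = W) : ratQuot P' Q' - ratQuot P Q = ratQuot W (Q * Q') := by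
  have h1 := (map_ne_zero_iff _ (RatFunc.algebraMap_injective ℂ)).2 hQ
  have h2 := (map_ne_zero_iff _ (RatFunc.algebraMap_injective ℂ)).2 hQ'
  simp only [ratQuot]
  rw [← h, map_sub, map_mul, map_mul, map_mul]
  field_simp

/-- Off `S` and the closure of `E_μ(r)` the potential exceeds its value on the boundary, because
it has no local minimum there. -/
theorem log_lt_integral_log_of_notMem_closure (hS : IsCompact S) (hμ : μ Sᶜ = 0)
    (hSc : IsConnected Sᶜ) {r : ℝ} (hr : 0 < r) {z : ℂ} (hzS : z ∉ S)
    (hz : z ∉ closure (potentialSublevel μ (ENNReal.ofReal r))) :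
    Real.log r < ∫ ζ, Real.log ‖z - ζ‖ ∂μ := by
  by_contra! h
  refine not_isLocalMin_integral_log hS hμ hSc hzS ?_
  filter_upwards [isClosed_closure.isOpen_compl.mem_nhds hz, hS.isClosed.isOpen_compl.mem_nhds hzS]
    with x hx hxS
  refine h.trans (not_lt.1 fun hlt => hx (subset_closure ?_))
  exact (mem_potentialSublevel_iff_of_notMem hS hμ hr hxS).2 hlt

theorem potentialSublevel_top (hS : IsCompact S) (hμ : μ Sᶜ = 0) :
    potentialSublevel μ ⊤ = Set.univ := by
  refine Set.eq_univ_of_forall fun z => ?_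
  refine potentialSublevel_mono (le_top (a := ENNReal.ofReal (Real.exp (truncPotential μ 1 z + 1))))
    ((mem_potentialSublevel_iff hS hμ (Real.exp_pos _) z).2 ⟨1, one_pos, ?_⟩)
  rw [Real.log_exp]
  linarith

/-- Convergence of the values at `z` bounds `A_n w_{n+1}(z)`, while `|w_{n+1}(z)|` grows faster
than `R_{μ,m}ⁿ` and `|A_n|` decays no faster than `R_{μ,m}⁻ⁿ`. -/
theorem not_exists_tendsto_sphereValue (hS : IsCompact S) (hSc : IsConnected Sᶜ) (hμ : μ Sᶜ = 0)
    (hV : IsOpen V) (hSV : S ⊆ V) (hf : DifferentiableOn ℂ f V) (hα : ∀ n i, α n i ∈ S)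
    (hnewton : IsNewtonianTable α) (hdist : HasAsymptoticZeroDistribution α μ)
    (hsingle : ∀ r : ℝ≥0, potentialInf S μ < r →
      HasMeromorphicContinuation f μ.support (potentialSublevel μ r) m →
      HasMeromorphicContinuation f S (potentialSublevel μ r) m)
    {P Q : ℕ → ℂ[X]} (hPQ : ∀ n, m ≤ n → IsPadePair f V α n m (P n) (Q n) ∧
      IsNormalizedDenominator (Q n)) {z : ℂ} (hzS : z ∉ S)
    (hz : z ∉ closure (meromorphySet S μ f m)) :
    ¬ ∃ L : ℂ, Tendsto (fun n => sphereValue (ratQuot (P n) (Q n)) z) atTop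
      (𝓝 (L : OnePoint ℂ)) := by
  rintro ⟨L, hL⟩
  set R := meromorphyRadius S μ f m with hR
  have hRtop : R ≠ ⊤ := fun h => hz (by
    rw [meromorphySet, ← hR, h, potentialSublevel_top hS hμ]
    exact subset_closure (Set.mem_univ z))
  have hR0 : 0 < R.toReal := by
    obtain ⟨r, hr, -, hr2⟩ := exists_ofReal_le_meromorphyRadius (m := m) hS hμ hSc hα hdist
      hV hSV hf
    exact ENNReal.toReal_pos ((ENNReal.ofReal_pos.2 hr).trans_le hr2).ne' hRtop
  have hRr : ENNReal.ofReal R.toReal = R := ENNReal.ofReal_toReal hRtop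
  have hlog : Real.log R.toReal < ∫ ζ, Real.log ‖z - ζ‖ ∂μ :=
    log_lt_integral_log_of_notMem_closure hS hμ hSc hR0 hzS (by rw [hRr]; exact hz)
  set r := Real.exp (∫ ζ, Real.log ‖z - ζ‖ ∂μ)
  have hRr' : R.toReal < r := (Real.log_lt_iff_lt_exp hR0).1 hlog
  obtain ⟨σ, hRσ, hσr⟩ := exists_between hRr'
  obtain ⟨ρ, hRρ, hρσ⟩ := exists_between hRσ
  have hρ : 0 < ρ := hR0.trans hRρ
  have hσ : 0 < σ := hρ.trans hρσ
  obtain ⟨δ, hδ, hw⟩ := exists_forall_le_norm_nodePoly hS hμ hα hdist hσ hσr hzS (by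
    rw [mem_potentialSublevel_iff_of_notMem hS hμ (Real.exp_pos _) hzS, Real.log_exp]
    exact lt_irrefl _)
  have hval : ∀ᶠ n in atTop, ∃ v : ℂ, ‖v‖ < ‖L‖ + 1 ∧
      sphereValue (ratQuot (P n) (Q n)) z = (v : OnePoint ℂ) := by
    refine hL.eventually (p := fun x => ∃ v : ℂ, ‖v‖ < ‖L‖ + 1 ∧ x = (v : OnePoint ℂ)) ?_
    rw [OnePoint.nhds_coe_eq, eventually_map]
    filter_upwards [Metric.ball_mem_nhds L one_pos] with v hv
    refine ⟨v, ?_, rfl⟩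
    have := norm_add_le (v - L) L
    rw [sub_add_cancel] at this
    linarith [mem_ball_iff_norm.1 hv]
  have hbound : ∀ᶠ n in atTop, ‖(P (n + 1)).coeff (n + 1 - m) * (Q n).coeff m‖ ≤ (ρ ^ n)⁻¹ := by
    refine eventually_le_inv_pow_of_le_div_pow
      (C := (2 * (‖L‖ + 1) * ((1 + ‖z‖) ^ m * (1 + ‖z‖) ^ m)) / σ) hρ hρσ ?_
    filter_upwards [hval, (tendsto_add_atTop_nat 1).eventually hval,
      (tendsto_add_atTop_nat 1).eventually hw, eventually_ge_atTop m] with n h1 h2 h3 hmn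
    obtain ⟨v, hv, hPv⟩ := h1
    obtain ⟨v', hv', hPv'⟩ := h2
    have hn := hPQ n hmn
    have hn' := hPQ (n + 1) (by omega)
    have e := congrArg (eval z) (IsPadePair.mul_sub_mul_eq hV (fun n i => hSV (hα n i)) hnewton hmn
      hn.1 hn'.1)
    rw [eval_sub, eval_mul, eval_mul, eval_mul, eval_C, eval_eq_of_sphereValue_eq hn.1.2.2.1 hPv,
      eval_eq_of_sphereValue_eq hn'.1.2.2.1 hPv'] at e
    have e' : ‖(P (n + 1)).coeff (n + 1 - m) * (Q n).coeff m‖ * ‖(nodePoly α (n + 1)).eval z‖ =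
        ‖v' - v‖ * (‖(Q n).eval z‖ * ‖(Q (n + 1)).eval z‖) := by
      rw [← norm_mul, ← e, ← norm_mul, ← norm_mul]
      congr 1
      ring
    rw [div_div, le_div_iff₀ (by positivity), ← pow_succ']
    calc _ ≤ ‖(P (n + 1)).coeff (n + 1 - m) * (Q n).coeff m‖ *
          ‖(nodePoly α (n + 1)).eval z‖ :=
          mul_le_mul_of_nonneg_left (h3 z (Metric.mem_ball_self hδ)) (norm_nonneg _)
      _ ≤ _ := by
          rw [e']
          have h4 : ‖v' - v‖ ≤ 2 * (‖L‖ + 1) := (norm_sub_le _ _).trans (by linarith)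
          exact mul_le_mul h4 (mul_le_mul (hn.2.norm_eval_le hn.1.2.1 le_rfl)
            (hn'.2.norm_eval_le hn'.1.2.1 le_rfl) (norm_nonneg _) (by positivity))
            (by positivity) (by positivity)
  have h1 := limsup_enorm_rpow_le hρ hbound
  rw [← inv_meromorphyRadius_eq_limsup hS hSc hμ hV hSV hf hα hnewton hdist hsingle hPQ,
    ENNReal.inv_le_inv, ← hR, ← hRr, ENNReal.ofReal_le_ofReal_iff hR0.le] at h1
  linarith

end Divergence

theorem mainTheorem3
    (S : Set ℂ) (hS : IsCompact S) (hSc : IsConnected Sᶜ)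
    (μ : Measure ℂ) [IsProbabilityMeasure μ] (hμ : μ Sᶜ = 0)
    (V : Set ℂ) (hV : IsOpen V) (hSV : S ⊆ V)
    (f : ℂ → ℂ) (hf : DifferentiableOn ℂ f V)
    (α : (n : ℕ) → Fin n → ℂ) (hα : ∀ n i, α n i ∈ S)
    (hnewton : IsNewtonianTable α)
    (hdist : HasAsymptoticZeroDistribution α μ)
    (m : ℕ)
    -- continuations from the support of `μ` do not conflict with the values of `f` near `S`
    (hsingle : ∀ r : ℝ≥0, potentialInf S μ < r →
      HasMeromorphicContinuation f μ.support (potentialSublevel μ r) m →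
      HasMeromorphicContinuation f S (potentialSublevel μ r) m) :
    -- the approximants exist
    (∀ n, m ≤ n → ∃ P Q : ℂ[X], IsPadePair f V α n m P Q ∧ IsNormalizedDenominator Q) ∧
    -- the row diverges at every point outside the closure of the set of `m`-meromorphy and `S`
    (∀ P Q : ℕ → ℂ[X], (∀ n, m ≤ n → IsPadePair f V α n m (P n) (Q n)) →
      ∀ z : ℂ, z ∉ closure (meromorphySet S μ f m) ∪ S →
        ¬ ∃ L : ℂ, Tendsto (fun n => sphereValue (ratQuot (P n) (Q n)) z) atTop
          (𝓝 (L : OnePoint ℂ))) ∧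
    -- the formula for the radius of `m`-meromorphy
    (∀ P Q : ℕ → ℂ[X],
      (∀ n, m ≤ n → IsPadePair f V α n m (P n) (Q n) ∧ IsNormalizedDenominator (Q n)) →
      ∃ A : ℕ → ℂ,
        (∀ n, m ≤ n →
          ratQuot (P (n + 1)) (Q (n + 1)) - ratQuot (P n) (Q n) =
            ratQuot (C (A n) * nodePoly α (n + 1)) (Q n * Q (n + 1))) ∧
        (meromorphyRadius S μ f m)⁻¹ =
          limsup (fun n : ℕ => ‖A n‖ₑ ^ (1 / (n : ℝ))) atTop) := by
  have hαV : ∀ n i, α n i ∈ V := fun n i => hSV (hα n i)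
  refine ⟨fun n hn => ?_, fun P Q hPQ z hz => ?_, fun P Q hPQ => ?_⟩
  · obtain ⟨P, Q, h⟩ := exists_isPadePair hV hf hαV hn
    obtain ⟨c, hc, hQ⟩ := exists_isNormalizedDenominator_C_mul h.2.2.1
    exact ⟨C c * P, C c * Q, h.C_mul hc, hQ⟩
  · have hc : ∀ n, ∃ c : ℂ, c ≠ 0 ∧ (m ≤ n → IsNormalizedDenominator (C c * Q n)) := by
      intro n
      by_cases hn : m ≤ n
      · obtain ⟨c, hc, hQ⟩ := exists_isNormalizedDenominator_C_mul (hPQ n hn).2.2.1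
        exact ⟨c, hc, fun _ => hQ⟩
      · exact ⟨1, one_ne_zero, fun h => absurd h hn⟩
    choose c hc hcQ using hc
    have h := not_exists_tendsto_sphereValue hS hSc hμ hV hSV hf hα hnewton hdist hsingle
      (P := fun n => C (c n) * P n) (Q := fun n => C (c n) * Q n)
      (fun n hn => ⟨(hPQ n hn).C_mul (hc n), hcQ n hn⟩) (fun h => hz (Or.inr h))
      (fun h => hz (Or.inl h))
    simpa only [ratQuot_C_mul_C_mul (hc _)] using h
  · refine ⟨fun n => (P (n + 1)).coeff (n + 1 - m) * (Q n).coeff m, fun n hn => ?_,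
      inv_meromorphyRadius_eq_limsup hS hSc hμ hV hSV hf hα hnewton hdist hsingle hPQ⟩
    have hn' := (hPQ (n + 1) (by omega)).1
    exact ratQuot_sub_ratQuot (hPQ n hn).1.2.2.1 hn'.2.2.1
      (IsPadePair.mul_sub_mul_eq hV hαV hnewton hn (hPQ n hn).1 hn')
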